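/- For $d\ge 0$ and $\mathbf n=(n_1,\dots,n_d)\in\mathbb N^d$ (all $n_i\ge 1$), with $|\mathbf n|=n_1+\cdots+n_d$, let $$\mathrm{Li}_{\mathbf n}(\mathbf z)=\sum_{0<k_1<\cdots<k_d}\frac{z_1^{k_1}\cdots z_d^{k_d}}{k_1^{n_1}\cdots k_d^{n_d}}$$ for $\mathbf z$ near $0$, and extend $\mathrm{Li}_{\mathbf n}$ by analytic continuation along the straight path $t\mapsto t\mathbf z$, $t\in[0,1]$, to all $\mathbf z$ in $$U_d=\{\mathbf z\in\mathbb C^d:\ z_iz_{i+1}\cdots z_j\notin[0,\infty)\ \text{for all } 1\le i\le j\le d\}$$ (this continuation exists for every $\mathbf z\in U_d$). Put $$\mathrm{PLi}_{\mathbf n}(\mathbf z)=\mathrm{Li}_{\mathbf n}(\mathbf z)-(-1)^{|\mathbf n|-d}\,\mathrm{Li}_{\mathbf n}(1/z_1,\dots,1/z_d),\qquad \beta_s(z)=\frac{(2\pi i)^s}{s!}B_s\!\left(\frac12+\frac{\log(-z)}{2\pi i}\right),$$ where $B_s$ is the $s$-th Bernoulli polynomial and $\log$ is the principal branch, and let $\binom{-r}{\mu}=(-1)^\mu\binom{r+\mu-1}{\mu}$.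 Then for all integers $n_1,n_2,n_3\ge1$ and all $(z_1,z_2,z_3)\in U_3$, $$\begin{aligned} \mathrm{PLi}_{n_1,n_2,n_3}(z_1,z_2,z_3) &=\mathrm{Li}_{n_1}(z_1)\,\mathrm{PLi}_{n_2,n_3}(z_2,z_3)-\mathrm{Li}_{n_1+n_2,n_3}(z_1z_2,z_3)\\ &\quad+\mathrm{Li}_{n_2,n_1}(z_2,z_1)\,\beta_{n_3}(z_3)+\mathrm{Li}_{n_2+n_3,n_1}(z_2z_3,z_1)\\ &\quad-\sum_{\mu+\nu+s=n_2}\beta_s(z_1z_2z_3)\binom{-n_3}{\mu}\binom{-n_1}{\nu}\mathrm{Li}_{n_3+\mu}(1/z_3)\,\mathrm{Li}_{n_1+\nu}(z_1)(-1)^{n_3+\mu}\\ &\quad-\sum_{\mu+\nu+s=n_3}\beta_s(z_1z_2z_3)\binom{-n_2}{\mu}\binom{-n_1}{\nu}\mathrm{Li}_{n_2+\mu,n_1+\nu}(z_2,z_1)\\ &\quad-\sum_{\mu+\nu+s=n_1}\beta_s(z_1z_2z_3)\binom{-n_2}{\mu}\binom{-n_3}{\nu}\mathrm{Li}_{n_2+\mu,n_3+\nu}(1/z_2,1/z_3)(-1)^{n_2+\mu+n_3+\nu},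 \end{aligned}$$ where the sums run over integers $\mu,\nu,s\ge0$. Moreover, for all integers $n_1,n_2,n_3\ge1$, the function $\mathrm{PLi}_{n_1,n_2,n_3}$ on $U_3$ lies in $\mathscr L^2_{n_1+n_2+n_3}(z_1,z_2,z_3)$. Here $\mathscr L^D_w(z_1,\dots,z_N)$ is the $\mathbb Z$-module of functions on $U_N$ spanned by the products $$\prod_{i=1}^N\beta_{k_i}(z_iz_{i+1}\cdots z_N)\ \prod_{i=1}^s\mathrm{Li}_{\mathbf n^{(i)}}(\mathbf z^{(i)}),\qquad k_1,\dots,k_N\ge0,\ s\ge0,$$ where $\mathbf n^{(i)}\in\mathbb N^{d_i}$ with $d_i\ge1$, the total depth $d=d_1+\cdots+d_s$ is at most $D$, the total weight $k_1+\cdots+k_N+\sum_i|\mathbf n^{(i)}|$ equals $w$, and the concatenated list of arguments $(\mathbf z^{(1)},\dots,\mathbf z^{(s)})$ has the form $(z_{i_1}\cdots z_{j_1},\ \dots,\ z_{i_d}\cdots z_{j_d})$ with $1\le i_1\le j_1<i_2\le j_2<\cdots<i_d\le j_d\le N$. -/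

import Mathlib

noncomputable section

/-- The domain of the variables: no consecutive product `z i * ⋯ * z j` lies in `[0, ∞)`. -/
def mplDomain (d : ℕ) : Set (Fin d → ℂ) :=
  {z | ∀ i j : Fin d, i ≤ j →
    (∏ k ∈ Finset.Icc i j, z k) ∉ ((fun r : ℝ => (r : ℂ)) '' Set.Ici (0 : ℝ))}

/-- The multiple polylogarithm series
`∑_{0 < k_1 < ⋯ < k_d} z_1 ^ k_1 ⋯ z_d ^ k_d / (k_1 ^ n_1 ⋯ k_d ^ n_d)`.
It is only used for `z` close to `0`, where it converges absolutely. -/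
def mplSeries {d : ℕ} (n : Fin d → ℕ) (z : Fin d → ℂ) : ℂ :=
  ∑' k : {k : Fin d → ℕ // StrictMono k ∧ ∀ i, 0 < k i},
    ∏ i, z i ^ (k.1 i) / ((k.1 i : ℂ) ^ n i)

/-- `w` is the value at `z` of the analytic continuation of the multiple polylogarithm series
along the straight path `t ↦ t • z`, `t ∈ [0, 1]`. -/
def IsMPLValue {d : ℕ} (n : Fin d → ℕ) (z : Fin d → ℂ) (w : ℂ) : Prop :=
  ∃ F : ℂ → ℂ, AnalyticOnNhd ℂ F (segment ℝ (0 : ℂ) 1) ∧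
    (∀ᶠ t in nhds (0 : ℂ), F t = mplSeries n (fun i => t * z i)) ∧ F 1 = w

theorem IsMPLValue.unique {d : ℕ} {n : Fin d → ℕ} {z : Fin d → ℂ} {w w' : ℂ}
    (h : IsMPLValue n z w) (h' : IsMPLValue n z w') : w = w' := by
  obtain ⟨F, hF, hF0, rfl⟩ := h
  obtain ⟨G, hG, hG0, rfl⟩ := h'
  have hFG : F =ᶠ[nhds 0] G := by
    filter_upwards [hF0, hG0] with t h1 h2
    rw [h1, h2]
  exact hF.eqOn_of_preconnected_of_eventuallyEq hG (convex_segment _ _).isPreconnected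
    (left_mem_segment ℝ _ _) hFG (right_mem_segment ℝ _ _)

open Classical in
/-- The multiple polylogarithm `Li_n(z)`, defined by analytic continuation along the straight
path from the origin to `z`. -/
def mpl {d : ℕ} (n : Fin d → ℕ) (z : Fin d → ℂ) : ℂ :=
  if h : ∃ w, IsMPLValue n z w then h.choose else 0

theorem IsMPLValue.mpl_eq {d : ℕ} {n : Fin d → ℕ} {z : Fin d → ℂ} {w : ℂ}
    (h : IsMPLValue n z w) : mpl n z = w := by
  have hex : ∃ w, IsMPLValue n z w := ⟨w, h⟩
  rw [mpl, dif_pos hex]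
  exact hex.choose_spec.unique h

/-- `PLi_n(z) = Li_n(z) - (-1) ^ (|n| - d) Li_n(1/z)`. -/
def parityMPL {d : ℕ} (n : Fin d → ℕ) (z : Fin d → ℂ) : ℂ :=
  mpl n z - (-1 : ℂ) ^ ((∑ i, (n i : ℤ)) - (d : ℤ)) * mpl n (fun i => (z i)⁻¹)

/-- `β_n(z) = (2πi) ^ n / n! * B_n(1/2 + log(-z) / (2πi))`, with the Bernoulli polynomial `B_n`
and the principal branch of the logarithm. -/
def bernoulliBeta (n : ℕ) (z : ℂ) : ℂ :=
  (2 * (Real.pi : ℂ) * Complex.I) ^ n / (n.factorial : ℂ) *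
    Polynomial.aeval (1 / 2 + Complex.log (-z) / (2 * (Real.pi : ℂ) * Complex.I))
      (Polynomial.bernoulli n)

/-- The factor `Li_{n_1,…,n_r}(z_{i_1,j_1}, …, z_{i_r,j_r})` described by a list of
triples `(n, i, j)`, where `z_{i,j} = z_i ⋯ z_j`. -/
def mplFactor {N : ℕ} (b : List (ℕ × Fin N × Fin N)) (z : Fin N → ℂ) : ℂ :=
  mpl (fun m : Fin b.length => (b.get m).1)
    (fun m : Fin b.length => ∏ k ∈ Finset.Icc (b.get m).2.1 (b.get m).2.2, z k)

/-- The generators of the module `𝓛^D_w(z)`: products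
`∏_i β_{k_i}(z_i ⋯ z_N) * ∏_i Li_{n^(i)}(z^(i))` of total weight `w` and total depth at most `D`.
Reading all arguments `z_{i_1,j_1}, z_{i_2,j_2}, …` of the polylogarithms from left to right,
`i_1 ≤ j_1 < i_2 ≤ j_2 < ⋯`. The elements of `B` are the factors `Li_{n^(i)}(z^(i))`. -/
def mplGenerators (N D w : ℕ) : Set (mplDomain N → ℂ) :=
  {f | ∃ (k : Fin N → ℕ) (B : List (List (ℕ × Fin N × Fin N))),
    (∀ b ∈ B, b ≠ []) ∧
    (∀ x ∈ B.flatten, 1 ≤ x.1 ∧ x.2.1 ≤ x.2.2) ∧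
    B.flatten.Pairwise (fun x y => x.2.2 < y.2.1) ∧
    B.flatten.length ≤ D ∧
    (∑ i, k i) + (B.flatten.map (fun x => x.1)).sum = w ∧
    f = fun z => (∏ i, bernoulliBeta (k i) (∏ j ∈ Finset.Ici i, z.1 j)) *
      (B.map (fun b => mplFactor b z.1)).prod}

/-- The `ℤ`-module `𝓛^D_w(z_1, …, z_N)` of functions on the domain. -/
def mplModule (N D w : ℕ) : Submodule ℤ (mplDomain N → ℂ) :=
  Submodule.span ℤ (mplGenerators N D w)

end

/-! The proof turns every term of the formula into an integral over ℝ³ and then compares integrands.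
Write W = z e^(-x), E(z; x) = W/(1-W) (`expSum`) and F(z; x) = 1/(1-W) = 1 + E(z; x) (`expSumFull`).

Since 1/k^n is the integral of x^(n-1)/(n-1)! e^(-kx) over x > 0, summing geometric series over the
gaps of k_1 < ⋯ < k_d gives Li_n(z) as the integral over the positive orthant of ∏
x_i^(n_i-1)/(n_i-1)! times ∏_j E(z_j⋯z_d; x_j+⋯+x_d). This integral is holomorphic along the
straight path, so it is the analytic continuation (`isMPLValue_mplIntegral`). The substitution x ↦
-x turns (-1)^|n| Li_n(1/z) into the same integral over the negative orthant with F in place of E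
(`neg_one_pow_mul_mplIntegral_inv`).

In depth one the two half lines together give -β_n(z) (`parity_one`): on the unit circle this is the
Fourier series of the Bernoulli polynomials, and the identity theorem does the rest. Replacing z by
z e^(-y) and expanding the Bernoulli polynomial in y, the powers of y merge with the kernels
y^(m-1)/(m-1)! and produce the binomials binom(-m, k). Hence each sum of β times polylogarithms is
one integral in which a single variable runs over the whole line
(`sum_bernoulliBeta_mul_integral₂`).

All terms then live on the sign sectors (+,+,+), (+,+,-), (+,-,-), (-,-,-). Neighbouring sectors are
joined by the variable that runs over the whole line. On each sector the integrands agree by the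
partial fraction identities `expSum_mul_expSum` and `expSum_mul_expSumFull`. Merged arguments such
as Li_{n₁+n₂,n₃}(z₁z₂, z₃) come from convolving two kernels (`integral_halfKernel_add_eq_prod`).

For membership in the module, the formula still contains inverted arguments and the reversed order
(z₂, z₁). Inverses are removed by the parity theorems in depths one and two, and reversed orders by
the quasi-shuffle product `mpl_one_mul_mpl_one`. None of these steps raises the depth above two or
changes the weight. -/

noncomputable section

open MeasureTheory Set Filter Topology

/-! ### The kernels `x ^ (n - 1) / (n - 1)!` on a half line -/

/-- The function `x ^ (n - 1) / (n - 1)!` cut off to the half line `0 < σ * x`. -/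
def halfKernel (σ : ℝ) (n : ℕ) (x : ℝ) : ℂ :=
  if 0 < σ * x then (x : ℂ) ^ (n - 1) / ((n - 1).factorial : ℂ) else 0

theorem halfKernel_of_pos {σ : ℝ} {n : ℕ} {x : ℝ} (h : 0 < σ * x) :
    halfKernel σ n x = (x : ℂ) ^ (n - 1) / ((n - 1).factorial : ℂ) := if_pos h

theorem halfKernel_of_not_pos {σ : ℝ} {n : ℕ} {x : ℝ} (h : ¬ 0 < σ * x) :
    halfKernel σ n x = 0 := if_neg h

theorem measurable_halfKernel (σ : ℝ) (n : ℕ) : Measurable (halfKernel σ n) := by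
  unfold halfKernel
  refine Measurable.ite ?_ (by fun_prop) measurable_const
  exact measurableSet_lt measurable_const (by fun_prop)

theorem halfKernel_neg (σ : ℝ) (n : ℕ) (x : ℝ) :
    halfKernel σ n (-x) = (-1 : ℂ) ^ (n - 1) * halfKernel (-σ) n x := by
  unfold halfKernel
  have h : σ * -x = -σ * x := by ring
  rw [h]
  split_ifs
  · push_cast
    rw [neg_pow (x : ℂ)]
    ring
  · simp

theorem halfKernel_one_eq_indicator (n : ℕ) :
    halfKernel 1 n = (Ioi (0 : ℝ)).indicator
      (fun x : ℝ => (x : ℂ) ^ (n - 1) / ((n - 1).factorial : ℂ)) := by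
  ext x
  simp [halfKernel, indicator]

theorem norm_halfKernel_one_mul_exp (n : ℕ) (c x : ℝ) :
    ‖halfKernel 1 n x * Complex.exp (-(c * x))‖ = (Ioi (0 : ℝ)).indicator
      (fun x : ℝ => x ^ (n - 1) * Real.exp (-(c * x)) / (n - 1).factorial) x := by
  rw [halfKernel_one_eq_indicator, norm_mul]
  by_cases hx : 0 < x
  · have h : (-((c : ℂ) * x)) = ((-(c * x) : ℝ) : ℂ) := by push_cast; ring
    rw [h, Complex.norm_exp_ofReal]
    simp [indicator, hx, abs_of_pos hx]
    ring
  · simp [indicator, hx]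

theorem integrableOn_pow_mul_exp_neg_mul (m : ℕ) {c : ℝ} (hc : 0 < c) :
    IntegrableOn (fun x : ℝ => x ^ m * Real.exp (-(c * x))) (Ioi 0) := by
  have h := Real.GammaIntegral_convergent (s := (m : ℝ) + 1) (by positivity)
  have h2 := (integrableOn_Ioi_comp_mul_left_iff
    (fun x : ℝ => Real.exp (-x) * x ^ ((m : ℝ) + 1 - 1)) 0 hc).2 (by simpa using h)
  have h3 : IntegrableOn (fun x : ℝ => (c ^ m)⁻¹ * (Real.exp (-(c * x)) *
      (c * x) ^ ((m : ℝ) + 1 - 1))) (Ioi 0) := h2.const_mul _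
  refine h3.congr_fun (fun x hx => ?_) measurableSet_Ioi
  simp only [add_sub_cancel_right, Real.rpow_natCast]
  rw [mul_pow]
  field_simp

theorem integrable_halfKernel_one_mul_exp (n : ℕ) {c : ℝ} (hc : 0 < c) :
    Integrable (fun x => halfKernel 1 n x * Complex.exp (-(c * x))) := by
  refine (integrable_norm_iff ?_).1 ?_
  · exact ((measurable_halfKernel 1 n).mul (by fun_prop)).aestronglyMeasurable
  · simp_rw [norm_halfKernel_one_mul_exp]
    rw [integrable_indicator_iff measurableSet_Ioi]
    exact (integrableOn_pow_mul_exp_neg_mul _ hc).div_const _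

theorem integral_pow_mul_exp_neg_mul (m : ℕ) {c : ℝ} (hc : 0 < c) :
    ∫ x in Ioi (0 : ℝ), x ^ m * Real.exp (-(c * x)) = m.factorial / c ^ (m + 1) := by
  have h := Real.integral_rpow_mul_exp_neg_mul_Ioi (a := (m : ℝ) + 1) (r := c) (by positivity) hc
  rw [Real.Gamma_nat_eq_factorial] at h
  simp only [add_sub_cancel_right, Real.rpow_natCast] at h
  rw [h]
  have : (1 / c) ^ ((m : ℝ) + 1) = (1 / c) ^ (m + 1) := by
    exact_mod_cast Real.rpow_natCast (1 / c) (m + 1)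
  rw [this, one_div, inv_pow]
  field_simp

theorem integral_norm_halfKernel_one_mul_exp {n : ℕ} (hn : 1 ≤ n) {c : ℝ} (hc : 0 < c) :
    ∫ x, ‖halfKernel 1 n x * Complex.exp (-(c * x))‖ = 1 / c ^ n := by
  simp_rw [norm_halfKernel_one_mul_exp]
  rw [integral_indicator measurableSet_Ioi, integral_div, integral_pow_mul_exp_neg_mul _ hc,
    Nat.sub_add_cancel hn]
  have := Nat.factorial_ne_zero (n - 1)
  field_simp

theorem integral_halfKernel_one_mul_exp {n : ℕ} (hn : 1 ≤ n) {c : ℝ} (hc : 0 < c) :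
    ∫ x, halfKernel 1 n x * Complex.exp (-(c * x)) = 1 / (c : ℂ) ^ n := by
  have h : ∀ x : ℝ, halfKernel 1 n x * Complex.exp (-(c * x))
      = ((‖halfKernel 1 n x * Complex.exp (-(c * x))‖ : ℝ) : ℂ) := by
    intro x
    rw [norm_halfKernel_one_mul_exp, halfKernel_one_eq_indicator]
    by_cases hx : 0 < x
    · simp [indicator, hx]
      ring
    · simp [indicator, hx]
  rw [integral_congr_ae (Eventually.of_forall h), integral_complex_ofReal,
    integral_norm_halfKernel_one_mul_exp hn hc]
  push_cast
  rfl

/-! ### Geometric sums over increasing tuples -/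

/-- The sum `W + W ^ 2 + ⋯ = W / (1 - W)`. -/
def geomSum (W : ℂ) : ℂ := W / (1 - W)

/-- The rational function `∏_j y_j ⋯ y_d / (1 - y_j ⋯ y_d)`. -/
def geomChain {d : ℕ} (y : Fin d → ℂ) : ℂ := ∏ j, geomSum (∏ k ∈ Finset.Ici j, y k)

/-- The increasing tuples of positive integers. -/
abbrev PosTuple (d : ℕ) : Type := {k : Fin d → ℕ // StrictMono k ∧ ∀ i, 0 < k i}

/-- Induction on `d`, splitting off the first coordinate. Norm summability is carried along because
multiplying two infinite sums needs absolute convergence. -/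
theorem hasSum_pi_prod {d : ℕ} (f : Fin d → ℕ → ℂ) (a : Fin d → ℂ)
    (h : ∀ i, HasSum (f i) (a i)) (hn : ∀ i, Summable fun m => ‖f i m‖) :
    HasSum (fun m : Fin d → ℕ => ∏ i, f i (m i)) (∏ i, a i) ∧
      Summable fun m : Fin d → ℕ => ‖∏ i, f i (m i)‖ := by
  induction d with
  | zero =>
    simp only [Finset.univ_eq_empty, Finset.prod_empty]
    exact ⟨hasSum_unique (fun _ : Fin 0 → ℕ => (1 : ℂ)), Summable.of_finite⟩
  | succ d ih =>
    obtain ⟨h1, h2⟩ := ih (fun i => f i.succ) (fun i => a i.succ) (fun i => h _) (fun i => hn _)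
    have h3 := summable_mul_of_summable_norm' (hn 0) (h 0).summable h2 h1.summable
    have h4 := (h 0).mul h1 h3
    have h5 := (hn 0).mul_norm h2
    rw [← (Fin.consEquiv (fun _ => ℕ)).hasSum_iff, ← (Fin.consEquiv (fun _ => ℕ)).summable_iff]
    have h6 : ∀ x : ℕ × (Fin d → ℕ), ∏ i, f i (Fin.consEquiv (fun _ => ℕ) x i)
        = f 0 x.1 * ∏ i : Fin d, f i.succ (x.2 i) := fun x => by
      simp [Fin.prod_univ_succ, Fin.consEquiv]
    simp only [Function.comp_def, h6, Fin.prod_univ_succ a]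
    exact ⟨h4, h5⟩

/-- Partial sums of the gaps `m j + 1`. -/
def partialSums {d : ℕ} (m : Fin d → ℕ) : PosTuple d :=
  ⟨fun i => ∑ j ∈ Finset.Iic i, (m j + 1), by
    constructor
    · intro i i' h
      refine Finset.sum_lt_sum_of_subset (Finset.Iic_subset_Iic.2 h.le) (i := i') (by simp)
        (by simpa using h) (by omega) (fun j _ _ => by omega)
    · intro i
      exact Finset.sum_pos (fun j _ => by omega) ⟨i, by simp⟩⟩

theorem partialSums_bijective (d : ℕ) : Function.Bijective (partialSums (d := d)) := by
  constructor
  · intro m m' h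
    have h' : ∀ i, ∑ j ∈ Finset.Iic i, (m j + 1) = ∑ j ∈ Finset.Iic i, (m' j + 1) := fun i =>
      congrFun (congrArg Subtype.val h) i
    ext i
    induction i using WellFoundedLT.induction with
    | ind i ih =>
      have h1 := h' i
      rw [← Finset.Iio_insert, Finset.sum_insert (by simp), Finset.sum_insert (by simp)] at h1
      have h2 : ∑ j ∈ Finset.Iio i, (m j + 1) = ∑ j ∈ Finset.Iio i, (m' j + 1) :=
        Finset.sum_congr rfl fun j hj => by rw [ih j (by simpa using hj)]
      omega
  · rintro ⟨k, hk, hpos⟩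
    cases d with
    | zero => exact ⟨fun _ => 0, Subtype.ext (funext fun i => i.elim0)⟩
    | succ d =>
      -- The gaps of `k`, lowered by one, with 0 as the entry preceding `k 0`. The truncated
      -- subtractions are exact because `k` is positive and strictly increasing.
      refine ⟨Fin.cons (k 0 - 1) fun i => k i.succ - k i.castSucc - 1, Subtype.ext (funext ?_)⟩
      intro i
      simp only [partialSums]
      induction i using Fin.induction with
      | zero =>
        have := hpos 0
        have h0 : Finset.Iic (0 : Fin (d + 1)) = {0} := by ext; simp
        rw [h0]
        simp
        omega
      | succ i ih =>
        have h0 : Finset.Iic i.succ = insert i.succ (Finset.Iic i.castSucc) := by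
          ext j
          simp only [Finset.mem_Iic, Finset.mem_insert, Fin.le_def, Fin.ext_iff, Fin.val_succ,
            Fin.val_castSucc]
          omega
        rw [h0, Finset.sum_insert (by simp [Fin.le_def]), ih]
        have := hk (Fin.castSucc_lt_succ (i := i))
        simp
        omega

theorem hasSum_geomSum_pow {W : ℂ} (h : ‖W‖ < 1) : HasSum (fun m : ℕ => W ^ (m + 1)) (geomSum W) := by
  have := (hasSum_geometric_of_norm_lt_one h).mul_left W
  rw [geomSum, div_eq_mul_inv]
  simpa [pow_succ'] using this

/-- The gap at `j` enters the exponent of every `y i` with `i ≥ j`. Collecting by gaps decouples the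
sum over increasing tuples into independent geometric series. -/
theorem prod_pow_partialSums {d : ℕ} (y : Fin d → ℂ) (m : Fin d → ℕ) :
    ∏ i, y i ^ (partialSums m).1 i = ∏ j, (∏ k ∈ Finset.Ici j, y k) ^ (m j + 1) := by
  simp only [partialSums, ← Finset.prod_pow_eq_pow_sum, ← Finset.prod_pow]
  exact Finset.prod_comm' (by simp)

theorem norm_prod_Ici_lt_one {d : ℕ} {y : Fin d → ℂ} (h : ∀ i, ‖y i‖ < 1) (j : Fin d) :
    ‖∏ k ∈ Finset.Ici j, y k‖ < 1 := by
  rw [norm_prod, ← Finset.mul_prod_erase _ _ (Finset.mem_Ici.2 le_rfl : j ∈ Finset.Ici j)]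
  refine mul_lt_one_of_nonneg_of_lt_one_left (norm_nonneg _) (h j)
    (Finset.prod_le_one (fun _ _ => norm_nonneg _) fun i _ => (h i).le)

theorem hasSum_geomChain {d : ℕ} {y : Fin d → ℂ} (h : ∀ i, ‖y i‖ < 1) :
    HasSum (fun k : PosTuple d => ∏ i, y i ^ k.1 i) (geomChain y) ∧
      Summable fun k : PosTuple d => ‖∏ i, y i ^ k.1 i‖ := by
  have h1 := hasSum_pi_prod (fun j m => (∏ k ∈ Finset.Ici j, y k) ^ (m + 1))
    (fun j => geomSum (∏ k ∈ Finset.Ici j, y k))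
    (fun j => hasSum_geomSum_pow (norm_prod_Ici_lt_one h j)) (fun j => by
      simp only [norm_pow]
      exact (summable_nat_add_iff 1).2
        (summable_geometric_of_lt_one (norm_nonneg _) (norm_prod_Ici_lt_one h j)))
  simp only [← prod_pow_partialSums] at h1
  exact ⟨((Equiv.ofBijective _ (partialSums_bijective d)).hasSum_iff).1 h1.1,
    ((Equiv.ofBijective _ (partialSums_bijective d)).summable_iff).1 h1.2⟩

/-! ### The integral representation and the analytic continuation -/

/-- The derivative is a pointwise limit of difference quotients along a sequence, each of them
measurable. -/
theorem aestronglyMeasurable_deriv_param {α : Type*} [MeasurableSpace α] {μ : Measure α}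
    {O : Set ℂ} (hO : IsOpen O) {F : ℂ → α → ℂ}
    (hmeas : ∀ t ∈ O, AEStronglyMeasurable (F t) μ)
    (hdiff : ∀ a, DifferentiableOn ℂ (fun t => F t a) O) {t₀ : ℂ} (ht₀ : t₀ ∈ O) :
    AEStronglyMeasurable (fun a => deriv (fun t => F t a) t₀) μ := by
  obtain ⟨u, hu⟩ := exists_seq_tendsto (𝓝[≠] t₀)
  have hu' : Tendsto u atTop (𝓝 t₀) := hu.mono_right nhdsWithin_le_nhds
  obtain ⟨N, hN⟩ := eventually_atTop.1 (hu'.eventually (hO.mem_nhds ht₀))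
  refine aestronglyMeasurable_of_tendsto_ae atTop
    (f := fun m a => slope (fun t => F t a) t₀ (u (m + N))) (fun m => ?_)
    (Eventually.of_forall fun a => ?_)
  · simp only [slope_def_field, div_eq_inv_mul]
    exact ((hmeas _ (hN _ (Nat.le_add_left N m))).sub (hmeas _ ht₀)).const_mul _
  · have h : HasDerivAt (fun t => F t a) (deriv (fun t => F t a) t₀) t₀ :=
      ((hdiff a).differentiableAt (hO.mem_nhds ht₀)).hasDerivAt
    exact h.tendsto_slope.comp (hu.comp (tendsto_add_atTop_nat N))

/-- A bound on the functions alone suffices: Cauchy's estimate on circles of radius `r / 2` turns it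
into a bound on the derivatives, as differentiation under the integral requires. -/
theorem differentiableOn_integral_of_locally_dominated {α : Type*} [MeasurableSpace α]
    {μ : Measure α} {O : Set ℂ} (hO : IsOpen O) {F : ℂ → α → ℂ}
    (hmeas : ∀ t ∈ O, AEStronglyMeasurable (F t) μ)
    (hdiff : ∀ a, DifferentiableOn ℂ (fun t => F t a) O)
    (hb : ∀ K, IsCompact K → K ⊆ O → ∃ bound : α → ℝ, Integrable bound μ ∧
      ∀ t ∈ K, ∀ a, ‖F t a‖ ≤ bound a) :
    DifferentiableOn ℂ (fun t => ∫ a, F t a ∂μ) O := by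
  intro t₀ ht₀
  obtain ⟨r, hr, hrO⟩ := Metric.nhds_basis_closedBall.mem_iff.1 (hO.mem_nhds ht₀)
  obtain ⟨bound, hbi, hbd⟩ := hb _ (isCompact_closedBall t₀ r) hrO
  have hr2 : 0 < r / 2 := by positivity
  have hsub : ∀ t ∈ Metric.ball t₀ (r / 2), Metric.closedBall t (r / 2) ⊆ Metric.closedBall t₀ r := by
    intro t ht
    refine Metric.closedBall_subset_closedBall' ?_
    have := Metric.mem_ball.1 ht
    linarith
  have key := hasDerivAt_integral_of_dominated_loc_of_deriv_le (μ := μ) (F := F) (x₀ := t₀)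
    (F' := fun t a => deriv (fun t => F t a) t) (bound := fun a => bound a / (r / 2))
    (Metric.ball_mem_nhds t₀ hr2)
    (by filter_upwards [hO.mem_nhds ht₀] with t ht using hmeas t ht)
    (hbi.mono' (hmeas _ ht₀) (Eventually.of_forall fun a =>
      hbd t₀ (Metric.mem_closedBall_self hr.le) a))
    (aestronglyMeasurable_deriv_param hO hmeas hdiff ht₀)
    (Eventually.of_forall fun a t ht => ?_) (hbi.div_const _)
    (Eventually.of_forall fun a t ht => ?_)
  · exact key.2.differentiableAt.differentiableWithinAt
  · refine Complex.norm_deriv_le_of_forall_mem_sphere_norm_le hr2 ?_ fun w hw =>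
      hbd w (hsub t ht (Metric.sphere_subset_closedBall hw)) a
    refine ((hdiff a).mono ?_).diffContOnCl
    rw [closure_ball _ hr2.ne']
    exact (hsub t ht).trans hrO
  · exact ((hdiff a).differentiableAt (hO.mem_nhds
      (hrO (hsub t ht (Metric.mem_closedBall_self hr2.le))))).hasDerivAt

/-- The slit plane is star-shaped about 1, and 1 - ur lies on the segment from 1 to 1 - u. -/
theorem one_sub_mul_mem_slitPlane {u : ℂ} (hu : 1 - u ∈ Complex.slitPlane) {r : ℝ} (h0 : 0 ≤ r)
    (h1 : r ≤ 1) : 1 - u * r ∈ Complex.slitPlane := by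
  have := starConvex_iff_segment_subset.1 Complex.starConvex_one_slitPlane hu
    (show (1 - r : ℝ) • (1 : ℂ) + r • (1 - u) ∈ segment ℝ (1 : ℂ) (1 - u) from
      ⟨1 - r, r, by linarith, h0, by ring, rfl⟩)
  convert this using 1
  simp only [Complex.real_smul]
  push_cast
  ring

theorem one_sub_mul_exp_mem_slitPlane {u : ℂ} (hu : 1 - u ∈ Complex.slitPlane) {x : ℝ}
    (hx : 0 ≤ x) : 1 - u * Complex.exp (-(x : ℂ)) ∈ Complex.slitPlane := by
  have := one_sub_mul_mem_slitPlane hu (Real.exp_pos (-x)).le (Real.exp_le_one_iff.2 (by linarith))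
  simpa using this

/-- With s = e^(-x) in [0, 1], the quotient by e^(-x) is u/(1 - us), which is continuous on the
compact set K × [0, 1]. -/
theorem exists_geomSum_bound {K : Set ℂ} (hK : IsCompact K) {u : ℂ → ℂ} (hu : Continuous u)
    (h : ∀ t ∈ K, 1 - u t ∈ Complex.slitPlane) :
    ∃ C : ℝ, 0 ≤ C ∧ ∀ t ∈ K, ∀ x : ℝ, 0 ≤ x →
      ‖geomSum (u t * Complex.exp (-(x : ℂ)))‖ ≤ C * Real.exp (-x) := by
  have hc : ContinuousOn (fun p : ℂ × ℝ => u p.1 / (1 - u p.1 * p.2)) (K ×ˢ Icc (0 : ℝ) 1) := by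
    refine ContinuousOn.div (by fun_prop) (by fun_prop) fun p hp => ?_
    exact Complex.slitPlane_ne_zero (one_sub_mul_mem_slitPlane (h _ hp.1) hp.2.1 hp.2.2)
  obtain ⟨C, hC⟩ := (hK.prod isCompact_Icc).exists_bound_of_continuousOn hc
  refine ⟨max C 0, le_max_right _ _, fun t ht x hx => ?_⟩
  have h1 := hC (t, Real.exp (-x)) ⟨ht, (Real.exp_pos _).le, Real.exp_le_one_iff.2 (by linarith)⟩
  have h2 : geomSum (u t * Complex.exp (-(x : ℂ)))
      = u t / (1 - u t * (Real.exp (-x) : ℝ)) * (Real.exp (-x) : ℝ) := by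
    rw [geomSum]
    push_cast
    ring
  rw [h2, norm_mul, Complex.norm_of_nonneg (Real.exp_pos _).le]
  exact mul_le_mul_of_nonneg_right (h1.trans (le_max_left _ _)) (Real.exp_pos _).le

theorem measurable_geomSum : Measurable geomSum := by
  unfold geomSum
  fun_prop

/-- The integrand of the integral representation of the multiple polylogarithm. -/
def mplIntegrand {d : ℕ} (n : Fin d → ℕ) (z : Fin d → ℂ) (x : Fin d → ℝ) : ℂ :=
  (∏ i, halfKernel 1 (n i) (x i)) * geomChain fun i => z i * Complex.exp (-(x i : ℂ))

/-- The integral representation of the multiple polylogarithm. -/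
def mplIntegral {d : ℕ} (n : Fin d → ℕ) (z : Fin d → ℂ) : ℂ := ∫ x, mplIntegrand n z x

theorem measurable_mplIntegrand {d : ℕ} (n : Fin d → ℕ) (z : Fin d → ℂ) :
    Measurable (mplIntegrand n z) := by
  refine Measurable.mul ?_ ?_
  · exact Finset.measurable_prod _ fun i _ =>
      (measurable_halfKernel 1 (n i)).comp (measurable_pi_apply i)
  · refine Finset.measurable_prod _ fun j _ => measurable_geomSum.comp ?_
    refine Finset.measurable_prod _ fun k _ => ?_
    fun_prop

theorem mplIntegrand_eq_zero {d : ℕ} (n : Fin d → ℕ) (z : Fin d → ℂ) {x : Fin d → ℝ}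
    (hx : ¬ ∀ i, 0 < x i) : mplIntegrand n z x = 0 := by
  push Not at hx
  obtain ⟨i, hi⟩ := hx
  rw [mplIntegrand, Finset.prod_eq_zero (Finset.mem_univ i), zero_mul]
  exact halfKernel_of_not_pos (by simpa using hi)

theorem prod_Ici_mul_exp {d : ℕ} (z : Fin d → ℂ) (x : Fin d → ℝ) (j : Fin d) :
    ∏ k ∈ Finset.Ici j, z k * Complex.exp (-(x k : ℂ))
      = (∏ k ∈ Finset.Ici j, z k) * Complex.exp (-((∑ k ∈ Finset.Ici j, x k : ℝ) : ℂ)) := by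
  rw [Finset.prod_mul_distrib, ← Complex.exp_sum]
  push_cast
  rw [Finset.sum_neg_distrib]

/-- The tuples for which no final product `z_j ⋯ z_d` lies in `[1, ∞)`. -/
def mplCutDomain (d : ℕ) : Set (Fin d → ℂ) :=
  {z | ∀ j, 1 - ∏ k ∈ Finset.Ici j, z k ∈ Complex.slitPlane}

theorem exists_mplIntegrand_bound {d : ℕ} (n : Fin d → ℕ) (z : Fin d → ℂ) {K : Set ℂ}
    (hK : IsCompact K) (h : ∀ t ∈ K, (fun i => t * z i) ∈ mplCutDomain d) :
    ∃ bound : (Fin d → ℝ) → ℝ, Integrable bound ∧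
      ∀ t ∈ K, ∀ x, ‖mplIntegrand n (fun i => t * z i) x‖ ≤ bound x := by
  choose C hC0 hC using fun j : Fin d => exists_geomSum_bound hK
    (u := fun t => ∏ k ∈ Finset.Ici j, t * z k) (by fun_prop) (fun t ht => h t ht j)
  refine ⟨fun x => ∏ i, ‖halfKernel 1 (n i) (x i) * Complex.exp (-((1 : ℝ) * x i : ℂ))‖ * C i,
    ?_, ?_⟩
  · exact Integrable.fintype_prod (f := fun i (x : ℝ) =>
      ‖halfKernel 1 (n i) x * Complex.exp (-((1 : ℝ) * x : ℂ))‖ * C i)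
      fun i => (integrable_halfKernel_one_mul_exp (n i) one_pos).norm.mul_const _
  · intro t ht x
    by_cases hx : ∀ i, 0 < x i
    · rw [mplIntegrand, geomChain, ← Finset.prod_mul_distrib, norm_prod]
      refine Finset.prod_le_prod (fun _ _ => norm_nonneg _) fun j _ => ?_
      rw [prod_Ici_mul_exp, norm_mul, norm_mul, mul_assoc]
      refine mul_le_mul_of_nonneg_left ?_ (norm_nonneg _)
      -- From the decay in x_j + ⋯ + x_d only e^(-x_j) is kept. The `d` factors then supply one
      -- exponential per variable, so the bound is a product of one-dimensional integrable
      -- functions.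
      refine (hC j t ht _ (Finset.sum_nonneg fun i _ => (hx i).le)).trans ?_
      rw [mul_comm]
      refine mul_le_mul_of_nonneg_right ?_ (hC0 j)
      have h2 : (-(((1 : ℝ) : ℂ) * (x j : ℂ))) = ((-(x j) : ℝ) : ℂ) := by push_cast; ring
      rw [h2, Complex.norm_exp_ofReal, Real.exp_le_exp, neg_le_neg_iff]
      exact Finset.single_le_sum (f := x) (fun i _ => (hx i).le) (Finset.mem_Ici.2 le_rfl)
    · rw [mplIntegrand_eq_zero _ _ hx, norm_zero]
      exact Finset.prod_nonneg fun i _ => mul_nonneg (norm_nonneg _) (hC0 i)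

theorem isOpen_dilation_cutDomain {d : ℕ} (z : Fin d → ℂ) :
    IsOpen {t : ℂ | (fun i => t * z i) ∈ mplCutDomain d} := by
  have h : {t : ℂ | (fun i => t * z i) ∈ mplCutDomain d} = ⋂ j,
      (fun t : ℂ => 1 - ∏ k ∈ Finset.Ici j, t * z k) ⁻¹' Complex.slitPlane := by
    ext t
    simp [mplCutDomain]
  rw [h]
  exact isOpen_iInter_of_finite fun j =>
    Complex.isOpen_slitPlane.preimage (by fun_prop : Continuous fun t : ℂ =>
      1 - ∏ k ∈ Finset.Ici j, t * z k)

theorem differentiableOn_mplIntegral {d : ℕ} (n : Fin d → ℕ) (z : Fin d → ℂ) :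
    DifferentiableOn ℂ (fun t : ℂ => mplIntegral n fun i => t * z i)
      {t : ℂ | (fun i => t * z i) ∈ mplCutDomain d} := by
  refine differentiableOn_integral_of_locally_dominated (isOpen_dilation_cutDomain z)
    (fun t _ => (measurable_mplIntegrand n _).aestronglyMeasurable) (fun x => ?_)
    (fun K hK hKO => exists_mplIntegrand_bound n z hK hKO)
  by_cases hx : ∀ i, 0 < x i
  · unfold mplIntegrand geomChain
    refine (DifferentiableOn.const_mul ?_ _)
    refine DifferentiableOn.fun_finsetProd fun j _ => ?_
    unfold geomSum
    refine DifferentiableOn.div (by fun_prop) (by fun_prop) fun t ht => ?_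
    rw [prod_Ici_mul_exp]
    exact Complex.slitPlane_ne_zero (one_sub_mul_exp_mem_slitPlane (ht j)
      (Finset.sum_nonneg fun i _ => (hx i).le))
  · simp only [mplIntegrand_eq_zero _ _ hx]
    exact differentiableOn_const _

/-- Termwise integration of the geometric expansion; `hs` says precisely that the L¹ norms of the
terms are summable. The closed polydisc is allowed because parity in depth one is checked on the
unit circle. -/
theorem mplIntegral_eq_mplSeries {d : ℕ} {n : Fin d → ℕ} (hn : ∀ i, 1 ≤ n i) {z : Fin d → ℂ}
    (hz : ∀ i, ‖z i‖ ≤ 1)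
    (hs : Summable fun k : PosTuple d => ∏ i, ‖z i‖ ^ k.1 i / (k.1 i : ℝ) ^ n i) :
    mplIntegral n z = mplSeries n z := by
  have hterm : ∀ (k : PosTuple d) (x : Fin d → ℝ),
      (∏ i, halfKernel 1 (n i) (x i)) * ∏ i, (z i * Complex.exp (-(x i : ℂ))) ^ k.1 i
        = ∏ i, z i ^ k.1 i * (halfKernel 1 (n i) (x i)
            * Complex.exp (-(((k.1 i : ℝ) : ℂ) * (x i : ℂ)))) := by
    intro k x
    rw [← Finset.prod_mul_distrib]
    refine Finset.prod_congr rfl fun i _ => ?_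
    rw [mul_pow, ← Complex.exp_nat_mul]
    push_cast
    ring_nf
  have hpos : ∀ (k : PosTuple d) i, 0 < ((k.1 i : ℕ) : ℝ) := fun k i => by exact_mod_cast k.2.2 i
  have hint : ∀ (k : PosTuple d) i, Integrable fun x : ℝ => z i ^ k.1 i * (halfKernel 1 (n i) x
      * Complex.exp (-(((k.1 i : ℝ) : ℂ) * (x : ℂ)))) := fun k i =>
    (integrable_halfKernel_one_mul_exp (n i) (hpos k i)).const_mul _
  have hsum : ∀ x, ∑' k : PosTuple d, ∏ i, z i ^ k.1 i * (halfKernel 1 (n i) (x i)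
      * Complex.exp (-(((k.1 i : ℝ) : ℂ) * (x i : ℂ)))) = mplIntegrand n z x := by
    intro x
    simp only [← hterm]
    by_cases hx : ∀ i, 0 < x i
    · have hy : ∀ i, ‖z i * Complex.exp (-(x i : ℂ))‖ < 1 := fun i => by
        have h2 : -(x i : ℂ) = ((-(x i) : ℝ) : ℂ) := by push_cast; ring
        rw [norm_mul, h2, Complex.norm_exp_ofReal]
        exact mul_lt_one_of_nonneg_of_lt_one_right (hz i) (Real.exp_pos _).le
          (Real.exp_lt_one_iff.2 (by linarith [hx i]))
      exact ((hasSum_geomChain hy).1.mul_left _).tsum_eq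
    · have h0 : ∏ i, halfKernel 1 (n i) (x i) = 0 := by
        push Not at hx
        obtain ⟨i, hi⟩ := hx
        exact Finset.prod_eq_zero (Finset.mem_univ i) (halfKernel_of_not_pos (by simpa using hi))
      simp [mplIntegrand, h0]
  have hnorm : ∀ k : PosTuple d, ∫ x : Fin d → ℝ, ‖∏ i, z i ^ k.1 i * (halfKernel 1 (n i) (x i)
      * Complex.exp (-(((k.1 i : ℝ) : ℂ) * (x i : ℂ))))‖
        = ∏ i, ‖z i‖ ^ k.1 i / (k.1 i : ℝ) ^ n i := by
    intro k
    simp only [norm_prod]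
    rw [integral_fintype_prod_volume_eq_prod (f := fun i (x : ℝ) => ‖z i ^ k.1 i *
      (halfKernel 1 (n i) x * Complex.exp (-(((k.1 i : ℝ) : ℂ) * (x : ℂ))))‖)]
    refine Finset.prod_congr rfl fun i _ => ?_
    simp only [norm_mul (z i ^ k.1 i)]
    rw [integral_const_mul, integral_norm_halfKernel_one_mul_exp (hn i) (hpos k i), norm_pow]
    ring
  have := hasSum_integral_of_summable_integral_norm (μ := (volume : Measure (Fin d → ℝ)))
    (F := fun (k : PosTuple d) (x : Fin d → ℝ) => ∏ i, z i ^ k.1 i * (halfKernel 1 (n i) (x i)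
      * Complex.exp (-(((k.1 i : ℝ) : ℂ) * (x i : ℂ)))))
    (fun k => Integrable.fintype_prod (hint k)) (by simpa only [hnorm] using hs)
  simp only [hsum] at this
  rw [mplIntegral, ← this.tsum_eq, mplSeries]
  refine tsum_congr fun k => ?_
  rw [integral_fintype_prod_volume_eq_prod (f := fun i (x : ℝ) => z i ^ k.1 i *
    (halfKernel 1 (n i) x * Complex.exp (-(((k.1 i : ℝ) : ℂ) * (x : ℂ)))))]
  refine Finset.prod_congr rfl fun i _ => ?_
  rw [integral_const_mul, integral_halfKernel_one_mul_exp (hn i) (hpos k i)]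
  push_cast
  ring

theorem mplIntegral_eq_mplSeries_of_norm_lt_one {d : ℕ} {n : Fin d → ℕ} (hn : ∀ i, 1 ≤ n i)
    {z : Fin d → ℂ} (hz : ∀ i, ‖z i‖ < 1) : mplIntegral n z = mplSeries n z := by
  refine mplIntegral_eq_mplSeries hn (fun i => (hz i).le) ?_
  refine Summable.of_nonneg_of_le (fun k => Finset.prod_nonneg fun i _ => by positivity)
    (fun k => ?_) (hasSum_geomChain hz).2
  rw [norm_prod]
  refine Finset.prod_le_prod (fun i _ => by positivity) fun i _ => ?_
  rw [norm_pow]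
  refine div_le_self (by positivity) (one_le_pow₀ ?_)
  exact_mod_cast k.2.2 i

theorem dilation_mem_cutDomain {d : ℕ} {z : Fin d → ℂ} (hz : z ∈ mplCutDomain d) {t : ℝ}
    (h0 : 0 ≤ t) (h1 : t ≤ 1) : (fun i => (t : ℂ) * z i) ∈ mplCutDomain d := by
  intro j
  rw [Finset.prod_mul_distrib, Finset.prod_const, mul_comm]
  have := one_sub_mul_mem_slitPlane (hz j) (pow_nonneg h0 (Finset.Ici j).card)
    (pow_le_one₀ h0 h1)
  simpa using this

/-- The parameters `t` for which the dilated tuple avoids the cuts form an open set containing [0,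
1]. The integral is holomorphic there, and for small `t` it equals the series. -/
theorem isMPLValue_mplIntegral {d : ℕ} {n : Fin d → ℕ} (hn : ∀ i, 1 ≤ n i) {z : Fin d → ℂ}
    (hz : z ∈ mplCutDomain d) : IsMPLValue n z (mplIntegral n z) := by
  refine ⟨fun t => mplIntegral n fun i => t * z i, fun t ht => ?_, ?_, by simp⟩
  · have hO := isOpen_dilation_cutDomain z
    refine (differentiableOn_mplIntegral n z).analyticOnNhd hO t ?_
    obtain ⟨a, b, ha, hb, hab, rfl⟩ := ht
    have := dilation_mem_cutDomain hz hb (by linarith)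
    simpa using this
  · have : ∀ᶠ t in 𝓝 (0 : ℂ), ∀ i, ‖t * z i‖ < 1 := by
      rw [eventually_all]
      intro i
      have hc : Tendsto (fun t : ℂ => ‖t * z i‖) (𝓝 0) (𝓝 0) := by
        have : Continuous fun t : ℂ => ‖t * z i‖ := by fun_prop
        simpa using this.tendsto 0
      exact hc.eventually (gt_mem_nhds one_pos)
    filter_upwards [this] with t ht
    exact mplIntegral_eq_mplSeries_of_norm_lt_one hn ht

theorem mpl_eq_mplIntegral {d : ℕ} {n : Fin d → ℕ} (hn : ∀ i, 1 ≤ n i) {z : Fin d → ℂ}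
    (hz : z ∈ mplCutDomain d) : mpl n z = mplIntegral n z :=
  (isMPLValue_mplIntegral hn hz).mpl_eq

theorem isMPLValue_mpl {d : ℕ} {n : Fin d → ℕ} (hn : ∀ i, 1 ≤ n i) {z : Fin d → ℂ}
    (hz : z ∈ mplCutDomain d) : IsMPLValue n z (mpl n z) := by
  rw [mpl_eq_mplIntegral hn hz]
  exact isMPLValue_mplIntegral hn hz

theorem neg_mem_slitPlane_iff {u : ℂ} :
    -u ∈ Complex.slitPlane ↔ u ∉ ((fun r : ℝ => (r : ℂ)) '' Set.Ici (0 : ℝ)) := by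
  rw [Complex.mem_slitPlane_iff]
  constructor
  · rintro h ⟨r, hr, rfl⟩
    have hr : 0 ≤ r := hr
    rcases h with h | h
    · simp at h
      linarith
    · simp at h
  · intro h
    by_contra hc
    push Not at hc
    refine h ⟨u.re, ?_, Complex.ext (by simp) ?_⟩
    · have := hc.1
      simpa using this
    · have := hc.2
      simp at this
      simp [this]

theorem one_sub_mem_slitPlane {u : ℂ} (hu : -u ∈ Complex.slitPlane) :
    1 - u ∈ Complex.slitPlane := by
  rw [Complex.mem_slitPlane_iff] at hu ⊢
  rcases hu with h | h
  · left
    simp at h ⊢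
    linarith
  · right
    simpa using h

theorem Ici_eq_Icc_last {d : ℕ} (j : Fin (d + 1)) : Finset.Ici j = Finset.Icc j (Fin.last d) := by
  ext k
  simp [Fin.le_last]

theorem mplDomain_subset_mplCutDomain (d : ℕ) : mplDomain d ⊆ mplCutDomain d := by
  intro z hz j
  cases d with
  | zero => exact j.elim0
  | succ d =>
    rw [Ici_eq_Icc_last]
    exact one_sub_mem_slitPlane (neg_mem_slitPlane_iff.2 (hz j _ (Fin.le_last j)))

/-! ### Inversion of the arguments -/

/-- The sum `1 + W + W ^ 2 + ⋯ = 1 / (1 - W)`. -/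
def geomSumFull (W : ℂ) : ℂ := 1 / (1 - W)

/-- At W = 1 both sides are 0 through division by zero, so the inversion formula can be applied
pointwise without excluding poles. -/
theorem geomSum_inv {W : ℂ} (hW : W ≠ 0) : geomSum W⁻¹ = -geomSumFull W := by
  unfold geomSum geomSumFull
  rcases eq_or_ne W 1 with rfl | h1
  · simp
  · have h2 : 1 - W ≠ 0 := sub_ne_zero.2 h1.symm
    have h3 : W - 1 ≠ 0 := sub_ne_zero.2 h1
    have h4 : 1 - W⁻¹ = (W - 1) / W := by field_simp
    rw [h4]
    field_simp
    ring

theorem neg_one_pow_mul_mplIntegral_inv {d : ℕ} {n : Fin d → ℕ} (hn : ∀ i, 1 ≤ n i)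
    {z : Fin d → ℂ} (hz : ∀ i, z i ≠ 0) :
    (-1 : ℂ) ^ (∑ i, n i) * mplIntegral n (fun i => (z i)⁻¹)
      = ∫ x : Fin d → ℝ, (∏ i, halfKernel (-1) (n i) (x i)) *
        ∏ j, geomSumFull (∏ k ∈ Finset.Ici j, z k * Complex.exp (-(x k : ℂ))) := by
  rw [mplIntegral, ← integral_neg_eq_self, ← integral_const_mul]
  congr 1
  ext x
  have h1 : ∀ j, geomSum (∏ k ∈ Finset.Ici j, (z k)⁻¹ * Complex.exp (-((-x) k : ℂ)))
      = -1 * geomSumFull (∏ k ∈ Finset.Ici j, z k * Complex.exp (-(x k : ℂ))) := by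
    intro j
    rw [neg_one_mul, ← geomSum_inv, ← Finset.prod_inv_distrib]
    · congr 1
      refine Finset.prod_congr rfl fun k _ => ?_
      rw [mul_inv, ← Complex.exp_neg]
      simp
    · exact Finset.prod_ne_zero_iff.2 fun k _ => mul_ne_zero (hz k) (Complex.exp_ne_zero _)
  simp only [mplIntegrand, geomChain, h1]
  simp only [Pi.neg_apply, halfKernel_neg]
  rw [Finset.prod_mul_distrib (f := fun i => (-1 : ℂ) ^ (n i - 1)),
    Finset.prod_mul_distrib (f := fun _ => (-1 : ℂ)), ← Finset.prod_pow_eq_pow_sum]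
  -- Three signs cancel: the prefactor, the parity of the kernels under x ↦ -x, and one sign for
  -- each inverted geometric sum.
  have h2 : (∏ i : Fin d, (-1 : ℂ) ^ n i) * (∏ i, (-1 : ℂ) ^ (n i - 1)) * ∏ _i : Fin d, (-1 : ℂ) = 1 := by
    rw [← Finset.prod_mul_distrib, ← Finset.prod_mul_distrib]
    refine Finset.prod_eq_one fun i _ => ?_
    rw [← pow_add, ← pow_succ]
    exact Even.neg_one_pow ⟨n i, by have := hn i; omega⟩
  linear_combination ((∏ i, halfKernel (-1) (n i) (x i)) *
        ∏ j, geomSumFull (∏ k ∈ Finset.Ici j, z k * Complex.exp (-(x k : ℂ)))) * h2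

/-! ### The basic functions of one real variable -/

/-- The function `W / (1 - W)` with `W = z * exp (-x)`. -/
def expSum (z : ℂ) (x : ℝ) : ℂ := geomSum (z * Complex.exp (-(x : ℂ)))

/-- The function `1 / (1 - W)` with `W = z * exp (-x)`. -/
def expSumFull (z : ℂ) (x : ℝ) : ℂ := geomSumFull (z * Complex.exp (-(x : ℂ)))

/-- `f` is continuous and bounded by a multiple of `exp u`. -/
def ExpBounded {α : Type*} [TopologicalSpace α] (f : α → ℂ) (u : α → ℝ) : Prop :=
  Continuous f ∧ ∃ C : ℝ, ∀ x, ‖f x‖ ≤ C * Real.exp (u x)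

theorem ExpBounded.mul {α : Type*} [TopologicalSpace α] {f g : α → ℂ} {u v : α → ℝ}
    (hf : ExpBounded f u) (hg : ExpBounded g v) :
    ExpBounded (fun x => f x * g x) (fun x => u x + v x) := by
  obtain ⟨hf, C, hC⟩ := hf
  obtain ⟨hg, D, hD⟩ := hg
  refine ⟨hf.mul hg, C * D, fun x => ?_⟩
  rw [norm_mul, Real.exp_add]
  calc ‖f x‖ * ‖g x‖ ≤ (C * Real.exp (u x)) * (D * Real.exp (v x)) :=
        mul_le_mul (hC x) (hD x) (norm_nonneg _) ((norm_nonneg _).trans (hC x))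
    _ = _ := by ring

theorem ExpBounded.comp {α β : Type*} [TopologicalSpace α] [TopologicalSpace β] {f : α → ℂ}
    {u : α → ℝ} (hf : ExpBounded f u) {L : β → α} (hL : Continuous L) :
    ExpBounded (fun x => f (L x)) (fun x => u (L x)) :=
  ⟨hf.1.comp hL, hf.2.imp fun _ h x => h (L x)⟩

theorem ExpBounded.congr {α : Type*} [TopologicalSpace α] {f : α → ℂ} {u v : α → ℝ}
    (hf : ExpBounded f u) (h : ∀ x, u x = v x) : ExpBounded f v := by
  rwa [← funext h]

theorem one_sub_mul_exp_ne_zero {z : ℂ} (hz : -z ∈ Complex.slitPlane) (x : ℝ) :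
    1 - z * Complex.exp (-(x : ℂ)) ≠ 0 := by
  have h : -(z * ((Real.exp (-x) : ℝ) : ℂ)) ∈ Complex.slitPlane := by
    rw [neg_mem_slitPlane_iff] at hz ⊢
    rintro ⟨r, hr, h⟩
    refine hz ⟨r * Real.exp x, mul_nonneg hr (Real.exp_pos x).le, ?_⟩
    have h2 : ((Real.exp (-x) : ℝ) : ℂ) * (Real.exp x : ℝ) = 1 := by
      rw [← Complex.ofReal_mul, ← Real.exp_add]
      simp
    push_cast at h h2 ⊢
    rw [h, mul_assoc, h2, mul_one]
  have := Complex.slitPlane_ne_zero (one_sub_mem_slitPlane h)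
  simpa using this

/-- After division by 1 + r and with s = r/(1 + r), the point (1 - s) - zs runs over the segment
from 1 to -z. This is a compact subset of the slit plane, so its distance to 0 has a positive
minimum. -/
theorem exists_le_norm_one_sub {z : ℂ} (hz : -z ∈ Complex.slitPlane) :
    ∃ c : ℝ, 0 < c ∧ ∀ r : ℝ, 0 ≤ r → c * (1 + r) ≤ ‖1 - z * r‖ := by
  have hc : ContinuousOn (fun s : ℝ => ‖((1 - s : ℝ) : ℂ) - z * s‖) (Icc 0 1) := by fun_prop
  obtain ⟨s, hs, hmin⟩ := isCompact_Icc.exists_isMinOn (nonempty_Icc.2 zero_le_one) hc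
  have hmem : (1 - s) • (1 : ℂ) + s • (-z) ∈ Complex.slitPlane :=
    starConvex_iff_segment_subset.1 Complex.starConvex_one_slitPlane hz
      ⟨1 - s, s, by linarith [hs.2], hs.1, by ring, rfl⟩
  refine ⟨_, norm_pos_iff.2 (Complex.slitPlane_ne_zero (?_ : ((1 - s : ℝ) : ℂ) - z * s ∈ _)),
    fun r hr => ?_⟩
  · convert hmem using 1
    simp only [Complex.real_smul]
    ring
  · have h1 : 0 < 1 + r := by linarith
    have h2 := hmin (show r / (1 + r) ∈ Icc (0 : ℝ) 1 from
      ⟨by positivity, by rw [div_le_one h1]; linarith⟩)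
    have h3 : ((1 - r / (1 + r) : ℝ) : ℂ) - z * (r / (1 + r) : ℝ)
        = (1 - z * r) / ((1 + r : ℝ) : ℂ) := by
      have : ((1 + r : ℝ) : ℂ) ≠ 0 := by exact_mod_cast h1.ne'
      push_cast at this ⊢
      field_simp
      ring
    simp only [mem_ofPred_eq, h3, norm_div, Complex.norm_of_nonneg h1.le] at h2
    exact (le_div_iff₀ h1).1 h2

theorem exp_neg_div_le {θ : ℝ} (h0 : 0 ≤ θ) (h1 : θ ≤ 1) (x : ℝ) :
    Real.exp (-x) / (1 + Real.exp (-x)) ≤ Real.exp (-(θ * x)) := by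
  have hp := Real.exp_pos (-x)
  rcases le_total 0 x with hx | hx
  · calc Real.exp (-x) / (1 + Real.exp (-x)) ≤ Real.exp (-x) := div_le_self hp.le (by linarith)
      _ ≤ _ := Real.exp_le_exp.2 (by nlinarith)
  · calc Real.exp (-x) / (1 + Real.exp (-x)) ≤ 1 := by rw [div_le_one (by linarith)]; linarith
      _ ≤ _ := Real.one_le_exp (by nlinarith)

/-- The function decays like e^(-x) at +∞ and stays bounded at -∞, so every rate between 0 and 1 is
available on the whole line. The choice of `θ` is tuned later so that a product of such factors
decays at rate 1/2 in each variable of a given sign sector. -/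
theorem expBounded_expSum {z : ℂ} (hz : -z ∈ Complex.slitPlane) {θ : ℝ} (h0 : 0 ≤ θ)
    (h1 : θ ≤ 1) : ExpBounded (expSum z) (fun x => -(θ * x)) := by
  obtain ⟨c, hc, hle⟩ := exists_le_norm_one_sub hz
  refine ⟨?_, ‖z‖ / c, fun x => ?_⟩
  · unfold expSum geomSum
    exact Continuous.div (by fun_prop) (by fun_prop) (one_sub_mul_exp_ne_zero hz)
  · have h2 := hle _ (Real.exp_pos (-x)).le
    have h3 : ‖expSum z x‖ = ‖z‖ * Real.exp (-x) / ‖1 - z * (Real.exp (-x) : ℝ)‖ := by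
      rw [expSum, geomSum, norm_div, norm_mul]
      push_cast
      rw [← Complex.ofReal_neg, Complex.norm_exp_ofReal]
    have hp := Real.exp_pos (-x)
    rw [h3]
    calc ‖z‖ * Real.exp (-x) / ‖1 - z * (Real.exp (-x) : ℝ)‖
        ≤ ‖z‖ * Real.exp (-x) / (c * (1 + Real.exp (-x))) := by gcongr
      _ = ‖z‖ / c * (Real.exp (-x) / (1 + Real.exp (-x))) := by field_simp
      _ ≤ _ := by
        gcongr
        exact exp_neg_div_le h0 h1 x

theorem expBounded_expSumFull {z : ℂ} (hz : -z ∈ Complex.slitPlane) {θ : ℝ} (h0 : 0 ≤ θ)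
    (h1 : θ ≤ 1) : ExpBounded (expSumFull z) (fun x => θ * x) := by
  obtain ⟨c, hc, hle⟩ := exists_le_norm_one_sub hz
  refine ⟨?_, 1 / c, fun x => ?_⟩
  · unfold expSumFull geomSumFull
    exact Continuous.div (by fun_prop) (by fun_prop) (one_sub_mul_exp_ne_zero hz)
  · have h2 := hle _ (Real.exp_pos (-x)).le
    have h3 : ‖expSumFull z x‖ = 1 / ‖1 - z * (Real.exp (-x) : ℝ)‖ := by
      rw [expSumFull, geomSumFull, norm_div, norm_one]
      push_cast
      rfl
    have hp := Real.exp_pos (-x)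
    have h4 : 1 / (1 + Real.exp (-x)) = Real.exp (- -x) / (1 + Real.exp (- -x)) := by
      rw [neg_neg, Real.exp_neg]
      have := Real.exp_pos x
      field_simp
      ring
    rw [h3]
    calc 1 / ‖1 - z * (Real.exp (-x) : ℝ)‖ ≤ 1 / (c * (1 + Real.exp (-x))) := by gcongr
      _ = 1 / c * (1 / (1 + Real.exp (-x))) := by field_simp
      _ ≤ _ := by
        gcongr
        rw [h4]
        simpa using exp_neg_div_le h0 h1 (-x)

/-! ### Integrability -/

theorem integrable_norm_halfKernel_mul_exp {σ : ℝ} (hσ : σ = 1 ∨ σ = -1) (n : ℕ) :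
    Integrable fun x => ‖halfKernel σ n x‖ * Real.exp (-(σ * x / 2)) := by
  have key : Integrable fun x => ‖halfKernel 1 n x‖ * Real.exp (-(x / 2)) := by
    refine (integrable_halfKernel_one_mul_exp n (c := 1 / 2) (by norm_num)).norm.congr
      (Eventually.of_forall fun x => ?_)
    have h : (-(((1 / 2 : ℝ) : ℂ) * (x : ℂ))) = ((-(x / 2) : ℝ) : ℂ) := by push_cast; ring
    simp only [norm_mul, h, Complex.norm_exp_ofReal]
  rcases hσ with rfl | rfl
  · simpa using key
  · refine key.comp_neg.congr (Eventually.of_forall fun x => ?_)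
    simp [halfKernel_neg, neg_div]

theorem integrable_halfKernel_mul {σ : ℝ} (hσ : σ = 1 ∨ σ = -1) (n : ℕ) {f : ℝ → ℂ}
    (hf : ExpBounded f fun x => -(σ * x / 2)) : Integrable fun x => halfKernel σ n x * f x := by
  obtain ⟨hc, C, hC⟩ := hf
  refine ((integrable_norm_halfKernel_mul_exp hσ n).const_mul C).mono'
    ((measurable_halfKernel σ n).mul hc.measurable).aestronglyMeasurable
    (Eventually.of_forall fun x => ?_)
  rw [norm_mul]
  calc _ ≤ ‖halfKernel σ n x‖ * (C * Real.exp (-(σ * x / 2))) := by gcongr; exact hC x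
    _ = _ := by ring

/-- On the sector with signs `σ`, `τ` the assumed bound is exp(-(|x.1| + |x.2|)/2), which absorbs
the polynomial kernels. -/
theorem integrable_halfKernel_mul₂ {σ τ : ℝ} (hσ : σ = 1 ∨ σ = -1) (hτ : τ = 1 ∨ τ = -1)
    (m n : ℕ) {f : ℝ × ℝ → ℂ} (hf : ExpBounded f fun x => -(σ * x.1 / 2) + -(τ * x.2 / 2)) :
    Integrable fun x : ℝ × ℝ => halfKernel σ m x.1 * halfKernel τ n x.2 * f x := by
  obtain ⟨hc, C, hC⟩ := hf
  refine (((integrable_norm_halfKernel_mul_exp hσ m).mul_prod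
    (integrable_norm_halfKernel_mul_exp hτ n)).const_mul C).mono' ?_
    (Eventually.of_forall fun x => ?_)
  · exact ((((measurable_halfKernel σ m).comp measurable_fst).mul
      ((measurable_halfKernel τ n).comp measurable_snd)).mul hc.measurable).aestronglyMeasurable
  · rw [norm_mul, norm_mul]
    calc _ ≤ ‖halfKernel σ m x.1‖ * ‖halfKernel τ n x.2‖ * (C * Real.exp
        (-(σ * x.1 / 2) + -(τ * x.2 / 2))) := by gcongr; exact hC x
      _ = _ := by rw [Real.exp_add]; ring

theorem integrable_halfKernel_mul₃ {ρ σ τ : ℝ} (hρ : ρ = 1 ∨ ρ = -1) (hσ : σ = 1 ∨ σ = -1)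
    (hτ : τ = 1 ∨ τ = -1) (l m n : ℕ) {f : ℝ × ℝ × ℝ → ℂ}
    (hf : ExpBounded f fun x => -(ρ * x.1 / 2) + (-(σ * x.2.1 / 2) + -(τ * x.2.2 / 2))) :
    Integrable fun x : ℝ × ℝ × ℝ =>
      halfKernel ρ l x.1 * halfKernel σ m x.2.1 * halfKernel τ n x.2.2 * f x := by
  obtain ⟨hc, C, hC⟩ := hf
  refine (((integrable_norm_halfKernel_mul_exp hρ l).mul_prod
    ((integrable_norm_halfKernel_mul_exp hσ m).mul_prod
    (integrable_norm_halfKernel_mul_exp hτ n))).const_mul C).mono' ?_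
    (Eventually.of_forall fun x => ?_)
  · exact (((((measurable_halfKernel ρ l).comp measurable_fst).mul
      ((measurable_halfKernel σ m).comp (measurable_fst.comp measurable_snd))).mul
      ((measurable_halfKernel τ n).comp (measurable_snd.comp measurable_snd))).mul
      hc.measurable).aestronglyMeasurable
  · rw [norm_mul, norm_mul, norm_mul]
    calc _ ≤ ‖halfKernel ρ l x.1‖ * ‖halfKernel σ m x.2.1‖ * ‖halfKernel τ n x.2.2‖ *
        (C * Real.exp (-(ρ * x.1 / 2) + (-(σ * x.2.1 / 2) + -(τ * x.2.2 / 2)))) := by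
          gcongr; exact hC x
      _ = _ := by rw [Real.exp_add, Real.exp_add]; ring

/-! ### Small depth -/

theorem integral_fin_one (f : (Fin 1 → ℝ) → ℂ) : ∫ x, f x = ∫ a : ℝ, f ![a] := by
  refine (((volume_preserving_funUnique (Fin 1) ℝ).symm
    (MeasurableEquiv.funUnique (Fin 1) ℝ)).integral_comp' f).symm.trans ?_
  congr 1
  ext a
  congr 1
  ext i
  fin_cases i
  rfl

theorem integral_fin_two (f : (Fin 2 → ℝ) → ℂ) : ∫ x, f x = ∫ p : ℝ × ℝ, f ![p.1, p.2] := by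
  rw [← ((volume_preserving_finTwoArrow ℝ).symm MeasurableEquiv.finTwoArrow).integral_comp' f]
  congr 1

theorem integral_fin_three (f : (Fin 3 → ℝ) → ℂ) :
    ∫ x, f x = ∫ p : ℝ × ℝ × ℝ, f ![p.1, p.2.1, p.2.2] := by
  have h : MeasurePreserving (MeasurableEquiv.prodCongr (MeasurableEquiv.refl ℝ)
      (MeasurableEquiv.finTwoArrow (α := ℝ)).symm) :=
    (MeasurePreserving.id (volume : Measure ℝ)).prod
      ((volume_preserving_finTwoArrow ℝ).symm MeasurableEquiv.finTwoArrow)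
  rw [← ((volume_preserving_piFinSuccAbove (fun _ : Fin 3 => ℝ) 0).symm
    (MeasurableEquiv.piFinSuccAbove (fun _ => ℝ) 0)).integral_comp' f, ← h.integral_comp']
  congr 1
  ext p
  congr 1
  ext i
  fin_cases i <;> rfl

theorem Fin.Ici_one_of_two : Finset.Ici (1 : Fin 2) = {1} := by decide

theorem Fin.Ici_one_of_three : Finset.Ici (1 : Fin 3) = {1, 2} := by decide

theorem Fin.Ici_two_of_three : Finset.Ici (2 : Fin 3) = {2} := by decide

theorem mpl_one {n : ℕ} (hn : 1 ≤ n) {z : ℂ} (hz : 1 - z ∈ Complex.slitPlane) :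
    mpl ![n] ![z] = ∫ x : ℝ, halfKernel 1 n x * expSum z x := by
  rw [mpl_eq_mplIntegral (by simpa using hn), mplIntegral, integral_fin_one]
  · simp [mplIntegrand, geomChain, expSum]
  · intro j
    fin_cases j
    simpa using hz

theorem mpl_two {n₁ n₂ : ℕ} (h₁ : 1 ≤ n₁) (h₂ : 1 ≤ n₂) {z₁ z₂ : ℂ}
    (hz₂ : 1 - z₂ ∈ Complex.slitPlane) (hz₁₂ : 1 - z₁ * z₂ ∈ Complex.slitPlane) :
    mpl ![n₁, n₂] ![z₁, z₂] = ∫ x : ℝ × ℝ, halfKernel 1 n₁ x.1 * halfKernel 1 n₂ x.2 *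
      (expSum (z₁ * z₂) (x.1 + x.2) * expSum z₂ x.2) := by
  rw [mpl_eq_mplIntegral (by intro i; fin_cases i <;> simpa), mplIntegral, integral_fin_two]
  · congr 1
    ext x
    simp [mplIntegrand, geomChain, expSum, Fin.Ici_one_of_two,
      Fin.prod_univ_two, Complex.exp_add]
    exact Or.inl (Or.inl (by ring_nf))
  · intro j
    fin_cases j
    · simpa [Fin.prod_univ_two] using hz₁₂
    · simpa [Fin.Ici_one_of_two] using hz₂

theorem mpl_three {n₁ n₂ n₃ : ℕ} (h₁ : 1 ≤ n₁) (h₂ : 1 ≤ n₂) (h₃ : 1 ≤ n₃) {z₁ z₂ z₃ : ℂ}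
    (hz₃ : 1 - z₃ ∈ Complex.slitPlane) (hz₂₃ : 1 - z₂ * z₃ ∈ Complex.slitPlane)
    (hz₁₂₃ : 1 - z₁ * z₂ * z₃ ∈ Complex.slitPlane) :
    mpl ![n₁, n₂, n₃] ![z₁, z₂, z₃] = ∫ x : ℝ × ℝ × ℝ,
      halfKernel 1 n₁ x.1 * halfKernel 1 n₂ x.2.1 * halfKernel 1 n₃ x.2.2 *
      (expSum (z₁ * z₂ * z₃) (x.1 + x.2.1 + x.2.2) * expSum (z₂ * z₃) (x.2.1 + x.2.2) *
        expSum z₃ x.2.2) := by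
  rw [mpl_eq_mplIntegral (by intro i; fin_cases i <;> simpa), mplIntegral, integral_fin_three]
  · congr 1
    ext x
    simp [mplIntegrand, geomChain, expSum, Fin.Ici_one_of_three,
      Fin.Ici_two_of_three, Fin.prod_univ_three, Complex.exp_add]
    exact Or.inl (Or.inl (by ring_nf))
  · intro j
    fin_cases j
    · simpa [Fin.prod_univ_three] using hz₁₂₃
    · simpa [Fin.Ici_one_of_three] using hz₂₃
    · simpa [Fin.Ici_two_of_three] using hz₃

theorem inv_neg_mem_slitPlane {u : ℂ} (hu : -u ∈ Complex.slitPlane) :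
    -u⁻¹ ∈ Complex.slitPlane := by
  rw [neg_mem_slitPlane_iff] at hu ⊢
  rintro ⟨r, hr, h⟩
  exact hu ⟨r⁻¹, Set.mem_Ici.2 (inv_nonneg.2 (Set.mem_Ici.1 hr)), by rw [← inv_inv u, ← h]; push_cast; rfl⟩

theorem ne_zero_of_neg_mem_slitPlane {u : ℂ} (hu : -u ∈ Complex.slitPlane) : u ≠ 0 :=
  neg_ne_zero.1 (Complex.slitPlane_ne_zero hu)

theorem neg_one_pow_mul_mpl_inv_one {n : ℕ} (hn : 1 ≤ n) {z : ℂ} (hz : -z ∈ Complex.slitPlane) :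
    (-1 : ℂ) ^ n * mpl ![n] ![z⁻¹] = ∫ x : ℝ, halfKernel (-1) n x * expSumFull z x := by
  have h := neg_one_pow_mul_mplIntegral_inv (n := ![n]) (by simpa using hn) (z := ![z])
    (by simpa using ne_zero_of_neg_mem_slitPlane hz)
  rw [integral_fin_one] at h
  rw [mpl_eq_mplIntegral (by simpa using hn)]
  · have e : (fun i => (![z] i)⁻¹) = ![z⁻¹] := by ext i; fin_cases i; rfl
    rw [e] at h
    simpa [expSumFull] using h
  · intro j
    fin_cases j
    simpa using one_sub_mem_slitPlane (inv_neg_mem_slitPlane hz)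

theorem neg_one_pow_mul_mpl_inv_two {n₁ n₂ : ℕ} (h₁ : 1 ≤ n₁) (h₂ : 1 ≤ n₂) {z₁ z₂ : ℂ}
    (hz₂ : -z₂ ∈ Complex.slitPlane) (hz₁₂ : -(z₁ * z₂) ∈ Complex.slitPlane) :
    (-1 : ℂ) ^ (n₁ + n₂) * mpl ![n₁, n₂] ![z₁⁻¹, z₂⁻¹] = ∫ x : ℝ × ℝ,
      halfKernel (-1) n₁ x.1 * halfKernel (-1) n₂ x.2 *
      (expSumFull (z₁ * z₂) (x.1 + x.2) * expSumFull z₂ x.2) := by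
  have hne := left_ne_zero_of_mul (ne_zero_of_neg_mem_slitPlane hz₁₂)
  have h := neg_one_pow_mul_mplIntegral_inv (n := ![n₁, n₂])
    (by intro i; fin_cases i <;> simpa) (z := ![z₁, z₂])
    (by intro i; fin_cases i <;> simp [ne_zero_of_neg_mem_slitPlane hz₂, hne])
  rw [integral_fin_two] at h
  rw [mpl_eq_mplIntegral (by intro i; fin_cases i <;> simpa)]
  · have e : (fun i => (![z₁, z₂] i)⁻¹) = ![z₁⁻¹, z₂⁻¹] := by ext i; fin_cases i <;> rfl
    rw [e, Fin.sum_univ_two] at h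
    refine h.trans ?_
    congr 1
    ext x
    simp [expSumFull, Fin.Ici_one_of_two, Fin.prod_univ_two,
      Complex.exp_add]
    exact Or.inl (Or.inl (by ring_nf))
  · intro j
    fin_cases j
    · have := one_sub_mem_slitPlane (inv_neg_mem_slitPlane hz₁₂)
      simpa [Fin.prod_univ_two, mul_inv, -mul_inv_rev] using this
    · simpa [Fin.Ici_one_of_two] using one_sub_mem_slitPlane (inv_neg_mem_slitPlane hz₂)

theorem neg_one_pow_mul_mpl_inv_three {n₁ n₂ n₃ : ℕ} (h₁ : 1 ≤ n₁) (h₂ : 1 ≤ n₂) (h₃ : 1 ≤ n₃)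
    {z₁ z₂ z₃ : ℂ} (hz₃ : -z₃ ∈ Complex.slitPlane) (hz₂₃ : -(z₂ * z₃) ∈ Complex.slitPlane)
    (hz₁₂₃ : -(z₁ * z₂ * z₃) ∈ Complex.slitPlane) :
    (-1 : ℂ) ^ (n₁ + n₂ + n₃) * mpl ![n₁, n₂, n₃] ![z₁⁻¹, z₂⁻¹, z₃⁻¹] = ∫ x : ℝ × ℝ × ℝ,
      halfKernel (-1) n₁ x.1 * halfKernel (-1) n₂ x.2.1 * halfKernel (-1) n₃ x.2.2 *
      (expSumFull (z₁ * z₂ * z₃) (x.1 + x.2.1 + x.2.2) * expSumFull (z₂ * z₃) (x.2.1 + x.2.2) *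
        expSumFull z₃ x.2.2) := by
  have hne₁ := left_ne_zero_of_mul (left_ne_zero_of_mul (ne_zero_of_neg_mem_slitPlane hz₁₂₃))
  have hne₂ := left_ne_zero_of_mul (ne_zero_of_neg_mem_slitPlane hz₂₃)
  have h := neg_one_pow_mul_mplIntegral_inv (n := ![n₁, n₂, n₃])
    (by intro i; fin_cases i <;> simpa) (z := ![z₁, z₂, z₃])
    (by intro i; fin_cases i <;> simp [ne_zero_of_neg_mem_slitPlane hz₃, hne₁, hne₂])
  rw [integral_fin_three] at h
  rw [mpl_eq_mplIntegral (by intro i; fin_cases i <;> simpa)]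
  · have e : (fun i => (![z₁, z₂, z₃] i)⁻¹) = ![z₁⁻¹, z₂⁻¹, z₃⁻¹] := by
      ext i
      fin_cases i <;> rfl
    rw [e, Fin.sum_univ_three] at h
    refine h.trans ?_
    congr 1
    ext x
    simp [expSumFull, Fin.Ici_one_of_three, Fin.Ici_two_of_three,
      Fin.prod_univ_three, Complex.exp_add]
    exact Or.inl (Or.inl (by ring_nf))
  · intro j
    fin_cases j
    · have := one_sub_mem_slitPlane (inv_neg_mem_slitPlane hz₁₂₃)
      simpa [Fin.prod_univ_three, mul_inv, -mul_inv_rev] using this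
    · have := one_sub_mem_slitPlane (inv_neg_mem_slitPlane hz₂₃)
      simpa [Fin.Ici_one_of_three, mul_inv, -mul_inv_rev] using this
    · simpa [Fin.Ici_two_of_three] using one_sub_mem_slitPlane (inv_neg_mem_slitPlane hz₃)

/-! ### The parity relation in depth one -/

/-- The increasing tuples of length one are the positive integers. -/
def natEquivPosTuple : ℕ ≃ PosTuple 1 where
  toFun m := ⟨fun _ => m + 1, Subsingleton.strictMono _, fun _ => Nat.succ_pos m⟩
  invFun k := k.1 0 - 1
  left_inv m := by simp
  right_inv k := by
    ext i
    fin_cases i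
    exact Nat.sub_add_cancel (k.2.2 0)

theorem mplSeries_one (n : ℕ) (z : ℂ) :
    mplSeries ![n] ![z] = ∑' m : ℕ, z ^ (m + 1) / ((m + 1 : ℕ) : ℂ) ^ n := by
  rw [mplSeries, ← natEquivPosTuple.tsum_eq]
  simp [natEquivPosTuple]

theorem mpl_one_eq_neg_log {z : ℂ} (hz : 1 - z ∈ Complex.slitPlane) :
    mpl ![1] ![z] = -Complex.log (1 - z) := by
  refine IsMPLValue.mpl_eq ⟨fun t => -Complex.log (1 - t * z), fun t ht => ?_, ?_, by simp⟩
  · have h : 1 - t * z ∈ Complex.slitPlane := by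
      obtain ⟨a, b, ha, hb, hab, rfl⟩ := ht
      have := one_sub_mul_mem_slitPlane hz hb (by linarith)
      simpa [mul_comm] using this
    exact (AnalyticAt.clog (by fun_prop : AnalyticAt ℂ (fun t => 1 - t * z) t) h).fun_neg
  · have hc : Tendsto (fun t : ℂ => ‖t * z‖) (𝓝 0) (𝓝 0) := by
      have : Continuous fun t : ℂ => ‖t * z‖ := by fun_prop
      simpa using this.tendsto 0
    filter_upwards [hc.eventually (gt_mem_nhds one_pos)] with t ht
    have e : (fun i => t * ![z] i) = ![t * z] := by ext i; fin_cases i; rfl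
    rw [e, mplSeries_one]
    have h := Complex.hasSum_taylorSeries_neg_log ht
    -- The Taylor series is indexed from 0, where its term vanishes through division by zero; the
    -- polylogarithm starts at 1.
    rw [← hasSum_nat_add_iff' 1] at h
    have h2 := h.tsum_eq
    simp only [Finset.range_one, Finset.sum_singleton, pow_zero, Nat.cast_zero, div_zero,
      sub_zero] at h2
    simp only [pow_one]
    exact h2.symm

theorem summable_one_div_nat_succ_pow {n : ℕ} (hn : 2 ≤ n) :
    Summable fun m : ℕ => 1 / ((m + 1 : ℕ) : ℝ) ^ n :=
  (summable_nat_add_iff 1).2 (Real.summable_one_div_nat_pow.2 hn)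

theorem summable_pow_div_pow {n : ℕ} (hn : 2 ≤ n) {z : ℂ} (hz : ‖z‖ = 1) :
    Summable fun m : ℕ => z ^ (m + 1) / ((m + 1 : ℕ) : ℂ) ^ n := by
  refine Summable.of_norm ((summable_one_div_nat_succ_pow hn).congr fun m => ?_)
  rw [norm_div, norm_pow, norm_pow, hz, one_pow, Complex.norm_natCast]

theorem hasSum_mpl_one {n : ℕ} (hn : 2 ≤ n) {z : ℂ} (hz : ‖z‖ = 1)
    (hz' : 1 - z ∈ Complex.slitPlane) :
    HasSum (fun m : ℕ => z ^ (m + 1) / ((m + 1 : ℕ) : ℂ) ^ n) (mpl ![n] ![z]) := by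
  have hn' : ∀ i, 1 ≤ ![n] i := by
    intro i
    fin_cases i
    exact one_le_two.trans hn
  rw [mpl_eq_mplIntegral hn', mplIntegral_eq_mplSeries hn', mplSeries_one]
  · exact (summable_pow_div_pow hn hz).hasSum
  · intro i
    fin_cases i
    exact hz.le
  · rw [← natEquivPosTuple.summable_iff]
    refine (summable_one_div_nat_succ_pow hn).congr fun m => ?_
    simp [natEquivPosTuple, hz]
  · intro j
    fin_cases j
    simpa using hz'

theorem ofReal_bernoulliFun (n : ℕ) (x : ℝ) :
    ((bernoulliFun n x : ℝ) : ℂ) = Polynomial.aeval (x : ℂ) (Polynomial.bernoulli n) := by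
  have h := Polynomial.aeval_algebraMap_apply ℂ x (Polynomial.bernoulli n)
  rw [bernoulliFun, Polynomial.eval_map_algebraMap]
  exact h.symm

theorem two_pi_I_ne_zero : 2 * (Real.pi : ℂ) * Complex.I ≠ 0 := Complex.two_pi_I_ne_zero

theorem log_neg_exp {x : ℝ} (h0 : 0 < x) (h1 : x < 1) :
    Complex.log (-Complex.exp (2 * Real.pi * Complex.I * x))
      = 2 * Real.pi * Complex.I * (x - 1 / 2) := by
  have e : -Complex.exp (2 * Real.pi * Complex.I * x)
      = Complex.exp (2 * Real.pi * Complex.I * (x - 1 / 2)) := by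
    rw [mul_sub, Complex.exp_sub]
    have : 2 * (Real.pi : ℂ) * Complex.I * (1 / 2) = Real.pi * Complex.I := by ring
    rw [this, Complex.exp_pi_mul_I, div_neg, div_one]
  have him : (2 * (Real.pi : ℂ) * Complex.I * (x - 1 / 2)).im = 2 * Real.pi * (x - 1 / 2) := by
    have : 2 * (Real.pi : ℂ) * Complex.I * (x - 1 / 2)
        = ((2 * Real.pi * (x - 1 / 2) : ℝ) : ℂ) * Complex.I := by push_cast; ring
    rw [this, Complex.mul_I_im, Complex.ofReal_re]
  have hpi := Real.pi_pos
  rw [e, Complex.log_exp]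
  · rw [him]
    nlinarith
  · rw [him]
    nlinarith

theorem bernoulliBeta_exp (n : ℕ) {x : ℝ} (h0 : 0 < x) (h1 : x < 1) :
    bernoulliBeta n (Complex.exp (2 * Real.pi * Complex.I * x))
      = (2 * Real.pi * Complex.I) ^ n / n.factorial * bernoulliFun n x := by
  rw [bernoulliBeta, log_neg_exp h0 h1, ofReal_bernoulliFun]
  congr 3
  field_simp [two_pi_I_ne_zero]
  ring

theorem neg_exp_mem_slitPlane {x : ℝ} (h0 : 0 < x) (h1 : x < 1) :
    -Complex.exp (2 * Real.pi * Complex.I * x) ∈ Complex.slitPlane := by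
  rw [neg_mem_slitPlane_iff]
  rintro ⟨r, hr, h⟩
  have hn : ‖Complex.exp (2 * Real.pi * Complex.I * x)‖ = 1 := by
    have e : 2 * (Real.pi : ℂ) * Complex.I * x = ((2 * Real.pi * x : ℝ) : ℂ) * Complex.I := by
      push_cast
      ring
    rw [e, Complex.norm_exp_ofReal_mul_I]
  simp only at h
  rw [← h, Complex.norm_of_nonneg (Set.mem_Ici.1 hr)] at hn
  rw [hn] at h
  have h2 := log_neg_exp h0 h1
  rw [← h] at h2
  have h3 := congrArg Complex.im h2
  have : 2 * (Real.pi : ℂ) * Complex.I * (x - 1 / 2)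
      = ((2 * Real.pi * (x - 1 / 2) : ℝ) : ℂ) * Complex.I := by push_cast; ring
  rw [this, Complex.mul_I_im, Complex.ofReal_re] at h3
  rw [Complex.ofReal_one, Complex.log_neg_one, Complex.mul_I_im, Complex.ofReal_re] at h3
  nlinarith [Real.pi_pos]

/-- For |z| = 1 the left side is the sum of e^(2πikx)/k^n over nonzero integers k, which is the
Fourier series of the Bernoulli polynomial. Absolute convergence needs n ≥ 2. -/
theorem parity_one_on_circle {n : ℕ} (hn : 2 ≤ n) {x : ℝ} (h0 : 0 < x) (h1 : x < 1) :
    mpl ![n] ![Complex.exp (2 * Real.pi * Complex.I * x)]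
      + (-1 : ℂ) ^ n * mpl ![n] ![(Complex.exp (2 * Real.pi * Complex.I * x))⁻¹]
      = -bernoulliBeta n (Complex.exp (2 * Real.pi * Complex.I * x)) := by
  have hs := neg_exp_mem_slitPlane h0 h1
  rw [bernoulliBeta_exp n h0 h1]
  set z := Complex.exp (2 * Real.pi * Complex.I * x) with hz
  have hnorm : ‖z‖ = 1 := by
    have e : 2 * (Real.pi : ℂ) * Complex.I * x = ((2 * Real.pi * x : ℝ) : ℂ) * Complex.I := by
      push_cast
      ring
    rw [hz, e, Complex.norm_exp_ofReal_mul_I]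
  have h2 := hasSum_mpl_one hn hnorm (one_sub_mem_slitPlane hs)
  have h3 := hasSum_mpl_one hn (z := z⁻¹) (by rw [norm_inv, hnorm, inv_one])
    (one_sub_mem_slitPlane (inv_neg_mem_slitPlane hs))
  have h4 := h2.add (h3.mul_left ((-1 : ℂ) ^ n))
  have h5 := hasSum_one_div_nat_pow_mul_fourier hn ⟨h0.le, h1.le⟩
  rw [← hasSum_nat_add_iff' 1] at h5
  have hn0 : n ≠ 0 := by omega
  simp only [Finset.range_one, Finset.sum_singleton, Nat.cast_zero, zero_pow hn0, div_zero,
    zero_mul, sub_zero] at h5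
  rw [show -((2 * (Real.pi : ℂ) * Complex.I) ^ n / n.factorial * bernoulliFun n x)
    = -(2 * (Real.pi : ℂ) * Complex.I) ^ n / n.factorial * bernoulliFun n x by ring]
  refine h4.unique (h5.congr_fun fun m => ?_)
  have e1 : fourier ((m + 1 : ℕ) : ℤ) (x : UnitAddCircle) = z ^ (m + 1) := by
    rw [fourier_coe_apply, hz, ← Complex.exp_nat_mul]
    congr 1
    push_cast
    ring
  have e2 : fourier (-((m + 1 : ℕ) : ℤ)) (x : UnitAddCircle) = z⁻¹ ^ (m + 1) := by
    rw [fourier_coe_apply, hz, ← Complex.exp_neg, ← Complex.exp_nat_mul]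
    congr 1
    push_cast
    ring
  rw [e1, e2]
  ring

theorem isPreconnected_neg_mem_slitPlane : IsPreconnected {z : ℂ | -z ∈ Complex.slitPlane} := by
  have h := (Complex.starConvex_one_slitPlane.isPathConnected
    Complex.one_mem_slitPlane).isConnected.isPreconnected.image _
    (continuous_neg (G := ℂ)).continuousOn
  rwa [Set.image_neg_eq_neg] at h

theorem differentiableOn_mpl_one {n : ℕ} (hn : 1 ≤ n) :
    DifferentiableOn ℂ (fun z => mpl ![n] ![z]) {z : ℂ | 1 - z ∈ Complex.slitPlane} := by
  have hdom : ∀ z : ℂ, 1 - z ∈ Complex.slitPlane → ![z] ∈ mplCutDomain 1 := by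
    intro z hz j
    fin_cases j
    simpa using hz
  have e : ∀ z : ℂ, (fun i => z * ![(1 : ℂ)] i) = ![z] := by
    intro z
    ext i
    fin_cases i
    simp
  refine ((differentiableOn_mplIntegral ![n] ![1]).mono fun z hz => ?_).congr fun z hz => ?_
  · rw [Set.mem_ofPred_eq, e]
    exact hdom z hz
  · rw [e, mpl_eq_mplIntegral (by simpa using hn) (hdom z hz)]

theorem differentiableOn_bernoulliBeta (n : ℕ) :
    DifferentiableOn ℂ (bernoulliBeta n) {z : ℂ | -z ∈ Complex.slitPlane} := by
  intro z hz
  unfold bernoulliBeta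
  have h1 : DifferentiableAt ℂ (fun z => Complex.log (-z)) z :=
    DifferentiableAt.clog (by fun_prop) hz
  have h2 : DifferentiableAt ℂ (fun z => 1 / 2 + Complex.log (-z) /
    (2 * (Real.pi : ℂ) * Complex.I)) z := (h1.div_const _).const_add _
  have h3 := (Polynomial.differentiable_aeval (𝕜 := ℂ) (Polynomial.bernoulli n)).differentiableAt
    (x := 1 / 2 + Complex.log (-z) / (2 * (Real.pi : ℂ) * Complex.I))
  exact ((h3.comp z h2).const_mul _).differentiableWithinAt

/-- Makes -1 an accumulation point of the part of the unit circle where the identity is known, as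
the identity theorem requires. -/
theorem tendsto_exp_punctured_nhds :
    Tendsto (fun x : ℝ => Complex.exp (2 * Real.pi * Complex.I * x)) (𝓝[>] (1 / 2))
      (𝓝[≠] (-1)) := by
  refine tendsto_nhdsWithin_iff.2 ⟨?_, ?_⟩
  · have hc : Continuous fun x : ℝ => Complex.exp (2 * Real.pi * Complex.I * x) := by fun_prop
    have h := hc.tendsto (1 / 2)
    have e : Complex.exp (2 * Real.pi * Complex.I * ((1 / 2 : ℝ) : ℂ)) = -1 := by
      rw [← Complex.exp_pi_mul_I]
      congr 1
      push_cast
      ring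
    rw [e] at h
    exact h.mono_left nhdsWithin_le_nhds
  · have : Ioo (1 / 2 : ℝ) 1 ∈ 𝓝[>] (1 / 2 : ℝ) := Ioo_mem_nhdsGT (by norm_num)
    filter_upwards [this] with x hx h
    have h2 := log_neg_exp (by linarith [hx.1]) hx.2
    rw [h, neg_neg, Complex.log_one] at h2
    have h3 : (x : ℂ) - 1 / 2 = 0 := (mul_eq_zero.1 h2.symm).resolve_left two_pi_I_ne_zero
    have h4 : x = 1 / 2 := by
      have : ((x - 1 / 2 : ℝ) : ℂ) = 0 := by push_cast; exact h3
      linarith [Complex.ofReal_eq_zero.1 this]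
    linarith [hx.1]

/-- The imaginary parts of 1 - 1/z and -z have opposite signs, so their arguments add up without
leaving (-π, π]. For real z the argument of -z is 0. -/
theorem parity_one_log {z : ℂ} (hz : -z ∈ Complex.slitPlane) :
    Complex.log (1 - z) = Complex.log (1 - z⁻¹) + Complex.log (-z) := by
  have h0 := ne_zero_of_neg_mem_slitPlane hz
  have h1 : 1 - z⁻¹ ≠ 0 :=
    Complex.slitPlane_ne_zero (one_sub_mem_slitPlane (inv_neg_mem_slitPlane hz))
  rw [← (Complex.log_mul_eq_add_log_iff h1 (neg_ne_zero.2 h0)).2]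
  · congr 1
    field_simp
    ring
  · have him : (1 - z⁻¹).im = z.im / Complex.normSq z := by
      simp [Complex.inv_im, neg_div]
    have hpos := Complex.normSq_pos.2 h0
    have a1 := Complex.neg_pi_lt_arg (1 - z⁻¹)
    have a2 := Complex.arg_le_pi (1 - z⁻¹)
    have b1 := Complex.neg_pi_lt_arg (-z)
    have b2 := Complex.arg_le_pi (-z)
    rcases lt_trichotomy z.im 0 with h | h | h
    · have c1 := Complex.arg_neg_iff.2 (by rw [him]; exact div_neg_of_neg_of_pos h hpos)
      have c2 := Complex.arg_nonneg_iff.2 (show 0 ≤ (-z).im by simp; exact h.le)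
      constructor <;> linarith
    · have hzr : (-z).arg = 0 := by
        rw [Complex.arg_eq_zero_iff]
        rw [Complex.mem_slitPlane_iff] at hz
        simp only [Complex.neg_im, h, neg_zero, ne_eq, not_true, or_false] at hz
        exact ⟨hz.le, by simp [h]⟩
      rw [hzr, add_zero]
      exact ⟨a1, a2⟩
    · have c1 := Complex.arg_nonneg_iff.2 (show 0 ≤ (1 - z⁻¹).im by
        rw [him]; exact (div_pos h hpos).le)
      have c2 := Complex.arg_neg_iff.2 (show (-z).im < 0 by simp; exact h)
      constructor <;> linarith

theorem bernoulliBeta_zero (z : ℂ) : bernoulliBeta 0 z = 1 := by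
  simp [bernoulliBeta]

theorem bernoulliBeta_one (z : ℂ) : bernoulliBeta 1 z = Complex.log (-z) := by
  have := two_pi_I_ne_zero
  simp only [bernoulliBeta, Polynomial.bernoulli_one, map_sub, Polynomial.aeval_X,
    Polynomial.aeval_C, pow_one, Nat.factorial_one, Nat.cast_one, div_one]
  have e : (algebraMap ℚ ℂ) 2⁻¹ = 1 / 2 := by
    rw [map_inv₀, map_ofNat, one_div]
  rw [e]
  field_simp
  ring

/-- The parity theorem in depth one. -/
theorem parity_one {n : ℕ} (hn : 1 ≤ n) {z : ℂ} (hz : -z ∈ Complex.slitPlane) :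
    mpl ![n] ![z] + (-1 : ℂ) ^ n * mpl ![n] ![z⁻¹] = -bernoulliBeta n z := by
  rcases hn.eq_or_lt with rfl | hn2
  · rw [bernoulliBeta_one, mpl_one_eq_neg_log (one_sub_mem_slitPlane hz),
      mpl_one_eq_neg_log (one_sub_mem_slitPlane (inv_neg_mem_slitPlane hz)), parity_one_log hz]
    ring
  · have hO : IsOpen {z : ℂ | -z ∈ Complex.slitPlane} :=
      Complex.isOpen_slitPlane.preimage continuous_neg
    have hd : DifferentiableOn ℂ (fun z => mpl ![n] ![z] + (-1 : ℂ) ^ n * mpl ![n] ![z⁻¹])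
        {z : ℂ | -z ∈ Complex.slitPlane} := by
      refine ((differentiableOn_mpl_one hn).mono fun z hz => one_sub_mem_slitPlane hz).add
        (DifferentiableOn.const_mul ?_ _)
      refine (differentiableOn_mpl_one hn).comp (t := {z : ℂ | 1 - z ∈ Complex.slitPlane})
        (f := fun z => z⁻¹) ?_ fun z hz => one_sub_mem_slitPlane (inv_neg_mem_slitPlane hz)
      exact differentiableOn_inv.mono fun z hz => ne_zero_of_neg_mem_slitPlane hz
    refine (hd.analyticOnNhd hO).eqOn_of_preconnected_of_frequently_eq
      ((differentiableOn_bernoulliBeta n).neg.analyticOnNhd hO) isPreconnected_neg_mem_slitPlane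
      (z₀ := -1) (by simp) ?_ hz
    refine tendsto_exp_punctured_nhds.frequently (Eventually.frequently ?_)
    have : Ioo (1 / 2 : ℝ) 1 ∈ 𝓝[>] (1 / 2 : ℝ) := Ioo_mem_nhdsGT (by norm_num)
    filter_upwards [this] with x hx
    exact parity_one_on_circle hn2 (by linarith [hx.1]) hx.2

/-! ### Translation of the functions `β` -/

/-- The generating function of B_n(u)/n! is X e^(uX)/(e^X - 1), so a shift by `v` multiplies it by
e^(vX). The proof cancels the nonzero factor e^X - 1. -/
theorem aeval_bernoulli_add (n : ℕ) (u v : ℂ) :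
    Polynomial.aeval (u + v) (Polynomial.bernoulli n) / (n.factorial : ℂ)
      = ∑ x ∈ Finset.HasAntidiagonal.antidiagonal n,
        Polynomial.aeval u (Polynomial.bernoulli x.1) / (x.1.factorial : ℂ)
          * (v ^ x.2 / (x.2.factorial : ℂ)) := by
  have h : (PowerSeries.mk fun n => Polynomial.aeval (u + v)
        ((1 / (n.factorial : ℚ)) • Polynomial.bernoulli n))
      = (PowerSeries.mk fun n => Polynomial.aeval u
        ((1 / (n.factorial : ℚ)) • Polynomial.bernoulli n))
        * PowerSeries.rescale v (PowerSeries.exp ℂ) := by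
    have hne : PowerSeries.exp ℂ - 1 ≠ 0 := by
      intro h0
      have := congrArg (PowerSeries.coeff 1) h0
      simp [PowerSeries.coeff_exp, PowerSeries.coeff_one] at this
    refine mul_right_cancel₀ hne ?_
    rw [Polynomial.bernoulli_generating_function, mul_right_comm,
      Polynomial.bernoulli_generating_function, mul_assoc, PowerSeries.exp_mul_exp_eq_exp_add]
  have h2 := congrArg (PowerSeries.coeff n) h
  rw [PowerSeries.coeff_mul] at h2
  simp only [PowerSeries.coeff_mk, PowerSeries.coeff_rescale, PowerSeries.coeff_exp, map_smul] at h2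
  convert h2 using 1
  · rw [Rat.smul_def]
    push_cast
    ring
  · refine Finset.sum_congr rfl fun x _ => ?_
    rw [Rat.smul_def]
    simp only [map_div₀, map_one, map_natCast]
    push_cast
    ring

/-- Scaling by a positive real does not change the branch, so log(-z e^(-x)) = log(-z) - x, and the
translation formula for Bernoulli polynomials applies. -/
theorem bernoulliBeta_mul_exp (n : ℕ) {z : ℂ} (hz : z ≠ 0) (x : ℝ) :
    bernoulliBeta n (z * Complex.exp (-(x : ℂ)))
      = ∑ k ∈ Finset.HasAntidiagonal.antidiagonal n,
        bernoulliBeta k.1 z * ((-(x : ℂ)) ^ k.2 / (k.2.factorial : ℂ)) := by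
  have hp := two_pi_I_ne_zero
  have hlog : Complex.log (-(z * Complex.exp (-(x : ℂ)))) = Complex.log (-z) - x := by
    have e : -(z * Complex.exp (-(x : ℂ))) = ((Real.exp (-x) : ℝ) : ℂ) * -z := by
      push_cast
      ring
    rw [e, Complex.log_ofReal_mul (Real.exp_pos _) (neg_ne_zero.2 hz), Real.log_exp]
    push_cast
    ring
  have h := aeval_bernoulli_add n (1 / 2 + Complex.log (-z) / (2 * (Real.pi : ℂ) * Complex.I))
    (-(x : ℂ) / (2 * (Real.pi : ℂ) * Complex.I))
  have e : 1 / 2 + Complex.log (-(z * Complex.exp (-(x : ℂ)))) / (2 * (Real.pi : ℂ) * Complex.I)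
      = 1 / 2 + Complex.log (-z) / (2 * (Real.pi : ℂ) * Complex.I)
        + -(x : ℂ) / (2 * (Real.pi : ℂ) * Complex.I) := by
    rw [hlog]
    ring
  rw [bernoulliBeta, e, div_mul_eq_mul_div, mul_div_assoc, h, Finset.mul_sum]
  refine Finset.sum_congr rfl fun k hk => ?_
  rw [← Finset.HasAntidiagonal.mem_antidiagonal.1 hk, pow_add, bernoulliBeta, div_pow]
  field_simp

theorem sum_antidiagonalTuple_three (n : ℕ) (f : ℕ → ℕ → ℕ → ℂ) :
    ∑ x ∈ Finset.Nat.antidiagonalTuple 3 n, f (x 0) (x 1) (x 2)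
      = ∑ y ∈ Finset.HasAntidiagonal.antidiagonal n, ∑ w ∈ Finset.HasAntidiagonal.antidiagonal y.1, f y.2 w.2 w.1 := by
  rw [Finset.sum_sigma']
  refine Finset.sum_bij' (fun x _ => ⟨(x 2 + x 1, x 0), (x 2, x 1)⟩)
    (fun y _ => ![y.1.2, y.2.2, y.2.1]) ?_ ?_ ?_ ?_ ?_
  · intro x hx
    rw [Finset.Nat.mem_antidiagonalTuple, Fin.sum_univ_three] at hx
    simp only [Finset.mem_sigma, Finset.HasAntidiagonal.mem_antidiagonal, and_true]
    omega
  · rintro ⟨⟨a, b⟩, ⟨c, d⟩⟩ hy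
    simp only [Finset.mem_sigma, Finset.HasAntidiagonal.mem_antidiagonal] at hy
    rw [Finset.Nat.mem_antidiagonalTuple, Fin.sum_univ_three]
    simp
    omega
  · intro x _
    ext i
    fin_cases i <;> rfl
  · rintro ⟨⟨a, b⟩, ⟨c, d⟩⟩ hy
    simp only [Finset.mem_sigma, Finset.HasAntidiagonal.mem_antidiagonal] at hy
    obtain ⟨-, rfl⟩ := hy
    rfl
  · intro x _
    rfl

theorem neg_mul_exp_mem_slitPlane {z : ℂ} (hz : -z ∈ Complex.slitPlane) (x : ℝ) :
    -(z * Complex.exp (-(x : ℂ))) ∈ Complex.slitPlane := by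
  have hp := Real.exp_pos (-x)
  have e : z * Complex.exp (-(x : ℂ)) = z * ((Real.exp (-x) : ℝ) : ℂ) := by push_cast; rfl
  rw [e, Complex.mem_slitPlane_iff] at *
  simp only [Complex.neg_re, Complex.neg_im, Complex.re_mul_ofReal, Complex.im_mul_ofReal] at *
  rcases hz with h | h
  · left
    nlinarith
  · right
    exact neg_ne_zero.2 (mul_ne_zero (neg_ne_zero.1 h) hp.ne')

theorem bernoulliBeta_mul_exp_add (n : ℕ) {z : ℂ} (hz : z ≠ 0) (x y : ℝ) :
    bernoulliBeta n (z * Complex.exp (-((x + y : ℝ) : ℂ)))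
      = ∑ k ∈ Finset.Nat.antidiagonalTuple 3 n, bernoulliBeta (k 2) z *
        (((-(x : ℂ)) ^ k 0 / ((k 0).factorial : ℂ)) *
          ((-(y : ℂ)) ^ k 1 / ((k 1).factorial : ℂ))) := by
  rw [sum_antidiagonalTuple_three n fun a b c => bernoulliBeta c z *
        (((-(x : ℂ)) ^ a / (a.factorial : ℂ)) * ((-(y : ℂ)) ^ b / (b.factorial : ℂ)))]
  have e : z * Complex.exp (-((x + y : ℝ) : ℂ))
      = z * Complex.exp (-(y : ℂ)) * Complex.exp (-(x : ℂ)) := by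
    rw [mul_assoc, ← Complex.exp_add]
    push_cast
    ring_nf
  rw [e, bernoulliBeta_mul_exp n (mul_ne_zero hz (Complex.exp_ne_zero _))]
  refine Finset.sum_congr rfl fun k _ => ?_
  rw [bernoulliBeta_mul_exp _ hz, Finset.sum_mul]
  exact Finset.sum_congr rfl fun w _ => by ring

theorem ringChoose_neg_natCast {n : ℕ} (hn : 1 ≤ n) (m : ℕ) :
    ((Ring.choose (-(n : ℤ)) m : ℤ) : ℂ) = (-1) ^ m * ((n + m - 1).choose m : ℂ) := by
  have e : (n : ℤ) + m - 1 = ((n + m - 1 : ℕ) : ℤ) := by omega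
  rw [Ring.choose_neg, e, Ring.choose_natCast, Int.negOnePow_def, Units.smul_def]
  simp

/-- The source of the binomials in the formula: a power of x produced by translating β raises the
index of a kernel from n to n + m. -/
theorem neg_pow_div_mul_halfKernel (σ : ℝ) {n : ℕ} (hn : 1 ≤ n) (m : ℕ) (x : ℝ) :
    (-(x : ℂ)) ^ m / (m.factorial : ℂ) * halfKernel σ n x
      = ((Ring.choose (-(n : ℤ)) m : ℤ) : ℂ) * halfKernel σ (n + m) x := by
  rw [ringChoose_neg_natCast hn]
  by_cases h : 0 < σ * x
  · rw [halfKernel_of_pos h, halfKernel_of_pos h]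
    have e : n + m - 1 = (n - 1) + m := by omega
    rw [e, Nat.add_choose, Nat.cast_div, neg_pow (x : ℂ)]
    · have h1 : ((n - 1).factorial : ℂ) ≠ 0 := by exact_mod_cast Nat.factorial_ne_zero _
      have h2 : (m.factorial : ℂ) ≠ 0 := by exact_mod_cast Nat.factorial_ne_zero _
      have h3 : ((n - 1 + m).factorial : ℂ) ≠ 0 := by exact_mod_cast Nat.factorial_ne_zero _
      push_cast
      field_simp
      ring
    · exact Nat.factorial_mul_factorial_dvd_factorial_add _ _
    · push_cast
      exact mul_ne_zero (by exact_mod_cast Nat.factorial_ne_zero _)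
        (by exact_mod_cast Nat.factorial_ne_zero _)
  · rw [halfKernel_of_not_pos h, halfKernel_of_not_pos h]
    ring

/-! ### The functions `β` as integrals -/

theorem integrable_halfKernel_one_mul_expSum (n : ℕ) {z : ℂ} (hz : -z ∈ Complex.slitPlane) :
    Integrable fun x => halfKernel 1 n x * expSum z x :=
  integrable_halfKernel_mul (Or.inl rfl) n
    ((expBounded_expSum hz (θ := 1 / 2) (by norm_num) (by norm_num)).congr fun x => by ring)

theorem integrable_halfKernel_neg_one_mul_expSumFull (n : ℕ) {z : ℂ}
    (hz : -z ∈ Complex.slitPlane) :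
    Integrable fun x => halfKernel (-1) n x * expSumFull z x :=
  integrable_halfKernel_mul (Or.inr rfl) n
    ((expBounded_expSumFull hz (θ := 1 / 2) (by norm_num) (by norm_num)).congr fun x => by ring)

/-- The integrand of `-β_n(z)`, translated by `y`. -/
def betaIntegrand (n : ℕ) (z : ℂ) (y x : ℝ) : ℂ :=
  halfKernel 1 n x * expSum z (y + x) + halfKernel (-1) n x * expSumFull z (y + x)

theorem mul_exp_neg_add (z : ℂ) (y x : ℝ) : z * Complex.exp (-((y + x : ℝ) : ℂ))
    = z * Complex.exp (-(y : ℂ)) * Complex.exp (-(x : ℂ)) := by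
  rw [mul_assoc, ← Complex.exp_add]
  push_cast
  ring_nf

theorem integral_betaIntegrand {n : ℕ} (hn : 1 ≤ n) {z : ℂ} (hz : -z ∈ Complex.slitPlane)
    (y : ℝ) : ∫ x, betaIntegrand n z y x = -bernoulliBeta n (z * Complex.exp (-(y : ℂ))) := by
  have hz' := neg_mul_exp_mem_slitPlane hz y
  have e : ∀ x, betaIntegrand n z y x
      = halfKernel 1 n x * expSum (z * Complex.exp (-(y : ℂ))) x
        + halfKernel (-1) n x * expSumFull (z * Complex.exp (-(y : ℂ))) x := by
    intro x
    simp only [betaIntegrand, expSum, expSumFull, mul_exp_neg_add]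
  simp only [e]
  rw [integral_add (integrable_halfKernel_one_mul_expSum n hz')
    (integrable_halfKernel_neg_one_mul_expSumFull n hz'), ← mpl_one hn (one_sub_mem_slitPlane hz'),
    ← neg_one_pow_mul_mpl_inv_one hn hz', parity_one hn hz']

/-- By Fubini, the inner integral is -β_n(z e^(-x)). Expanding it in powers of x, each power is
absorbed into the kernel of index m. -/
theorem sum_bernoulliBeta_mul_integral {σ : ℝ} (hσ : σ = 1 ∨ σ = -1) {m : ℕ} (hm : 1 ≤ m)
    {n : ℕ} (hn : 1 ≤ n) {z : ℂ} (hz : -z ∈ Complex.slitPlane) {F : ℝ → ℂ}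
    (hF : ExpBounded F fun x => -(σ * x / 2))
    (hint : Integrable fun p : ℝ × ℝ => halfKernel σ m p.1 * F p.1 * betaIntegrand n z p.1 p.2) :
    ∑ k ∈ Finset.HasAntidiagonal.antidiagonal n, bernoulliBeta k.1 z * ((Ring.choose (-(m : ℤ)) k.2 : ℤ) : ℂ)
        * ∫ x, halfKernel σ (m + k.2) x * F x
      = -∫ p : ℝ × ℝ, halfKernel σ m p.1 * F p.1 * betaIntegrand n z p.1 p.2 := by
  simp only [← integral_const_mul]
  rw [← integral_finsetSum _ fun k _ => (integrable_halfKernel_mul hσ _ hF).const_mul _,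
    ← integral_neg, Measure.volume_eq_prod, integral_neg, integral_prod _ hint, ← integral_neg]
  congr 1
  ext x
  dsimp only
  rw [integral_const_mul, integral_betaIntegrand hn hz,
    bernoulliBeta_mul_exp n (ne_zero_of_neg_mem_slitPlane hz), mul_neg, neg_neg, Finset.mul_sum]
  refine Finset.sum_congr rfl fun k _ => ?_
  linear_combination (-bernoulliBeta k.1 z * F x) * neg_pow_div_mul_halfKernel σ hm k.2 x

theorem sum_bernoulliBeta_mul_integral₂ {σ τ : ℝ} (hσ : σ = 1 ∨ σ = -1) (hτ : τ = 1 ∨ τ = -1)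
    {l m : ℕ} (hl : 1 ≤ l) (hm : 1 ≤ m) {n : ℕ} (hn : 1 ≤ n) {z : ℂ}
    (hz : -z ∈ Complex.slitPlane) {F : ℝ × ℝ → ℂ}
    (hF : ExpBounded F fun x => -(σ * x.1 / 2) + -(τ * x.2 / 2))
    (hint : Integrable fun p : (ℝ × ℝ) × ℝ => halfKernel σ l p.1.1 * halfKernel τ m p.1.2 * F p.1
      * betaIntegrand n z (p.1.1 + p.1.2) p.2) :
    ∑ k ∈ Finset.Nat.antidiagonalTuple 3 n, bernoulliBeta (k 2) z
        * ((Ring.choose (-(l : ℤ)) (k 0) : ℤ) : ℂ) * ((Ring.choose (-(m : ℤ)) (k 1) : ℤ) : ℂ)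
        * ∫ x : ℝ × ℝ, halfKernel σ (l + k 0) x.1 * halfKernel τ (m + k 1) x.2 * F x
      = -∫ p : (ℝ × ℝ) × ℝ, halfKernel σ l p.1.1 * halfKernel τ m p.1.2 * F p.1
        * betaIntegrand n z (p.1.1 + p.1.2) p.2 := by
  simp only [← integral_const_mul]
  rw [← integral_finsetSum _ fun k _ => (integrable_halfKernel_mul₂ hσ hτ _ _ hF).const_mul _,
    Measure.volume_eq_prod (ℝ × ℝ) ℝ, integral_prod _ hint, ← integral_neg]
  congr 1
  ext x
  dsimp only
  rw [integral_const_mul, integral_betaIntegrand hn hz,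
    bernoulliBeta_mul_exp_add n (ne_zero_of_neg_mem_slitPlane hz), mul_neg, neg_neg,
    Finset.mul_sum]
  refine Finset.sum_congr rfl fun k _ => ?_
  have h1 := neg_pow_div_mul_halfKernel σ hl (k 0) x.1
  have h2 := neg_pow_div_mul_halfKernel τ hm (k 1) x.2
  calc _ = bernoulliBeta (k 2) z * (((Ring.choose (-(l : ℤ)) (k 0) : ℤ) : ℂ)
          * halfKernel σ (l + k 0) x.1) * (((Ring.choose (-(m : ℤ)) (k 1) : ℤ) : ℂ)
          * halfKernel τ (m + k 1) x.2) * F x := by ring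
    _ = _ := by rw [← h1, ← h2]; ring

/-! ### Convolution of the kernels -/

/-- Euler's Beta integral at integer arguments; it makes the kernels a convolution semigroup. -/
theorem integral_sub_pow_mul_pow (a b : ℕ) {u : ℝ} (hu : 0 < u) :
    ∫ y in (0 : ℝ)..u, ((u - y : ℝ) : ℂ) ^ a / (a.factorial : ℂ) * ((y : ℂ) ^ b / (b.factorial : ℂ))
      = (u : ℂ) ^ (a + b + 1) / ((a + b + 1).factorial : ℂ) := by
  have h := Complex.betaIntegral_scaled ((b : ℂ) + 1) ((a : ℂ) + 1) hu
  have hG := Complex.Gamma_mul_Gamma_eq_betaIntegral (s := (b : ℂ) + 1) (t := (a : ℂ) + 1)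
    (by simp; positivity) (by simp; positivity)
  have e : (b : ℂ) + 1 + ((a : ℂ) + 1) = ((a + b + 1 : ℕ) : ℂ) + 1 := by push_cast; ring
  rw [e, Complex.Gamma_nat_eq_factorial, Complex.Gamma_nat_eq_factorial,
    Complex.Gamma_nat_eq_factorial] at hG
  rw [e] at h
  simp only [add_sub_cancel_right, Complex.cpow_natCast] at h
  have ha : (a.factorial : ℂ) ≠ 0 := by exact_mod_cast Nat.factorial_ne_zero _
  have hb : (b.factorial : ℂ) ≠ 0 := by exact_mod_cast Nat.factorial_ne_zero _
  have hab : ((a + b + 1).factorial : ℂ) ≠ 0 := by exact_mod_cast Nat.factorial_ne_zero _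
  calc _ = (∫ y in (0 : ℝ)..u, (y : ℂ) ^ b * ((u : ℂ) - y) ^ a)
        * (1 / ((a.factorial : ℂ) * b.factorial)) := by
        rw [← intervalIntegral.integral_mul_const]
        congr 1
        ext y
        push_cast
        field_simp
    _ = _ := by
        rw [h]
        field_simp
        linear_combination (-(u : ℂ) ^ (a + b + 1)) * hG

theorem integral_halfKernel_sub_mul {m n : ℕ} (hm : 1 ≤ m) (hn : 1 ≤ n) (u : ℝ) :
    ∫ y, halfKernel 1 m (u - y) * halfKernel 1 n y = halfKernel 1 (m + n) u := by
  by_cases hu : 0 < u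
  · have e : ∀ y, halfKernel 1 m (u - y) * halfKernel 1 n y = (Ioo 0 u).indicator
        (fun y : ℝ => ((u - y : ℝ) : ℂ) ^ (m - 1) / ((m - 1).factorial : ℂ)
          * ((y : ℂ) ^ (n - 1) / ((n - 1).factorial : ℂ))) y := by
      intro y
      by_cases h1 : 0 < y
      · by_cases h2 : y < u
        · rw [indicator_of_mem (show y ∈ Ioo 0 u from ⟨h1, h2⟩), halfKernel_of_pos (by linarith),
            halfKernel_of_pos (by linarith)]
        · rw [indicator_of_notMem (fun h => h2 h.2), halfKernel_of_not_pos (by linarith), zero_mul]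
      · rw [indicator_of_notMem (fun h => h1 h.1), halfKernel_of_not_pos (n := n) (by linarith),
          mul_zero]
    simp only [e]
    rw [integral_indicator measurableSet_Ioo, ← integral_Ioc_eq_integral_Ioo,
      ← intervalIntegral.integral_of_le hu.le, integral_sub_pow_mul_pow _ _ hu,
      halfKernel_of_pos (by linarith)]
    have : m - 1 + (n - 1) + 1 = m + n - 1 := by omega
    rw [this]
  · have e : ∀ y, halfKernel 1 m (u - y) * halfKernel 1 n y = 0 := by
      intro y
      by_cases h1 : 0 < y
      · rw [halfKernel_of_not_pos (by linarith), zero_mul]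
      · rw [halfKernel_of_not_pos (n := n) (by linarith), mul_zero]
    simp only [e, integral_zero]
    rw [halfKernel_of_not_pos (by linarith)]

/-- The shear (x, y) ↦ (x, x + y) preserves the measure and exposes the convolution of the kernels.
Read from right to left, it lifts a term with merged indices to one more variable. -/
theorem integral_halfKernel_add_eq {m n : ℕ} (hm : 1 ≤ m) (hn : 1 ≤ n) {φ : ℝ → ℂ}
    (hint : Integrable fun p : ℝ × ℝ => halfKernel 1 m p.1 * halfKernel 1 n p.2 * φ (p.1 + p.2)) :
    ∫ p : ℝ × ℝ, halfKernel 1 m p.1 * halfKernel 1 n p.2 * φ (p.1 + p.2)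
      = ∫ u, halfKernel 1 (m + n) u * φ u := by
  have hmp := measurePreserving_prod_sub (G := ℝ) volume volume
  have hemb := (MeasurableEquiv.shearSubRight ℝ).measurableEmbedding
  have hint' : Integrable (fun p : ℝ × ℝ => halfKernel 1 m p.1 * halfKernel 1 n (p.2 - p.1) *
      φ (p.1 + (p.2 - p.1))) (volume.prod volume) := (hmp.integrable_comp_emb hemb).2 hint
  have h := hmp.integral_comp hemb
    fun p : ℝ × ℝ => halfKernel 1 m p.1 * halfKernel 1 n p.2 * φ (p.1 + p.2)
  rw [Measure.volume_eq_prod, ← h, integral_prod_symm _ hint']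
  congr 1
  ext u
  simp only [add_sub_cancel]
  rw [integral_mul_const]
  simp only [mul_comm (halfKernel 1 m _)]
  rw [integral_halfKernel_sub_mul hn hm, add_comm]

theorem integral_halfKernel_add_eq_prod {m n l : ℕ} (hm : 1 ≤ m) (hn : 1 ≤ n) {φ : ℝ × ℝ → ℂ}
    (hφ : ExpBounded φ fun p => -(1 * p.1 / 2) + -(1 * p.2 / 2))
    (hint : Integrable fun p : (ℝ × ℝ) × ℝ => halfKernel 1 m p.1.1 * halfKernel 1 n p.1.2 *
      (halfKernel 1 l p.2 * φ (p.1.1 + p.1.2, p.2))) :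
    ∫ p : (ℝ × ℝ) × ℝ, halfKernel 1 m p.1.1 * halfKernel 1 n p.1.2 *
      (halfKernel 1 l p.2 * φ (p.1.1 + p.1.2, p.2))
      = ∫ p : ℝ × ℝ, halfKernel 1 (m + n) p.1 * halfKernel 1 l p.2 * φ p := by
  have hint' := integrable_halfKernel_mul₂ (Or.inl rfl) (Or.inl rfl) (m + n) l hφ
  rw [Measure.volume_eq_prod] at hint hint'
  rw [Measure.volume_eq_prod (ℝ × ℝ) ℝ, integral_prod_symm _ hint, Measure.volume_eq_prod ℝ ℝ,
    integral_prod_symm _ hint']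
  refine integral_congr_ae ?_
  -- Fubini gives integrability of the slice only for almost every `y`, which suffices here.
  filter_upwards [hint.prod_left_ae] with y hy
  have := integral_halfKernel_add_eq hm hn (φ := fun u => halfKernel 1 l y * φ (u, y)) hy
  rw [Measure.volume_eq_prod] at this
  rw [this]
  simp only [mul_assoc]

/-! ### The parity theorem in depth two -/

theorem integrable_fun_sub {α : Type*} [MeasurableSpace α] {μ : Measure α} {f g : α → ℂ}
    (hf : Integrable f μ) (hg : Integrable g μ) : Integrable (fun x => f x - g x) μ := hf.sub hg

theorem ExpBounded.expSum {α : Type*} [TopologicalSpace α] {z : ℂ} (hz : -z ∈ Complex.slitPlane)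
    {L : α → ℝ} (θ : ℝ) (hL : Continuous L := by fun_prop) (h0 : 0 ≤ θ := by norm_num)
    (h1 : θ ≤ 1 := by norm_num) :
    ExpBounded (fun x => expSum z (L x)) (fun x => -(θ * L x)) :=
  (expBounded_expSum hz h0 h1).comp hL

theorem ExpBounded.expSumFull {α : Type*} [TopologicalSpace α] {z : ℂ}
    (hz : -z ∈ Complex.slitPlane) {L : α → ℝ} (θ : ℝ) (hL : Continuous L := by fun_prop)
    (h0 : 0 ≤ θ := by norm_num) (h1 : θ ≤ 1 := by norm_num) :
    ExpBounded (fun x => expSumFull z (L x)) (fun x => θ * L x) :=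
  (expBounded_expSumFull hz h0 h1).comp hL

/-- As power series, this splits the sum of a^k b^l over k, l ≥ 1 into k = l, k > l and k < l. As a
rational identity it holds for all real x and y. -/
theorem expSum_mul_expSum {z w : ℂ} (hz : -z ∈ Complex.slitPlane) (hw : -w ∈ Complex.slitPlane)
    (hzw : -(z * w) ∈ Complex.slitPlane) (x y : ℝ) :
    expSum z x * expSum w y = expSum (z * w) (x + y) * (1 + expSum z x + expSum w y) := by
  have h1 := one_sub_mul_exp_ne_zero hz x
  have h2 := one_sub_mul_exp_ne_zero hw y
  have h3 := one_sub_mul_exp_ne_zero hzw (x + y)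
  have e : z * w * Complex.exp (-((x + y : ℝ) : ℂ))
      = (z * Complex.exp (-(x : ℂ))) * (w * Complex.exp (-(y : ℂ))) := by
    push_cast
    rw [neg_add, Complex.exp_add]
    ring
  simp only [_root_.expSum, geomSum]
  rw [e] at h3 ⊢
  generalize z * Complex.exp (-(x : ℂ)) = a at *
  generalize w * Complex.exp (-(y : ℂ)) = b at *
  field_simp
  ring

/-- As power series, this splits the sum of a^k b^l over k ≥ 1, l ≥ 0 into k > l and k ≤ l. -/
theorem expSum_mul_expSumFull {z w : ℂ} (hz : -z ∈ Complex.slitPlane)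
    (hw : -w ∈ Complex.slitPlane) (hzw : -(z * w) ∈ Complex.slitPlane) (x y : ℝ) :
    expSum z x * expSumFull w y
      = expSum z x * expSumFull (z * w) (x + y) + expSumFull w y * expSum (z * w) (x + y) := by
  have h1 := one_sub_mul_exp_ne_zero hz x
  have h2 := one_sub_mul_exp_ne_zero hw y
  have h3 := one_sub_mul_exp_ne_zero hzw (x + y)
  have e : z * w * Complex.exp (-((x + y : ℝ) : ℂ))
      = (z * Complex.exp (-(x : ℂ))) * (w * Complex.exp (-(y : ℂ))) := by
    push_cast
    rw [neg_add, Complex.exp_add]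
    ring
  simp only [_root_.expSum, _root_.expSumFull, geomSum, geomSumFull]
  rw [e] at h3 ⊢
  generalize z * Complex.exp (-(x : ℂ)) = a at *
  generalize w * Complex.exp (-(y : ℂ)) = b at *
  field_simp
  ring

theorem integral_betaIntegrand_zero {n : ℕ} (hn : 1 ≤ n) {z : ℂ} (hz : -z ∈ Complex.slitPlane) :
    ∫ x, betaIntegrand n z 0 x = -bernoulliBeta n z := by
  simpa using integral_betaIntegrand hn hz 0

/-- The product formula in depth one. -/
theorem mpl_one_mul_mpl_one {n₁ n₂ : ℕ} (h₁ : 1 ≤ n₁) (h₂ : 1 ≤ n₂) {z₁ z₂ : ℂ}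
    (hz₁ : -z₁ ∈ Complex.slitPlane) (hz₂ : -z₂ ∈ Complex.slitPlane)
    (hz₁₂ : -(z₁ * z₂) ∈ Complex.slitPlane) :
    mpl ![n₁] ![z₁] * mpl ![n₂] ![z₂]
      = mpl ![n₁, n₂] ![z₁, z₂] + mpl ![n₂, n₁] ![z₂, z₁] + mpl ![n₁ + n₂] ![z₁ * z₂] := by
  have i1 := integrable_halfKernel_mul₂ (Or.inl rfl) (Or.inl rfl) n₁ n₂
    (f := fun x => expSum (z₁ * z₂) (x.1 + x.2) * expSum z₂ x.2)
    (((ExpBounded.expSum hz₁₂ (1 / 2)).mul (ExpBounded.expSum hz₂ 0)).congr fun x => by ring)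
  have i2 := integrable_halfKernel_mul₂ (Or.inl rfl) (Or.inl rfl) n₂ n₁
    (f := fun x => expSum (z₂ * z₁) (x.1 + x.2) * expSum z₁ x.2)
    (((ExpBounded.expSum (mul_comm z₁ z₂ ▸ hz₁₂) (1 / 2)).mul
      (ExpBounded.expSum hz₁ 0)).congr fun x => by ring)
  have i3 := integrable_halfKernel_mul₂ (Or.inl rfl) (Or.inl rfl) n₁ n₂
    (f := fun x => expSum (z₁ * z₂) (x.1 + x.2))
    ((ExpBounded.expSum hz₁₂ (1 / 2)).congr fun x => by ring)
  have hsw : MeasurePreserving (MeasurableEquiv.prodComm (α := ℝ) (β := ℝ)) :=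
    Measure.measurePreserving_swap
  have i2' : Integrable fun x : ℝ × ℝ => halfKernel 1 n₂ x.2 * halfKernel 1 n₁ x.1 *
      (expSum (z₂ * z₁) (x.2 + x.1) * expSum z₁ x.1) :=
    (hsw.integrable_comp_emb (MeasurableEquiv.measurableEmbedding _)).2 i2
  have e2 : ∫ x : ℝ × ℝ, halfKernel 1 n₂ x.2 * halfKernel 1 n₁ x.1 *
      (expSum (z₂ * z₁) (x.2 + x.1) * expSum z₁ x.1) = _ := hsw.integral_comp' fun x : ℝ × ℝ => halfKernel 1 n₂ x.1 * halfKernel 1 n₁ x.2 *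
      (expSum (z₂ * z₁) (x.1 + x.2) * expSum z₁ x.2)
  rw [mpl_one h₁ (one_sub_mem_slitPlane hz₁), mpl_one h₂ (one_sub_mem_slitPlane hz₂),
    mpl_one (by omega) (one_sub_mem_slitPlane hz₁₂),
    mpl_two h₁ h₂ (one_sub_mem_slitPlane hz₂) (one_sub_mem_slitPlane hz₁₂),
    mpl_two h₂ h₁ (one_sub_mem_slitPlane hz₁) (mul_comm z₁ z₂ ▸ one_sub_mem_slitPlane hz₁₂),
    ← integral_halfKernel_add_eq h₁ h₂ i3, ← e2, ← integral_prod_mul, ← Measure.volume_eq_prod,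
    ← integral_add i1 i2', ← integral_add (i1.fun_add i2') i3]
  congr 1
  ext x
  have := expSum_mul_expSum hz₁ hz₂ hz₁₂ x.1 x.2
  rw [add_comm x.2 x.1, mul_comm z₂ z₁]
  linear_combination halfKernel 1 n₁ x.1 * halfKernel 1 n₂ x.2 * this

/-- The parity theorem in depth two. -/
theorem parity_two {n₁ n₂ : ℕ} (h₁ : 1 ≤ n₁) (h₂ : 1 ≤ n₂) {z₁ z₂ : ℂ}
    (hz₁ : -z₁ ∈ Complex.slitPlane) (hz₂ : -z₂ ∈ Complex.slitPlane)
    (hz₁₂ : -(z₁ * z₂) ∈ Complex.slitPlane) :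
    mpl ![n₁, n₂] ![z₁, z₂] - (-1 : ℂ) ^ (n₁ + n₂) * mpl ![n₁, n₂] ![z₁⁻¹, z₂⁻¹]
      = -(mpl ![n₁] ![z₁] * bernoulliBeta n₂ z₂) - mpl ![n₁ + n₂] ![z₁ * z₂]
        + ∑ k ∈ Finset.HasAntidiagonal.antidiagonal n₂, bernoulliBeta k.1 (z₁ * z₂)
            * ((Ring.choose (-(n₁ : ℤ)) k.2 : ℤ) : ℂ) * mpl ![n₁ + k.2] ![z₁]
        + ∑ k ∈ Finset.HasAntidiagonal.antidiagonal n₁, bernoulliBeta k.1 (z₁ * z₂)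
            * ((Ring.choose (-(n₂ : ℤ)) k.2 : ℤ) : ℂ)
            * ((-1 : ℂ) ^ (n₂ + k.2) * mpl ![n₂ + k.2] ![z₂⁻¹]) := by
  have l : (1 : ℝ) = 1 ∨ (1 : ℝ) = -1 := Or.inl rfl
  have r : (-1 : ℝ) = 1 ∨ (-1 : ℝ) = -1 := Or.inr rfl
  have i1 := integrable_halfKernel_mul₂ l l n₁ n₂
    (f := fun x => expSum (z₁ * z₂) (x.1 + x.2) * expSum z₂ x.2)
    (((ExpBounded.expSum hz₁₂ (1 / 2)).mul (ExpBounded.expSum hz₂ 0)).congr fun x => by ring)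
  have i2 := integrable_halfKernel_mul₂ r r n₁ n₂
    (f := fun x => expSumFull (z₁ * z₂) (x.1 + x.2) * expSumFull z₂ x.2)
    (((ExpBounded.expSumFull hz₁₂ (1 / 2)).mul
      (ExpBounded.expSumFull hz₂ 0)).congr fun x => by ring)
  have i3 := integrable_halfKernel_mul₂ l l n₁ n₂
    (f := fun x => expSum (z₁ * z₂) (x.1 + x.2))
    ((ExpBounded.expSum hz₁₂ (1 / 2)).congr fun x => by ring)
  have iA : Integrable fun x : ℝ × ℝ => halfKernel 1 n₁ x.1 * expSum z₁ x.1 *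
      betaIntegrand n₂ z₂ 0 x.2 := by
    refine ((integrable_halfKernel_mul₂ l l n₁ n₂ (f := fun x => expSum z₁ x.1 *
        expSum z₂ (0 + x.2)) (((ExpBounded.expSum hz₁ (1 / 2)).mul
        (ExpBounded.expSum hz₂ (1 / 2))).congr fun x => by ring)).add
      (integrable_halfKernel_mul₂ l r n₁ n₂ (f := fun x => expSum z₁ x.1 *
        expSumFull z₂ (0 + x.2)) (((ExpBounded.expSum hz₁ (1 / 2)).mul
        (ExpBounded.expSumFull hz₂ (1 / 2))).congr fun x => by ring))).congr
      (Eventually.of_forall fun x => ?_)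
    simp only [Pi.add_apply, betaIntegrand]
    ring
  have iC : Integrable fun x : ℝ × ℝ => halfKernel 1 n₁ x.1 * expSum z₁ x.1 *
      betaIntegrand n₂ (z₁ * z₂) x.1 x.2 := by
    refine ((integrable_halfKernel_mul₂ l l n₁ n₂ (f := fun x => expSum z₁ x.1 *
        expSum (z₁ * z₂) (x.1 + x.2)) (((ExpBounded.expSum hz₁ 0).mul
        (ExpBounded.expSum hz₁₂ (1 / 2))).congr fun x => by ring)).add
      (integrable_halfKernel_mul₂ l r n₁ n₂ (f := fun x => expSum z₁ x.1 *
        expSumFull (z₁ * z₂) (x.1 + x.2)) (((ExpBounded.expSum hz₁ 1).mul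
        (ExpBounded.expSumFull hz₁₂ (1 / 2))).congr fun x => by ring))).congr
      (Eventually.of_forall fun x => ?_)
    simp only [Pi.add_apply, betaIntegrand]
    ring
  have iD : Integrable fun x : ℝ × ℝ => halfKernel (-1) n₂ x.1 * expSumFull z₂ x.1 *
      betaIntegrand n₁ (z₁ * z₂) x.1 x.2 := by
    refine ((integrable_halfKernel_mul₂ r l n₂ n₁ (f := fun x => expSumFull z₂ x.1 *
        expSum (z₁ * z₂) (x.1 + x.2)) (((ExpBounded.expSumFull hz₂ 1).mul
        (ExpBounded.expSum hz₁₂ (1 / 2))).congr fun x => by ring)).add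
      (integrable_halfKernel_mul₂ r r n₂ n₁ (f := fun x => expSumFull z₂ x.1 *
        expSumFull (z₁ * z₂) (x.1 + x.2)) (((ExpBounded.expSumFull hz₂ 0).mul
        (ExpBounded.expSumFull hz₁₂ (1 / 2))).congr fun x => by ring))).congr
      (Eventually.of_forall fun x => ?_)
    simp only [Pi.add_apply, betaIntegrand]
    ring
  have hsw : MeasurePreserving (MeasurableEquiv.prodComm (α := ℝ) (β := ℝ)) :=
    Measure.measurePreserving_swap
  have iD' : Integrable fun x : ℝ × ℝ => halfKernel (-1) n₂ x.2 * expSumFull z₂ x.2 *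
      betaIntegrand n₁ (z₁ * z₂) x.2 x.1 :=
    (hsw.integrable_comp_emb (MeasurableEquiv.measurableEmbedding _)).2 iD
  have eD : ∫ x : ℝ × ℝ, halfKernel (-1) n₂ x.2 * expSumFull z₂ x.2 *
      betaIntegrand n₁ (z₁ * z₂) x.2 x.1 = _ := hsw.integral_comp' fun x : ℝ × ℝ => halfKernel (-1) n₂ x.1 * expSumFull z₂ x.1 *
      betaIntegrand n₁ (z₁ * z₂) x.1 x.2
  have hA : -(mpl ![n₁] ![z₁] * bernoulliBeta n₂ z₂) = ∫ x : ℝ × ℝ, halfKernel 1 n₁ x.1 *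
      expSum z₁ x.1 * betaIntegrand n₂ z₂ 0 x.2 := by
    rw [Measure.volume_eq_prod, integral_prod_mul (fun x => halfKernel 1 n₁ x * expSum z₁ x)
      (fun x => betaIntegrand n₂ z₂ 0 x), integral_betaIntegrand_zero h₂ hz₂,
      mpl_one h₁ (one_sub_mem_slitPlane hz₁)]
    ring
  have hC := sum_bernoulliBeta_mul_integral l h₁ h₂ hz₁₂
    ((expBounded_expSum hz₁ (θ := 1 / 2) (by norm_num) (by norm_num)).congr fun x => by ring) iC
  have hD := sum_bernoulliBeta_mul_integral r h₂ h₁ hz₁₂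
    ((expBounded_expSumFull hz₂ (θ := 1 / 2) (by norm_num) (by norm_num)).congr
      fun x => by ring) iD
  rw [hA, mpl_two h₁ h₂ (one_sub_mem_slitPlane hz₂) (one_sub_mem_slitPlane hz₁₂),
    neg_one_pow_mul_mpl_inv_two h₁ h₂ hz₂ hz₁₂, mpl_one (by omega) (one_sub_mem_slitPlane hz₁₂),
    ← integral_halfKernel_add_eq h₁ h₂ i3]
  simp only [fun k : ℕ => mpl_one (n := n₁ + k) (by omega) (one_sub_mem_slitPlane hz₁),
    fun k : ℕ => neg_one_pow_mul_mpl_inv_one (n := n₂ + k) (by omega) hz₂]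
  rw [hC, hD, ← eD, ← sub_eq_add_neg, ← sub_eq_add_neg, ← integral_sub i1 i2,
    ← integral_sub iA i3, ← integral_sub (integrable_fun_sub iA i3) iC,
    ← integral_sub (integrable_fun_sub (integrable_fun_sub iA i3) iC) iD']
  congr 1
  ext x
  have e1 := expSum_mul_expSum hz₁ hz₂ hz₁₂ x.1 x.2
  have e2 := expSum_mul_expSumFull hz₁ hz₂ hz₁₂ x.1 x.2
  simp only [betaIntegrand, zero_add, add_comm x.2 x.1]
  -- The sector (+,+) needs the first identity and (+,-) the second; on (-,-) the integrands already
  -- agree.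
  linear_combination (-halfKernel 1 n₁ x.1 * halfKernel 1 n₂ x.2) * e1 -
    halfKernel 1 n₁ x.1 * halfKernel (-1) n₂ x.2 * e2

/-! ### The parity theorem in depth three -/

/-- This and the next three permutations isolate one variable in last place: the one that carries a
β integrand, or the one left out of a convolution of kernels. -/
theorem integral_reorder_snd_fst_thd {f : ℝ × ℝ × ℝ → ℂ} (hf : Integrable f) :
    Integrable (fun p : (ℝ × ℝ) × ℝ => f (p.1.2, p.1.1, p.2)) ∧
      ∫ p : (ℝ × ℝ) × ℝ, f (p.1.2, p.1.1, p.2) = ∫ x, f x := by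
  have h : MeasurePreserving ((MeasurableEquiv.prodCongr (MeasurableEquiv.prodComm (α := ℝ)
      (β := ℝ)) (MeasurableEquiv.refl ℝ)).trans MeasurableEquiv.prodAssoc) :=
    ((Measure.measurePreserving_swap (μ := (volume : Measure ℝ)) (ν := (volume : Measure ℝ))).prod
      (MeasurePreserving.id (volume : Measure ℝ))).trans volume_preserving_prodAssoc
  exact ⟨(h.integrable_comp_emb (MeasurableEquiv.measurableEmbedding _)).2 hf, h.integral_comp' f⟩

theorem integral_reorder_fst_snd_thd {f : ℝ × ℝ × ℝ → ℂ} (hf : Integrable f) :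
    Integrable (fun p : (ℝ × ℝ) × ℝ => f (p.1.1, p.1.2, p.2)) ∧
      ∫ p : (ℝ × ℝ) × ℝ, f (p.1.1, p.1.2, p.2) = ∫ x, f x := by
  have h : MeasurePreserving (MeasurableEquiv.prodAssoc (α := ℝ) (β := ℝ) (γ := ℝ)) :=
    volume_preserving_prodAssoc
  exact ⟨(h.integrable_comp_emb (MeasurableEquiv.measurableEmbedding _)).2 hf, h.integral_comp' f⟩

theorem integral_reorder_snd_thd_fst {f : ℝ × ℝ × ℝ → ℂ} (hf : Integrable f) :
    Integrable (fun p : (ℝ × ℝ) × ℝ => f (p.2, p.1.1, p.1.2)) ∧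
      ∫ p : (ℝ × ℝ) × ℝ, f (p.2, p.1.1, p.1.2) = ∫ x, f x := by
  have h : MeasurePreserving (MeasurableEquiv.prodComm (α := ℝ × ℝ) (β := ℝ)) :=
    Measure.measurePreserving_swap
  exact ⟨(h.integrable_comp_emb (MeasurableEquiv.measurableEmbedding _)).2 hf, h.integral_comp' f⟩

theorem integral_reorder_thd_fst_snd {f : ℝ × ℝ × ℝ → ℂ} (hf : Integrable f) :
    Integrable (fun p : (ℝ × ℝ) × ℝ => f (p.1.2, p.2, p.1.1)) ∧
      ∫ p : (ℝ × ℝ) × ℝ, f (p.1.2, p.2, p.1.1) = ∫ x, f x := by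
  have h : MeasurePreserving (((MeasurableEquiv.prodAssoc (α := ℝ) (β := ℝ) (γ := ℝ)).trans
      (MeasurableEquiv.prodComm (α := ℝ) (β := ℝ × ℝ))).trans MeasurableEquiv.prodAssoc) :=
    (volume_preserving_prodAssoc.trans Measure.measurePreserving_swap).trans
      volume_preserving_prodAssoc
  exact ⟨(h.integrable_comp_emb (MeasurableEquiv.measurableEmbedding _)).2 hf, h.integral_comp' f⟩

section DepthThree

variable {n₁ n₂ n₃ : ℕ} {z₁ z₂ z₃ : ℂ}

theorem mpl_one_mul_parity_two (h₁ : 1 ≤ n₁) (h₂ : 1 ≤ n₂) (h₃ : 1 ≤ n₃)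
    (hz₁ : -z₁ ∈ Complex.slitPlane) (hz₃ : -z₃ ∈ Complex.slitPlane)
    (hz₂₃ : -(z₂ * z₃) ∈ Complex.slitPlane) :
    (Integrable fun x : ℝ × ℝ × ℝ => (halfKernel 1 n₁ x.1 * expSum z₁ x.1) *
      (halfKernel 1 n₂ x.2.1 * halfKernel 1 n₃ x.2.2 *
        (expSum (z₂ * z₃) (x.2.1 + x.2.2) * expSum z₃ x.2.2)
        - halfKernel (-1) n₂ x.2.1 * halfKernel (-1) n₃ x.2.2 *
        (expSumFull (z₂ * z₃) (x.2.1 + x.2.2) * expSumFull z₃ x.2.2))) ∧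
    mpl ![n₁] ![z₁] * (mpl ![n₂, n₃] ![z₂, z₃]
      - (-1 : ℂ) ^ (n₂ + n₃) * mpl ![n₂, n₃] ![z₂⁻¹, z₃⁻¹])
      = ∫ x : ℝ × ℝ × ℝ, (halfKernel 1 n₁ x.1 * expSum z₁ x.1) *
      (halfKernel 1 n₂ x.2.1 * halfKernel 1 n₃ x.2.2 *
        (expSum (z₂ * z₃) (x.2.1 + x.2.2) * expSum z₃ x.2.2)
        - halfKernel (-1) n₂ x.2.1 * halfKernel (-1) n₃ x.2.2 *
        (expSumFull (z₂ * z₃) (x.2.1 + x.2.2) * expSumFull z₃ x.2.2)) := by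
  have i1 := integrable_halfKernel_mul₂ (Or.inl rfl) (Or.inl rfl) n₂ n₃
    (f := fun x => expSum (z₂ * z₃) (x.1 + x.2) * expSum z₃ x.2)
    (((ExpBounded.expSum hz₂₃ (1 / 2)).mul (ExpBounded.expSum hz₃ 0)).congr fun x => by ring)
  have i2 := integrable_halfKernel_mul₂ (Or.inr rfl) (Or.inr rfl) n₂ n₃
    (f := fun x => expSumFull (z₂ * z₃) (x.1 + x.2) * expSumFull z₃ x.2)
    (((ExpBounded.expSumFull hz₂₃ (1 / 2)).mul
      (ExpBounded.expSumFull hz₃ 0)).congr fun x => by ring)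
  refine ⟨(integrable_halfKernel_one_mul_expSum n₁ hz₁).mul_prod (integrable_fun_sub i1 i2), ?_⟩
  rw [mpl_one h₁ (one_sub_mem_slitPlane hz₁),
    mpl_two h₂ h₃ (one_sub_mem_slitPlane hz₃) (one_sub_mem_slitPlane hz₂₃),
    neg_one_pow_mul_mpl_inv_two h₂ h₃ hz₃ hz₂₃, ← integral_sub i1 i2, ← integral_prod_mul]
  rfl

theorem mpl_merge_first (h₁ : 1 ≤ n₁) (h₂ : 1 ≤ n₂) (h₃ : 1 ≤ n₃)
    (hz₃ : -z₃ ∈ Complex.slitPlane) (hz : -(z₁ * z₂ * z₃) ∈ Complex.slitPlane) :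
    (Integrable fun x : ℝ × ℝ × ℝ => halfKernel 1 n₁ x.1 * halfKernel 1 n₂ x.2.1 *
      (halfKernel 1 n₃ x.2.2 *
        (expSum (z₁ * z₂ * z₃) (x.1 + x.2.1 + x.2.2) * expSum z₃ x.2.2))) ∧
    mpl ![n₁ + n₂, n₃] ![z₁ * z₂, z₃] = ∫ x : ℝ × ℝ × ℝ,
      halfKernel 1 n₁ x.1 * halfKernel 1 n₂ x.2.1 * (halfKernel 1 n₃ x.2.2 *
        (expSum (z₁ * z₂ * z₃) (x.1 + x.2.1 + x.2.2) * expSum z₃ x.2.2)) := by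
  have i := integrable_halfKernel_mul₃ (Or.inl rfl) (Or.inl rfl) (Or.inl rfl) n₁ n₂ n₃
    (f := fun x => expSum (z₁ * z₂ * z₃) (x.1 + x.2.1 + x.2.2) * expSum z₃ x.2.2)
    (((ExpBounded.expSum hz (1 / 2)).mul (ExpBounded.expSum hz₃ 0)).congr fun x => by ring)
  simp only [mul_assoc (_ * halfKernel 1 n₂ _)] at i
  refine ⟨i, ?_⟩
  obtain ⟨i', e⟩ := integral_reorder_fst_snd_thd i
  rw [mpl_two (by omega) h₃ (one_sub_mem_slitPlane hz₃) (one_sub_mem_slitPlane hz), ← e]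
  exact (integral_halfKernel_add_eq_prod h₁ h₂ (φ := fun p => expSum (z₁ * z₂ * z₃) (p.1 + p.2)
    * expSum z₃ p.2) (((ExpBounded.expSum hz (1 / 2)).mul
    (ExpBounded.expSum hz₃ 0)).congr fun x => by ring) i').symm

theorem mpl_merge_last (h₁ : 1 ≤ n₁) (h₂ : 1 ≤ n₂) (h₃ : 1 ≤ n₃)
    (hz₁ : -z₁ ∈ Complex.slitPlane) (hz : -(z₂ * z₃ * z₁) ∈ Complex.slitPlane) :
    (Integrable fun x : ℝ × ℝ × ℝ => halfKernel 1 n₂ x.2.1 * halfKernel 1 n₃ x.2.2 *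
      (halfKernel 1 n₁ x.1 *
        (expSum (z₂ * z₃ * z₁) (x.2.1 + x.2.2 + x.1) * expSum z₁ x.1))) ∧
    mpl ![n₂ + n₃, n₁] ![z₂ * z₃, z₁] = ∫ x : ℝ × ℝ × ℝ,
      halfKernel 1 n₂ x.2.1 * halfKernel 1 n₃ x.2.2 * (halfKernel 1 n₁ x.1 *
        (expSum (z₂ * z₃ * z₁) (x.2.1 + x.2.2 + x.1) * expSum z₁ x.1)) := by
  have i : Integrable fun x : ℝ × ℝ × ℝ => halfKernel 1 n₂ x.2.1 * halfKernel 1 n₃ x.2.2 *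
      (halfKernel 1 n₁ x.1 *
        (expSum (z₂ * z₃ * z₁) (x.2.1 + x.2.2 + x.1) * expSum z₁ x.1)) := by
    refine (integrable_halfKernel_mul₃ (Or.inl rfl) (Or.inl rfl) (Or.inl rfl) n₁ n₂ n₃
      (f := fun x => expSum (z₂ * z₃ * z₁) (x.2.1 + x.2.2 + x.1) * expSum z₁ x.1)
      (((ExpBounded.expSum hz (1 / 2)).mul (ExpBounded.expSum hz₁ 0)).congr
        fun x => by ring)).congr (Eventually.of_forall fun x => ?_)
    ring
  refine ⟨i, ?_⟩
  obtain ⟨i', e⟩ := integral_reorder_snd_thd_fst i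
  rw [mpl_two (by omega) h₁ (one_sub_mem_slitPlane hz₁) (one_sub_mem_slitPlane hz), ← e]
  exact (integral_halfKernel_add_eq_prod h₂ h₃ (φ := fun p => expSum (z₂ * z₃ * z₁) (p.1 + p.2)
    * expSum z₁ p.2) (((ExpBounded.expSum hz (1 / 2)).mul
    (ExpBounded.expSum hz₁ 0)).congr fun x => by ring) i').symm

theorem mpl_two_mul_beta (h₁ : 1 ≤ n₁) (h₂ : 1 ≤ n₂) (h₃ : 1 ≤ n₃)
    (hz₁ : -z₁ ∈ Complex.slitPlane) (hz₃ : -z₃ ∈ Complex.slitPlane)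
    (hz₂₁ : -(z₂ * z₁) ∈ Complex.slitPlane) :
    (Integrable fun x : ℝ × ℝ × ℝ => (halfKernel 1 n₂ x.2.1 * halfKernel 1 n₁ x.1 *
      (expSum (z₂ * z₁) (x.2.1 + x.1) * expSum z₁ x.1)) * betaIntegrand n₃ z₃ 0 x.2.2) ∧
    mpl ![n₂, n₁] ![z₂, z₁] * bernoulliBeta n₃ z₃ = -∫ x : ℝ × ℝ × ℝ,
      (halfKernel 1 n₂ x.2.1 * halfKernel 1 n₁ x.1 *
      (expSum (z₂ * z₁) (x.2.1 + x.1) * expSum z₁ x.1)) * betaIntegrand n₃ z₃ 0 x.2.2 := by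
  have i : Integrable fun x : ℝ × ℝ × ℝ => (halfKernel 1 n₂ x.2.1 * halfKernel 1 n₁ x.1 *
      (expSum (z₂ * z₁) (x.2.1 + x.1) * expSum z₁ x.1)) * betaIntegrand n₃ z₃ 0 x.2.2 := by
    refine ((integrable_halfKernel_mul₃ (Or.inl rfl) (Or.inl rfl) (Or.inl rfl) n₁ n₂ n₃
      (f := fun x => expSum (z₂ * z₁) (x.2.1 + x.1) * expSum z₁ x.1 * expSum z₃ (0 + x.2.2))
      ((((ExpBounded.expSum hz₂₁ (1 / 2)).mul (ExpBounded.expSum hz₁ 0)).mul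
        (ExpBounded.expSum hz₃ (1 / 2))).congr fun x => by ring)).add
      (integrable_halfKernel_mul₃ (Or.inl rfl) (Or.inl rfl) (Or.inr rfl) n₁ n₂ n₃
      (f := fun x => expSum (z₂ * z₁) (x.2.1 + x.1) * expSum z₁ x.1 * expSumFull z₃ (0 + x.2.2))
      ((((ExpBounded.expSum hz₂₁ (1 / 2)).mul (ExpBounded.expSum hz₁ 0)).mul
        (ExpBounded.expSumFull hz₃ (1 / 2))).congr fun x => by ring))).congr
      (Eventually.of_forall fun x => ?_)
    simp only [Pi.add_apply, betaIntegrand]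
    ring
  refine ⟨i, ?_⟩
  rw [← (integral_reorder_snd_fst_thd i).2, Measure.volume_eq_prod (ℝ × ℝ) ℝ,
    integral_prod_mul (fun p : ℝ × ℝ => halfKernel 1 n₂ p.1 * halfKernel 1 n₁ p.2 *
      (expSum (z₂ * z₁) (p.1 + p.2) * expSum z₁ p.2)) (fun x => betaIntegrand n₃ z₃ 0 x),
    integral_betaIntegrand_zero h₃ hz₃,
    ← mpl_two h₂ h₁ (one_sub_mem_slitPlane hz₁) (one_sub_mem_slitPlane hz₂₁)]
  ring

theorem sum_beta_mul_mpl_inv_mul_mpl (h₁ : 1 ≤ n₁) (h₂ : 1 ≤ n₂) (h₃ : 1 ≤ n₃)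
    (hz₁ : -z₁ ∈ Complex.slitPlane) (hz₃ : -z₃ ∈ Complex.slitPlane)
    {z : ℂ} (hz : -z ∈ Complex.slitPlane) :
    (Integrable fun x : ℝ × ℝ × ℝ => halfKernel (-1) n₃ x.2.2 * halfKernel 1 n₁ x.1 *
      (expSumFull z₃ x.2.2 * expSum z₁ x.1) * betaIntegrand n₂ z (x.2.2 + x.1) x.2.1) ∧
    ∑ k ∈ Finset.Nat.antidiagonalTuple 3 n₂, bernoulliBeta (k 2) z
        * ((Ring.choose (-(n₃ : ℤ)) (k 0) : ℤ) : ℂ) * ((Ring.choose (-(n₁ : ℤ)) (k 1) : ℤ) : ℂ)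
        * mpl ![n₃ + k 0] ![z₃⁻¹] * mpl ![n₁ + k 1] ![z₁] * (-1 : ℂ) ^ (n₃ + k 0)
      = -∫ x : ℝ × ℝ × ℝ, halfKernel (-1) n₃ x.2.2 * halfKernel 1 n₁ x.1 *
      (expSumFull z₃ x.2.2 * expSum z₁ x.1) * betaIntegrand n₂ z (x.2.2 + x.1) x.2.1 := by
  have i : Integrable fun x : ℝ × ℝ × ℝ => halfKernel (-1) n₃ x.2.2 * halfKernel 1 n₁ x.1 *
      (expSumFull z₃ x.2.2 * expSum z₁ x.1) * betaIntegrand n₂ z (x.2.2 + x.1) x.2.1 := by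
    -- The β variable covers two sectors, and each needs its own rates. On (+,+,-), rate 1 for z₃
    -- offsets the growth of E(z; ·) as x₃ → -∞; on (+,-,-), rate 1 for z₁ offsets that of F(z; ·)
    -- as x₁ → +∞.
    refine ((integrable_halfKernel_mul₃ (Or.inl rfl) (Or.inl rfl) (Or.inr rfl) n₁ n₂ n₃
      (f := fun x => expSumFull z₃ x.2.2 * expSum z₁ x.1 * expSum z (x.2.2 + x.1 + x.2.1))
      ((((ExpBounded.expSumFull hz₃ 1).mul (ExpBounded.expSum hz₁ 0)).mul
        (ExpBounded.expSum hz (1 / 2))).congr fun x => by ring)).add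
      (integrable_halfKernel_mul₃ (Or.inl rfl) (Or.inr rfl) (Or.inr rfl) n₁ n₂ n₃
      (f := fun x => expSumFull z₃ x.2.2 * expSum z₁ x.1 * expSumFull z (x.2.2 + x.1 + x.2.1))
      ((((ExpBounded.expSumFull hz₃ 0).mul (ExpBounded.expSum hz₁ 1)).mul
        (ExpBounded.expSumFull hz (1 / 2))).congr fun x => by ring))).congr
      (Eventually.of_forall fun x => ?_)
    simp only [Pi.add_apply, betaIntegrand]
    ring
  refine ⟨i, ?_⟩
  obtain ⟨i', e⟩ := integral_reorder_thd_fst_snd i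
  rw [← e, ← sum_bernoulliBeta_mul_integral₂ (Or.inr rfl) (Or.inl rfl) h₃ h₁ h₂ hz
    (F := fun p => expSumFull z₃ p.1 * expSum z₁ p.2)
    (((ExpBounded.expSumFull hz₃ (1 / 2)).mul (ExpBounded.expSum hz₁ (1 / 2))).congr
      fun x => by ring) i']
  refine Finset.sum_congr rfl fun k _ => ?_
  have e2 : ∫ x : ℝ × ℝ, halfKernel (-1) (n₃ + k 0) x.1 * halfKernel 1 (n₁ + k 1) x.2 *
      (expSumFull z₃ x.1 * expSum z₁ x.2)
      = ((-1 : ℂ) ^ (n₃ + k 0) * mpl ![n₃ + k 0] ![z₃⁻¹]) * mpl ![n₁ + k 1] ![z₁] := by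
    rw [neg_one_pow_mul_mpl_inv_one (by omega) hz₃, mpl_one (by omega) (one_sub_mem_slitPlane hz₁),
      ← integral_prod_mul, ← Measure.volume_eq_prod]
    congr 1
    ext x
    ring
  rw [e2]
  ring

theorem sum_beta_mul_mpl_two (h₁ : 1 ≤ n₁) (h₂ : 1 ≤ n₂) (h₃ : 1 ≤ n₃)
    (hz₁ : -z₁ ∈ Complex.slitPlane) (hz₂₁ : -(z₂ * z₁) ∈ Complex.slitPlane)
    {z : ℂ} (hz : -z ∈ Complex.slitPlane) :
    (Integrable fun x : ℝ × ℝ × ℝ => halfKernel 1 n₂ x.2.1 * halfKernel 1 n₁ x.1 *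
      (expSum (z₂ * z₁) (x.2.1 + x.1) * expSum z₁ x.1) *
        betaIntegrand n₃ z (x.2.1 + x.1) x.2.2) ∧
    ∑ k ∈ Finset.Nat.antidiagonalTuple 3 n₃, bernoulliBeta (k 2) z
        * ((Ring.choose (-(n₂ : ℤ)) (k 0) : ℤ) : ℂ) * ((Ring.choose (-(n₁ : ℤ)) (k 1) : ℤ) : ℂ)
        * mpl ![n₂ + k 0, n₁ + k 1] ![z₂, z₁]
      = -∫ x : ℝ × ℝ × ℝ, halfKernel 1 n₂ x.2.1 * halfKernel 1 n₁ x.1 *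
      (expSum (z₂ * z₁) (x.2.1 + x.1) * expSum z₁ x.1) *
        betaIntegrand n₃ z (x.2.1 + x.1) x.2.2 := by
  have i : Integrable fun x : ℝ × ℝ × ℝ => halfKernel 1 n₂ x.2.1 * halfKernel 1 n₁ x.1 *
      (expSum (z₂ * z₁) (x.2.1 + x.1) * expSum z₁ x.1) *
        betaIntegrand n₃ z (x.2.1 + x.1) x.2.2 := by
    refine ((integrable_halfKernel_mul₃ (Or.inl rfl) (Or.inl rfl) (Or.inl rfl) n₁ n₂ n₃
      (f := fun x => expSum (z₂ * z₁) (x.2.1 + x.1) * expSum z₁ x.1 *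
        expSum z (x.2.1 + x.1 + x.2.2))
      ((((ExpBounded.expSum hz₂₁ 0).mul (ExpBounded.expSum hz₁ 0)).mul
        (ExpBounded.expSum hz (1 / 2))).congr fun x => by ring)).add
      (integrable_halfKernel_mul₃ (Or.inl rfl) (Or.inl rfl) (Or.inr rfl) n₁ n₂ n₃
      (f := fun x => expSum (z₂ * z₁) (x.2.1 + x.1) * expSum z₁ x.1 *
        expSumFull z (x.2.1 + x.1 + x.2.2))
      ((((ExpBounded.expSum hz₂₁ 1).mul (ExpBounded.expSum hz₁ 0)).mul
        (ExpBounded.expSumFull hz (1 / 2))).congr fun x => by ring))).congr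
      (Eventually.of_forall fun x => ?_)
    simp only [Pi.add_apply, betaIntegrand]
    ring
  refine ⟨i, ?_⟩
  obtain ⟨i', e⟩ := integral_reorder_snd_fst_thd i
  rw [← e, ← sum_bernoulliBeta_mul_integral₂ (Or.inl rfl) (Or.inl rfl) h₂ h₁ h₃ hz
    (F := fun p => expSum (z₂ * z₁) (p.1 + p.2) * expSum z₁ p.2)
    (((ExpBounded.expSum hz₂₁ (1 / 2)).mul (ExpBounded.expSum hz₁ 0)).congr
      fun x => by ring) i']
  refine Finset.sum_congr rfl fun k _ => ?_
  rw [mpl_two (by omega) (by omega) (one_sub_mem_slitPlane hz₁) (one_sub_mem_slitPlane hz₂₁)]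

theorem sum_beta_mul_mpl_inv_two (h₁ : 1 ≤ n₁) (h₂ : 1 ≤ n₂) (h₃ : 1 ≤ n₃)
    (hz₃ : -z₃ ∈ Complex.slitPlane) (hz₂₃ : -(z₂ * z₃) ∈ Complex.slitPlane)
    {z : ℂ} (hz : -z ∈ Complex.slitPlane) :
    (Integrable fun x : ℝ × ℝ × ℝ => halfKernel (-1) n₂ x.2.1 * halfKernel (-1) n₃ x.2.2 *
      (expSumFull (z₂ * z₃) (x.2.1 + x.2.2) * expSumFull z₃ x.2.2) *
        betaIntegrand n₁ z (x.2.1 + x.2.2) x.1) ∧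
    ∑ k ∈ Finset.Nat.antidiagonalTuple 3 n₁, bernoulliBeta (k 2) z
        * ((Ring.choose (-(n₂ : ℤ)) (k 0) : ℤ) : ℂ) * ((Ring.choose (-(n₃ : ℤ)) (k 1) : ℤ) : ℂ)
        * mpl ![n₂ + k 0, n₃ + k 1] ![z₂⁻¹, z₃⁻¹] * (-1 : ℂ) ^ (n₂ + k 0 + n₃ + k 1)
      = -∫ x : ℝ × ℝ × ℝ, halfKernel (-1) n₂ x.2.1 * halfKernel (-1) n₃ x.2.2 *
      (expSumFull (z₂ * z₃) (x.2.1 + x.2.2) * expSumFull z₃ x.2.2) *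
        betaIntegrand n₁ z (x.2.1 + x.2.2) x.1 := by
  have i : Integrable fun x : ℝ × ℝ × ℝ => halfKernel (-1) n₂ x.2.1 * halfKernel (-1) n₃ x.2.2 *
      (expSumFull (z₂ * z₃) (x.2.1 + x.2.2) * expSumFull z₃ x.2.2) *
        betaIntegrand n₁ z (x.2.1 + x.2.2) x.1 := by
    refine ((integrable_halfKernel_mul₃ (Or.inl rfl) (Or.inr rfl) (Or.inr rfl) n₁ n₂ n₃
      (f := fun x => expSumFull (z₂ * z₃) (x.2.1 + x.2.2) * expSumFull z₃ x.2.2 *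
        expSum z (x.2.1 + x.2.2 + x.1))
      ((((ExpBounded.expSumFull hz₂₃ 1).mul (ExpBounded.expSumFull hz₃ 0)).mul
        (ExpBounded.expSum hz (1 / 2))).congr fun x => by ring)).add
      (integrable_halfKernel_mul₃ (Or.inr rfl) (Or.inr rfl) (Or.inr rfl) n₁ n₂ n₃
      (f := fun x => expSumFull (z₂ * z₃) (x.2.1 + x.2.2) * expSumFull z₃ x.2.2 *
        expSumFull z (x.2.1 + x.2.2 + x.1))
      ((((ExpBounded.expSumFull hz₂₃ 0).mul (ExpBounded.expSumFull hz₃ 0)).mul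
        (ExpBounded.expSumFull hz (1 / 2))).congr fun x => by ring))).congr
      (Eventually.of_forall fun x => ?_)
    simp only [Pi.add_apply, betaIntegrand]
    ring
  refine ⟨i, ?_⟩
  obtain ⟨i', e⟩ := integral_reorder_snd_thd_fst i
  rw [← e, ← sum_bernoulliBeta_mul_integral₂ (Or.inr rfl) (Or.inr rfl) h₂ h₃ h₁ hz
    (F := fun p => expSumFull (z₂ * z₃) (p.1 + p.2) * expSumFull z₃ p.2)
    (((ExpBounded.expSumFull hz₂₃ (1 / 2)).mul (ExpBounded.expSumFull hz₃ 0)).congr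
      fun x => by ring) i']
  refine Finset.sum_congr rfl fun k _ => ?_
  rw [← neg_one_pow_mul_mpl_inv_two (by omega) (by omega) hz₃ hz₂₃]
  ring

/-- The parity theorem in depth three. -/
theorem parity_three (h₁ : 1 ≤ n₁) (h₂ : 1 ≤ n₂) (h₃ : 1 ≤ n₃)
    (hz₁ : -z₁ ∈ Complex.slitPlane) (hz₃ : -z₃ ∈ Complex.slitPlane)
    (hz₁₂ : -(z₁ * z₂) ∈ Complex.slitPlane) (hz₂₃ : -(z₂ * z₃) ∈ Complex.slitPlane)
    (hz : -(z₁ * z₂ * z₃) ∈ Complex.slitPlane) :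
    mpl ![n₁, n₂, n₃] ![z₁, z₂, z₃]
        + (-1 : ℂ) ^ (n₁ + n₂ + n₃) * mpl ![n₁, n₂, n₃] ![z₁⁻¹, z₂⁻¹, z₃⁻¹]
      = mpl ![n₁] ![z₁] * (mpl ![n₂, n₃] ![z₂, z₃]
          - (-1 : ℂ) ^ (n₂ + n₃) * mpl ![n₂, n₃] ![z₂⁻¹, z₃⁻¹])
        - mpl ![n₁ + n₂, n₃] ![z₁ * z₂, z₃]
        + mpl ![n₂, n₁] ![z₂, z₁] * bernoulliBeta n₃ z₃
        + mpl ![n₂ + n₃, n₁] ![z₂ * z₃, z₁]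
        - ∑ k ∈ Finset.Nat.antidiagonalTuple 3 n₂, bernoulliBeta (k 2) (z₁ * z₂ * z₃)
          * ((Ring.choose (-(n₃ : ℤ)) (k 0) : ℤ) : ℂ) * ((Ring.choose (-(n₁ : ℤ)) (k 1) : ℤ) : ℂ)
          * mpl ![n₃ + k 0] ![z₃⁻¹] * mpl ![n₁ + k 1] ![z₁] * (-1 : ℂ) ^ (n₃ + k 0)
        - ∑ k ∈ Finset.Nat.antidiagonalTuple 3 n₃, bernoulliBeta (k 2) (z₁ * z₂ * z₃)
          * ((Ring.choose (-(n₂ : ℤ)) (k 0) : ℤ) : ℂ) * ((Ring.choose (-(n₁ : ℤ)) (k 1) : ℤ) : ℂ)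
          * mpl ![n₂ + k 0, n₁ + k 1] ![z₂, z₁]
        - ∑ k ∈ Finset.Nat.antidiagonalTuple 3 n₁, bernoulliBeta (k 2) (z₁ * z₂ * z₃)
          * ((Ring.choose (-(n₂ : ℤ)) (k 0) : ℤ) : ℂ) * ((Ring.choose (-(n₃ : ℤ)) (k 1) : ℤ) : ℂ)
          * mpl ![n₂ + k 0, n₃ + k 1] ![z₂⁻¹, z₃⁻¹] * (-1 : ℂ) ^ (n₂ + k 0 + n₃ + k 1) := by
  have hz₂₁ : -(z₂ * z₁) ∈ Complex.slitPlane := by rwa [mul_comm]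
  have hz' : -(z₂ * z₃ * z₁) ∈ Complex.slitPlane := by rwa [mul_comm, ← mul_assoc]
  have hz'' : -(z₁ * (z₂ * z₃)) ∈ Complex.slitPlane := by rwa [← mul_assoc]
  have i1 := integrable_halfKernel_mul₃ (Or.inl rfl) (Or.inl rfl) (Or.inl rfl) n₁ n₂ n₃
    (f := fun x => expSum (z₁ * z₂ * z₃) (x.1 + x.2.1 + x.2.2) *
      expSum (z₂ * z₃) (x.2.1 + x.2.2) * expSum z₃ x.2.2)
    ((((ExpBounded.expSum hz (1 / 2)).mul (ExpBounded.expSum hz₂₃ 0)).mul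
      (ExpBounded.expSum hz₃ 0)).congr fun x => by ring)
  have i2 := integrable_halfKernel_mul₃ (Or.inr rfl) (Or.inr rfl) (Or.inr rfl) n₁ n₂ n₃
    (f := fun x => expSumFull (z₁ * z₂ * z₃) (x.1 + x.2.1 + x.2.2) *
      expSumFull (z₂ * z₃) (x.2.1 + x.2.2) * expSumFull z₃ x.2.2)
    ((((ExpBounded.expSumFull hz (1 / 2)).mul (ExpBounded.expSumFull hz₂₃ 0)).mul
      (ExpBounded.expSumFull hz₃ 0)).congr fun x => by ring)
  obtain ⟨j1, e1⟩ := mpl_one_mul_parity_two h₁ h₂ h₃ hz₁ hz₃ hz₂₃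
  obtain ⟨j2, e2⟩ := mpl_merge_first h₁ h₂ h₃ hz₃ hz
  obtain ⟨j3, e3⟩ := mpl_two_mul_beta h₁ h₂ h₃ hz₁ hz₃ hz₂₁
  obtain ⟨j4, e4⟩ := mpl_merge_last h₁ h₂ h₃ hz₁ hz'
  obtain ⟨j5, e5⟩ := sum_beta_mul_mpl_inv_mul_mpl h₁ h₂ h₃ hz₁ hz₃ hz
  obtain ⟨j6, e6⟩ := sum_beta_mul_mpl_two h₁ h₂ h₃ hz₁ hz₂₁ hz
  obtain ⟨j7, e7⟩ := sum_beta_mul_mpl_inv_two h₁ h₂ h₃ hz₃ hz₂₃ hz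
  rw [e1, e2, e3, e4, e5, e6, e7, mpl_three h₁ h₂ h₃ (one_sub_mem_slitPlane hz₃)
    (one_sub_mem_slitPlane hz₂₃) (one_sub_mem_slitPlane hz),
    neg_one_pow_mul_mpl_inv_three h₁ h₂ h₃ hz₃ hz₂₃ hz, ← sub_eq_zero]
  -- Everything is moved to one side and into a single integral over ℝ³, whose integrand is then
  -- shown to vanish pointwise. The signs of `j3`, `j5`, `j6`, `j7` include the minus of the
  -- integral formula for β.
  have key := integral_add (i1.add i2) ((((((j2.add j3).sub j1).sub j4).sub j5).sub j6).sub j7)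
  rw [integral_add' i1 i2, integral_sub' (((((j2.add j3).sub j1).sub j4).sub j5).sub j6) j7,
    integral_sub' ((((j2.add j3).sub j1).sub j4).sub j5) j6,
    integral_sub' (((j2.add j3).sub j1).sub j4) j5,
    integral_sub' ((j2.add j3).sub j1) j4, integral_sub' (j2.add j3) j1,
    integral_add' j2 j3] at key
  refine Eq.trans ?_ (key.symm.trans (integral_eq_zero_of_ae (Eventually.of_forall fun x => ?_)))
  · ring
  · have a1 := expSum_mul_expSum hz₁ hz₂₃ hz'' x.1 (x.2.1 + x.2.2)
    have a2 := expSum_mul_expSum hz₁₂ hz₃ hz (x.1 + x.2.1) x.2.2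
    have a3 := expSum_mul_expSumFull hz₁₂ hz₃ hz (x.1 + x.2.1) x.2.2
    have a4 := expSum_mul_expSumFull hz₁ hz₂₃ hz'' x.1 (x.2.1 + x.2.2)
    have s1 : x.2.2 + x.1 + x.2.1 = x.1 + x.2.1 + x.2.2 := by ring
    have s2 : x.2.1 + x.2.2 + x.1 = x.1 + x.2.1 + x.2.2 := by ring
    have s3 : z₂ * z₃ * z₁ = z₁ * z₂ * z₃ := by ring
    rw [← mul_assoc, ← add_assoc] at a1 a4
    simp only [Pi.add_apply, Pi.sub_apply, Pi.zero_apply, betaIntegrand, zero_add, s1, s2, s3,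
      add_comm x.2.1 x.1, mul_comm z₂ z₁]
    -- Sector by sector: `a1` and `a2` settle (+,+,+), `a3` settles (+,+,-) and `a4` settles
    -- (+,-,-). On (-,-,-) the terms cancel directly.
    linear_combination
      (-halfKernel 1 n₁ x.1 * halfKernel 1 n₂ x.2.1 * halfKernel 1 n₃ x.2.2 * expSum z₃ x.2.2) * a1
      + (halfKernel 1 n₁ x.1 * halfKernel 1 n₂ x.2.1 * halfKernel 1 n₃ x.2.2 * expSum z₁ x.1) * a2
      + (halfKernel 1 n₁ x.1 * halfKernel 1 n₂ x.2.1 * halfKernel (-1) n₃ x.2.2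
        * expSum z₁ x.1) * a3
      + (halfKernel 1 n₁ x.1 * halfKernel (-1) n₂ x.2.1 * halfKernel (-1) n₃ x.2.2
        * expSumFull z₃ x.2.2) * a4

end DepthThree

/-! ### The module of functions of depth at most two -/

/-- The product `z_i ⋯ z_j` as a function on the domain. -/
def segProd (i j : Fin 3) (z : mplDomain 3) : ℂ := ∏ k ∈ Finset.Icc i j, z.1 k

theorem neg_segProd_mem_slitPlane {i j : Fin 3} (hij : i ≤ j) (z : mplDomain 3) :
    -segProd i j z ∈ Complex.slitPlane :=
  neg_mem_slitPlane_iff.2 (z.2 i j hij)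

theorem segProd_self (i : Fin 3) (z : mplDomain 3) : segProd i i z = z.1 i := by
  simp [segProd]

theorem segProd_zero_one (z : mplDomain 3) : segProd 0 1 z = z.1 0 * z.1 1 := by
  rw [segProd, show Finset.Icc (0 : Fin 3) 1 = {0, 1} by decide, Finset.prod_pair (by decide)]

theorem segProd_one_two (z : mplDomain 3) : segProd 1 2 z = z.1 1 * z.1 2 := by
  rw [segProd, show Finset.Icc (1 : Fin 3) 2 = {1, 2} by decide, Finset.prod_pair (by decide)]

theorem segProd_zero_two (z : mplDomain 3) : segProd 0 2 z = z.1 0 * z.1 1 * z.1 2 := by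
  rw [segProd, show Finset.Icc (0 : Fin 3) 2 = Finset.univ by decide, Fin.prod_univ_three]

/-- The product of `F` with one function `β` for each final product of the variables. -/
def betaMul (a b c : ℕ) (F : mplDomain 3 → ℂ) : mplDomain 3 → ℂ := fun z =>
  bernoulliBeta a (segProd 0 2 z) * bernoulliBeta b (segProd 1 2 z)
    * bernoulliBeta c (segProd 2 2 z) * F z

theorem betaMul_mem {a b c w : ℕ} (B : List (List (ℕ × Fin 3 × Fin 3))) {F : mplDomain 3 → ℂ}
    (hF : ∀ z, F z = (B.map fun b => mplFactor b z.1).prod) (h1 : ∀ b ∈ B, b ≠ [])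
    (h2 : ∀ x ∈ B.flatten, 1 ≤ x.1 ∧ x.2.1 ≤ x.2.2)
    (h3 : B.flatten.Pairwise fun x y => x.2.2 < y.2.1) (h4 : B.flatten.length ≤ 2)
    (hw : a + b + c + (B.flatten.map fun x => x.1).sum = w) :
    betaMul a b c F ∈ mplModule 3 2 w := by
  refine Submodule.subset_span ⟨![a, b, c], B, h1, h2, h3, h4, ?_, ?_⟩
  · rw [← hw, Fin.sum_univ_three]
    rfl
  · funext z
    rw [betaMul, hF, Fin.prod_univ_three]
    simp only [Ici_eq_Icc_last]
    rfl

theorem mplFactor_singleton (n : ℕ) (i j : Fin 3) (z : mplDomain 3) :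
    mplFactor [(n, i, j)] z.1 = mpl ![n] ![segProd i j z] := by
  unfold mplFactor segProd
  congr 1
  · ext m
    fin_cases m
    rfl
  · ext m
    fin_cases m
    rfl

theorem mplFactor_pair (m n : ℕ) (i j k l : Fin 3) (z : mplDomain 3) :
    mplFactor [(m, i, j), (n, k, l)] z.1 = mpl ![m, n] ![segProd i j z, segProd k l z] := by
  unfold mplFactor segProd
  congr 1
  · ext m
    fin_cases m <;> rfl
  · ext m
    fin_cases m <;> rfl

theorem betaMul_one_mem {a b c w : ℕ} (hw : a + b + c = w) :
    betaMul a b c (fun _ => 1) ∈ mplModule 3 2 w :=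
  betaMul_mem [] (by simp) (by simp) (by simp) (by simp) (by simp) (by simpa using hw)

theorem betaMul_mpl_one_mem {a b c n w : ℕ} {i j : Fin 3} (hn : 1 ≤ n) (hij : i ≤ j)
    (hw : a + b + c + n = w) :
    betaMul a b c (fun z => mpl ![n] ![segProd i j z]) ∈ mplModule 3 2 w :=
  betaMul_mem [[(n, i, j)]] (by simp [mplFactor_singleton]) (by simp) (by simp [hn, hij])
    (by simp) (by simp) (by simpa using hw)

theorem betaMul_mpl_one_mul_mem {a b c m n w : ℕ} {i j k l : Fin 3} (hm : 1 ≤ m) (hn : 1 ≤ n)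
    (hij : i ≤ j) (hjk : j < k) (hkl : k ≤ l) (hw : a + b + c + m + n = w) :
    betaMul a b c (fun z => mpl ![m] ![segProd i j z] * mpl ![n] ![segProd k l z])
      ∈ mplModule 3 2 w :=
  betaMul_mem [[(m, i, j)], [(n, k, l)]] (by simp [mplFactor_singleton]) (by simp)
    (by simp [hm, hn, hij, hkl]) (by simpa using hjk) (by simp) (by simp; omega)

theorem betaMul_mpl_two_mem {a b c m n w : ℕ} {i j k l : Fin 3} (hm : 1 ≤ m) (hn : 1 ≤ n)
    (hij : i ≤ j) (hjk : j < k) (hkl : k ≤ l) (hw : a + b + c + m + n = w) :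
    betaMul a b c (fun z => mpl ![m, n] ![segProd i j z, segProd k l z]) ∈ mplModule 3 2 w :=
  betaMul_mem [[(m, i, j), (n, k, l)]] (by simp [mplFactor_pair]) (by simp)
    (by simp [hm, hn, hij, hkl]) (by simpa using hjk) (by simp) (by simp; omega)

/-- The function `P` is `1` or a polylogarithm in the first variable, of weight `w`. -/
def IsFirstFactor (P : mplDomain 3 → ℂ) (w : ℕ) : Prop :=
  (P = fun _ => 1) ∧ w = 0 ∨ 1 ≤ w ∧ P = fun z => mpl ![w] ![segProd 0 0 z]

theorem IsFirstFactor.betaMul_mem {P : mplDomain 3 → ℂ} {v : ℕ} (hP : IsFirstFactor P v)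
    {a b c w : ℕ} (hw : a + b + c + v = w) : betaMul a b c P ∈ mplModule 3 2 w := by
  rcases hP with ⟨rfl, rfl⟩ | ⟨hv, rfl⟩
  · exact betaMul_one_mem hw
  · exact betaMul_mpl_one_mem hv le_rfl hw

theorem IsFirstFactor.betaMul_mul_mem {P : mplDomain 3 → ℂ} {v : ℕ} (hP : IsFirstFactor P v)
    {a b c n w : ℕ} {i j : Fin 3} (hn : 1 ≤ n) (hi : 0 < i) (hij : i ≤ j)
    (hw : a + b + c + v + n = w) :
    betaMul a b c (fun z => P z * mpl ![n] ![segProd i j z]) ∈ mplModule 3 2 w := by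
  rcases hP with ⟨rfl, rfl⟩ | ⟨hv, rfl⟩
  · have hw' : a + b + c + n = w := by omega
    simp only [one_mul]
    exact betaMul_mpl_one_mem hn hij hw'
  · exact betaMul_mpl_one_mul_mem hv hn le_rfl hi hij hw

theorem neg_one_pow_mul_mpl_inv_eq {n : ℕ} (hn : 1 ≤ n) {z : ℂ} (hz : -z ∈ Complex.slitPlane) :
    (-1 : ℂ) ^ n * mpl ![n] ![z⁻¹] = -bernoulliBeta n z - mpl ![n] ![z] := by
  rw [← parity_one hn hz]
  ring

/-- Parity in depth one replaces the inverse by β(z₃) and Li(z₃). A generator has only one β for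
each final product, so the slot for β(z₃) must be free, which is why it carries index 0. -/
theorem IsFirstFactor.betaMul_inv_mem {P : mplDomain 3 → ℂ} {v : ℕ} (hP : IsFirstFactor P v)
    {a b n w : ℕ} (hn : 1 ≤ n) (hw : a + b + v + n = w) :
    betaMul a b 0 (fun z => P z * ((-1 : ℂ) ^ n * mpl ![n] ![(segProd 2 2 z)⁻¹]))
      ∈ mplModule 3 2 w := by
  have h : betaMul a b 0 (fun z => P z * ((-1 : ℂ) ^ n * mpl ![n] ![(segProd 2 2 z)⁻¹]))
      = -betaMul a b n P - betaMul a b 0 (fun z => P z * mpl ![n] ![segProd 2 2 z]) := by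
    funext z
    simp only [betaMul, Pi.sub_apply, Pi.neg_apply, bernoulliBeta_zero,
      neg_one_pow_mul_mpl_inv_eq hn (neg_segProd_mem_slitPlane (le_refl (2 : Fin 3)) z)]
    ring
  rw [h]
  exact Submodule.sub_mem _ (Submodule.neg_mem _ (hP.betaMul_mem (by omega)))
    (hP.betaMul_mul_mem hn (by decide) le_rfl (by omega))

/-- Parity in depth two lowers the depth in (z₂, z₃) to one, leaving room for the factor in z₁. It
introduces β of z₂z₃ and of z₃, so both slots are kept at index 0. -/
theorem IsFirstFactor.betaMul_parity_two_mem {P : mplDomain 3 → ℂ} {v : ℕ}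
    (hP : IsFirstFactor P v) {a m n w : ℕ} (hm : 1 ≤ m) (hn : 1 ≤ n) (hw : a + v + m + n = w) :
    betaMul a 0 0 (fun z => P z * (mpl ![m, n] ![segProd 1 1 z, segProd 2 2 z]
      - (-1 : ℂ) ^ (m + n) * mpl ![m, n] ![(segProd 1 1 z)⁻¹, (segProd 2 2 z)⁻¹]))
      ∈ mplModule 3 2 w := by
  have h : betaMul a 0 0 (fun z => P z * (mpl ![m, n] ![segProd 1 1 z, segProd 2 2 z]
      - (-1 : ℂ) ^ (m + n) * mpl ![m, n] ![(segProd 1 1 z)⁻¹, (segProd 2 2 z)⁻¹]))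
      = -betaMul a 0 n (fun z => P z * mpl ![m] ![segProd 1 1 z])
        - betaMul a 0 0 (fun z => P z * mpl ![m + n] ![segProd 1 2 z])
        + ∑ k ∈ Finset.HasAntidiagonal.antidiagonal n, (Ring.choose (-(m : ℤ)) k.2 : ℤ) •
          betaMul a k.1 0 (fun z => P z * mpl ![m + k.2] ![segProd 1 1 z])
        + ∑ k ∈ Finset.HasAntidiagonal.antidiagonal m, (Ring.choose (-(n : ℤ)) k.2 : ℤ) •
          betaMul a k.1 0 (fun z => P z * ((-1 : ℂ) ^ (n + k.2) *
            mpl ![n + k.2] ![(segProd 2 2 z)⁻¹])) := by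
    funext z
    have e : segProd 1 2 z = segProd 1 1 z * segProd 2 2 z := by
      rw [segProd_one_two, segProd_self, segProd_self]
    have h12 := neg_segProd_mem_slitPlane (show (1 : Fin 3) ≤ 2 by decide) z
    rw [e] at h12
    simp only [Pi.add_apply, Pi.sub_apply, Pi.neg_apply, Finset.sum_apply, Pi.smul_apply]
    simp only [betaMul, zsmul_eq_mul, bernoulliBeta_zero, e]
    rw [parity_two hm hn (neg_segProd_mem_slitPlane le_rfl z) (neg_segProd_mem_slitPlane le_rfl z)
      h12]
    simp only [mul_add, mul_sub, Finset.mul_sum]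
    congr 1
    · congr 1
      · ring
      · exact Finset.sum_congr rfl fun k _ => by ring
    · exact Finset.sum_congr rfl fun k _ => by ring
  rw [h]
  refine Submodule.add_mem _ (Submodule.add_mem _ (Submodule.sub_mem _ (Submodule.neg_mem _ ?_) ?_)
    (Submodule.sum_mem _ fun k hk => Submodule.smul_mem _ _ ?_))
    (Submodule.sum_mem _ fun k hk => Submodule.smul_mem _ _ ?_)
  · exact hP.betaMul_mul_mem hm (by decide) le_rfl (by omega)
  · exact hP.betaMul_mul_mem (by omega) (by decide) (by decide) (by omega)
  · have := Finset.HasAntidiagonal.mem_antidiagonal.1 hk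
    exact hP.betaMul_mul_mem (by omega) (by decide) le_rfl (by omega)
  · have := Finset.HasAntidiagonal.mem_antidiagonal.1 hk
    exact hP.betaMul_inv_mem (by omega) (by omega)

/-- The generators demand arguments in increasing order. The quasi-shuffle product trades the
reversed pair for a product, the ordered pair and a merged term. -/
theorem betaMul_mpl_two_swap_mem {a c m n w : ℕ} {j : Fin 3} (hj : 1 ≤ j) (hm : 1 ≤ m)
    (hn : 1 ≤ n) (hw : a + c + m + n = w) :
    betaMul a 0 c (fun z => mpl ![m, n] ![segProd 1 j z, segProd 0 0 z]) ∈ mplModule 3 2 w := by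
  have e : ∀ z, segProd 0 0 z * segProd 1 j z = segProd 0 j z := by
    intro z
    fin_cases j
    · exact absurd hj (by decide)
    · simp [segProd_self, segProd_zero_one]
    · simp [segProd_self, segProd_zero_two, segProd_one_two, mul_assoc]
  have h : betaMul a 0 c (fun z => mpl ![m, n] ![segProd 1 j z, segProd 0 0 z])
      = betaMul a 0 c (fun z => mpl ![n] ![segProd 0 0 z] * mpl ![m] ![segProd 1 j z])
        - betaMul a 0 c (fun z => mpl ![n, m] ![segProd 0 0 z, segProd 1 j z])
        - betaMul a 0 c (fun z => mpl ![n + m] ![segProd 0 j z]) := by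
    funext z
    have h0 := neg_segProd_mem_slitPlane (Fin.zero_le j) z
    rw [← e] at h0
    have := mpl_one_mul_mpl_one hn hm (neg_segProd_mem_slitPlane (le_refl (0 : Fin 3)) z)
      (neg_segProd_mem_slitPlane hj z) h0
    simp only [betaMul, Pi.sub_apply, this, e]
    ring
  rw [h]
  refine Submodule.sub_mem _ (Submodule.sub_mem _ ?_ ?_) ?_
  · exact betaMul_mpl_one_mul_mem hn hm le_rfl (by omega) hj (by omega)
  · exact betaMul_mpl_two_mem hn hm le_rfl (by omega) hj (by omega)
  · exact betaMul_mpl_one_mem (by omega) (Fin.zero_le j) (by omega)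

/-! ### The main theorem -/

theorem parityMPL_two (m n : ℕ) (z w : ℂ) : parityMPL ![m, n] ![z, w]
    = mpl ![m, n] ![z, w] - (-1 : ℂ) ^ (m + n) * mpl ![m, n] ![z⁻¹, w⁻¹] := by
  have e : (fun i => (![z, w] i)⁻¹) = ![z⁻¹, w⁻¹] := by ext i; fin_cases i <;> rfl
  have h : (-1 : ℂ) ^ ((m : ℤ) + n - 2) = (-1) ^ (m + n) := by
    rw [zpow_sub₀ (by norm_num), ← Nat.cast_add, zpow_natCast]
    norm_num
  rw [parityMPL, e, Fin.sum_univ_two]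
  congr 2

theorem parityMPL_three (l m n : ℕ) (z : Fin 3 → ℂ) : parityMPL ![l, m, n] z
    = mpl ![l, m, n] ![z 0, z 1, z 2]
      + (-1 : ℂ) ^ (l + m + n) * mpl ![l, m, n] ![(z 0)⁻¹, (z 1)⁻¹, (z 2)⁻¹] := by
  have e : (fun i => (z i)⁻¹) = ![(z 0)⁻¹, (z 1)⁻¹, (z 2)⁻¹] := by ext i; fin_cases i <;> rfl
  have e' : z = ![z 0, z 1, z 2] := by ext i; fin_cases i <;> rfl
  -- Odd depth flips the sign, so the parity combination becomes a sum.
  have h : (-1 : ℂ) ^ ((l : ℤ) + m + n - 3) = -(-1) ^ (l + m + n) := by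
    rw [zpow_sub₀ (by norm_num), ← Nat.cast_add, ← Nat.cast_add, zpow_natCast]
    norm_num [div_neg]
  rw [parityMPL, e, Fin.sum_univ_three]
  have h' : (-1 : ℂ) ^ (((![l, m, n] 0 : ℕ) : ℤ) + ((![l, m, n] 1 : ℕ) : ℤ)
      + ((![l, m, n] 2 : ℕ) : ℤ) - ((3 : ℕ) : ℤ)) = -(-1) ^ (l + m + n) := h
  rw [h', ← e', sub_eq_add_neg, neg_mul, neg_neg]

/-- The explicit formula on the domain. -/
theorem parityMPL_three_eq {n₁ n₂ n₃ : ℕ} (h₁ : 1 ≤ n₁) (h₂ : 1 ≤ n₂) (h₃ : 1 ≤ n₃)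
    (z : mplDomain 3) : parityMPL ![n₁, n₂, n₃] z.1 =
      mpl ![n₁] ![segProd 0 0 z] * (mpl ![n₂, n₃] ![segProd 1 1 z, segProd 2 2 z]
          - (-1 : ℂ) ^ (n₂ + n₃) * mpl ![n₂, n₃] ![(segProd 1 1 z)⁻¹, (segProd 2 2 z)⁻¹])
        - mpl ![n₁ + n₂, n₃] ![segProd 0 1 z, segProd 2 2 z]
        + mpl ![n₂, n₁] ![segProd 1 1 z, segProd 0 0 z] * bernoulliBeta n₃ (segProd 2 2 z)
        + mpl ![n₂ + n₃, n₁] ![segProd 1 2 z, segProd 0 0 z]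
        - ∑ k ∈ Finset.Nat.antidiagonalTuple 3 n₂, bernoulliBeta (k 2) (segProd 0 2 z)
          * ((Ring.choose (-(n₃ : ℤ)) (k 0) : ℤ) : ℂ) * ((Ring.choose (-(n₁ : ℤ)) (k 1) : ℤ) : ℂ)
          * mpl ![n₃ + k 0] ![(segProd 2 2 z)⁻¹] * mpl ![n₁ + k 1] ![segProd 0 0 z]
          * (-1 : ℂ) ^ (n₃ + k 0)
        - ∑ k ∈ Finset.Nat.antidiagonalTuple 3 n₃, bernoulliBeta (k 2) (segProd 0 2 z)
          * ((Ring.choose (-(n₂ : ℤ)) (k 0) : ℤ) : ℂ) * ((Ring.choose (-(n₁ : ℤ)) (k 1) : ℤ) : ℂ)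
          * mpl ![n₂ + k 0, n₁ + k 1] ![segProd 1 1 z, segProd 0 0 z]
        - ∑ k ∈ Finset.Nat.antidiagonalTuple 3 n₁, bernoulliBeta (k 2) (segProd 0 2 z)
          * ((Ring.choose (-(n₂ : ℤ)) (k 0) : ℤ) : ℂ) * ((Ring.choose (-(n₃ : ℤ)) (k 1) : ℤ) : ℂ)
          * mpl ![n₂ + k 0, n₃ + k 1] ![(segProd 1 1 z)⁻¹, (segProd 2 2 z)⁻¹]
          * (-1 : ℂ) ^ (n₂ + k 0 + n₃ + k 1) := by
  have h12 := neg_segProd_mem_slitPlane (show (0 : Fin 3) ≤ 1 by decide) z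
  have h23 := neg_segProd_mem_slitPlane (show (1 : Fin 3) ≤ 2 by decide) z
  have h123 := neg_segProd_mem_slitPlane (show (0 : Fin 3) ≤ 2 by decide) z
  have hs := fun i => neg_segProd_mem_slitPlane (le_refl i) z
  simp only [segProd_self, segProd_zero_one, segProd_one_two, segProd_zero_two] at *
  rw [parityMPL_three, parity_three h₁ h₂ h₃ (hs 0) (hs 2) h12 h23 h123]

theorem parityMPL_three_mem {n₁ n₂ n₃ : ℕ} (h₁ : 1 ≤ n₁) (h₂ : 1 ≤ n₂) (h₃ : 1 ≤ n₃) :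
    (fun z : mplDomain 3 => parityMPL ![n₁, n₂, n₃] z.1) ∈ mplModule 3 2 (n₁ + n₂ + n₃) := by
  have hone : IsFirstFactor (fun _ => 1) 0 := Or.inl ⟨rfl, rfl⟩
  have hmpl : ∀ n, 1 ≤ n → IsFirstFactor (fun z => mpl ![n] ![segProd 0 0 z]) n :=
    fun n hn => Or.inr ⟨hn, rfl⟩
  have h : (fun z : mplDomain 3 => parityMPL ![n₁, n₂, n₃] z.1)
      = betaMul 0 0 0 (fun z => mpl ![n₁] ![segProd 0 0 z] *
          (mpl ![n₂, n₃] ![segProd 1 1 z, segProd 2 2 z]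
          - (-1 : ℂ) ^ (n₂ + n₃) * mpl ![n₂, n₃] ![(segProd 1 1 z)⁻¹, (segProd 2 2 z)⁻¹]))
        - betaMul 0 0 0 (fun z => mpl ![n₁ + n₂, n₃] ![segProd 0 1 z, segProd 2 2 z])
        + betaMul 0 0 n₃ (fun z => mpl ![n₂, n₁] ![segProd 1 1 z, segProd 0 0 z])
        + betaMul 0 0 0 (fun z => mpl ![n₂ + n₃, n₁] ![segProd 1 2 z, segProd 0 0 z])
        - ∑ k ∈ Finset.Nat.antidiagonalTuple 3 n₂, (Ring.choose (-(n₃ : ℤ)) (k 0)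
          * Ring.choose (-(n₁ : ℤ)) (k 1) : ℤ) • betaMul (k 2) 0 0 (fun z =>
            mpl ![n₁ + k 1] ![segProd 0 0 z] *
              ((-1 : ℂ) ^ (n₃ + k 0) * mpl ![n₃ + k 0] ![(segProd 2 2 z)⁻¹]))
        - ∑ k ∈ Finset.Nat.antidiagonalTuple 3 n₃, (Ring.choose (-(n₂ : ℤ)) (k 0)
          * Ring.choose (-(n₁ : ℤ)) (k 1) : ℤ) • betaMul (k 2) 0 0 (fun z =>
            mpl ![n₂ + k 0, n₁ + k 1] ![segProd 1 1 z, segProd 0 0 z])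
        - ∑ k ∈ Finset.Nat.antidiagonalTuple 3 n₁, (Ring.choose (-(n₂ : ℤ)) (k 0)
          * Ring.choose (-(n₃ : ℤ)) (k 1) : ℤ) •
            -- The signed polylogarithm at (1/z₂, 1/z₃) is written as the one at (z₂, z₃) minus the
            -- parity combination. The factor 1 stands for the trivial first factor, so the lemma
            -- for a product with Li(z₁) also covers this case.
            (betaMul (k 2) 0 0 (fun z => mpl ![n₂ + k 0, n₃ + k 1] ![segProd 1 1 z, segProd 2 2 z])
            - betaMul (k 2) 0 0 (fun z => 1 *
              (mpl ![n₂ + k 0, n₃ + k 1] ![segProd 1 1 z, segProd 2 2 z]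
              - (-1 : ℂ) ^ (n₂ + k 0 + (n₃ + k 1)) *
                mpl ![n₂ + k 0, n₃ + k 1] ![(segProd 1 1 z)⁻¹, (segProd 2 2 z)⁻¹]))) := by
    funext z
    rw [parityMPL_three_eq h₁ h₂ h₃]
    simp only [Pi.add_apply, Pi.sub_apply, Finset.sum_apply, Pi.smul_apply]
    simp only [betaMul, zsmul_eq_mul, bernoulliBeta_zero, one_mul, Int.cast_mul]
    congr 1
    · congr 1
      · congr 1
        · ring
        · exact Finset.sum_congr rfl fun k _ => by ring
      · exact Finset.sum_congr rfl fun k _ => by ring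
    · exact Finset.sum_congr rfl fun k _ => by ring
  have hk : ∀ {n : ℕ} {k : Fin 3 → ℕ}, k ∈ Finset.Nat.antidiagonalTuple 3 n →
      k 0 + k 1 + k 2 = n := fun hk => by
    rwa [Finset.Nat.mem_antidiagonalTuple, Fin.sum_univ_three] at hk
  rw [h]
  refine Submodule.sub_mem _ (Submodule.sub_mem _ (Submodule.sub_mem _ (Submodule.add_mem _
    (Submodule.add_mem _ (Submodule.sub_mem _ ?_ ?_) ?_) ?_)
    (Submodule.sum_mem _ fun k hk' => Submodule.smul_mem _ _ ?_))
    (Submodule.sum_mem _ fun k hk' => Submodule.smul_mem _ _ ?_))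
    (Submodule.sum_mem _ fun k hk' => Submodule.smul_mem _ _ (Submodule.sub_mem _ ?_ ?_))
  · exact (hmpl n₁ h₁).betaMul_parity_two_mem h₂ h₃ (by omega)
  · exact betaMul_mpl_two_mem (by omega) h₃ (by decide) (by decide) le_rfl (by omega)
  · exact betaMul_mpl_two_swap_mem le_rfl h₂ h₁ (by omega)
  · exact betaMul_mpl_two_swap_mem (by decide) (by omega) h₁ (by omega)
  · have := hk hk'
    exact (hmpl (n₁ + k 1) (by omega)).betaMul_inv_mem (by omega) (by omega)
  · have := hk hk'
    exact betaMul_mpl_two_swap_mem le_rfl (by omega) (by omega) (by omega)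
  · have := hk hk'
    exact betaMul_mpl_two_mem (by omega) (by omega) le_rfl (by decide) le_rfl (by omega)
  · have := hk hk'
    exact hone.betaMul_parity_two_mem (by omega) (by omega) (by omega)

end

theorem mainTheorem6 :
    -- the analytic continuation along the straight path exists on the whole domain
    (∀ (d : ℕ) (n : Fin d → ℕ) (z : Fin d → ℂ), (∀ i, 1 ≤ n i) → z ∈ mplDomain d →
      IsMPLValue n z (mpl n z)) ∧
    ∀ n₁ n₂ n₃ : ℕ, 1 ≤ n₁ → 1 ≤ n₂ → 1 ≤ n₃ →
      -- the explicit formula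
      (∀ z₁ z₂ z₃ : ℂ, ![z₁, z₂, z₃] ∈ mplDomain 3 →
        parityMPL ![n₁, n₂, n₃] ![z₁, z₂, z₃] =
          mpl ![n₁] ![z₁] * parityMPL ![n₂, n₃] ![z₂, z₃]
          - mpl ![n₁ + n₂, n₃] ![z₁ * z₂, z₃]
          + mpl ![n₂, n₁] ![z₂, z₁] * bernoulliBeta n₃ z₃
          + mpl ![n₂ + n₃, n₁] ![z₂ * z₃, z₁]
          - ∑ x ∈ Finset.Nat.antidiagonalTuple 3 n₂,
              bernoulliBeta (x 2) (z₁ * z₂ * z₃)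
                * ((Ring.choose (-(n₃ : ℤ)) (x 0) : ℤ) : ℂ)
                * ((Ring.choose (-(n₁ : ℤ)) (x 1) : ℤ) : ℂ)
                * mpl ![n₃ + x 0] ![z₃⁻¹] * mpl ![n₁ + x 1] ![z₁]
                * (-1 : ℂ) ^ (n₃ + x 0)
          - ∑ x ∈ Finset.Nat.antidiagonalTuple 3 n₃,
              bernoulliBeta (x 2) (z₁ * z₂ * z₃)
                * ((Ring.choose (-(n₂ : ℤ)) (x 0) : ℤ) : ℂ)
                * ((Ring.choose (-(n₁ : ℤ)) (x 1) : ℤ) : ℂ)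
                * mpl ![n₂ + x 0, n₁ + x 1] ![z₂, z₁]
          - ∑ x ∈ Finset.Nat.antidiagonalTuple 3 n₁,
              bernoulliBeta (x 2) (z₁ * z₂ * z₃)
                * ((Ring.choose (-(n₂ : ℤ)) (x 0) : ℤ) : ℂ)
                * ((Ring.choose (-(n₃ : ℤ)) (x 1) : ℤ) : ℂ)
                * mpl ![n₂ + x 0, n₃ + x 1] ![z₂⁻¹, z₃⁻¹]
                * (-1 : ℂ) ^ (n₂ + x 0 + n₃ + x 1)) ∧
      -- membership in the module of depth at most two
      (fun z : mplDomain 3 => parityMPL ![n₁, n₂, n₃] z.1) ∈ mplModule 3 2 (n₁ + n₂ + n₃) := by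
  refine ⟨fun d n z hn hz => isMPLValue_mpl hn (mplDomain_subset_mplCutDomain d hz),
    fun n₁ n₂ n₃ h₁ h₂ h₃ => ⟨fun z₁ z₂ z₃ hz => ?_, parityMPL_three_mem h₁ h₂ h₃⟩⟩
  have h := parityMPL_three_eq h₁ h₂ h₃ ⟨_, hz⟩
  simp only [segProd_self, segProd_zero_one, segProd_one_two, segProd_zero_two] at h
  rw [parityMPL_two]
  exact h
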